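/- **Setting.** A signature $\sigma$ consists of relation symbols of positive arity and of constant symbols. $\mathcal R(\sigma)$ is the category of $\sigma$-structures (possibly empty or infinite) and functions preserving relations and constants, and $\mathcal R_0(\sigma)$ is its discrete subcategory. An *embedding* in $\mathcal R(\sigma)$ is an injective homomorphism that reflects relations. $\sigma^I$ is $\sigma$ with a fresh binary relation symbol $I$, and $\mathfrak t^I\colon\mathcal R_0(\sigma)\to\mathcal R(\sigma^I)$ interprets $I$ as equality. Fix an integer $k\ge 1$. **Comonads.** In each case the underlying set consists of certain non-empty words, together with the constant symbols. The counit $\varepsilon$ sends a word to (the element in) its last letter and a constant symbol to its interpretation. The coextension $h^*$ of $h$ fixes constant symbols and replaces (the element in) each letter of a word by the value of $h$ at the initial segment ending at that letter. * $\mathbb E_k(A)$: words over $A$ of length $\le k$; $R(s_1,\dots,s_r)$ holds iff those $s_i$ that are words are pairwise comparable in the prefix order and $R^A(\varepsilon(s_1),\dots,\varepsilon(s_r))$. * $\mathbb P_k(A)$: words over $\{0,\dots,k-1\}\times A$; $R(s_1,\dots,s_r)$ holds iff the same two conditions hold and, whenever $s_i\le s_j$ are words, the index in the last letter of $s_i$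 does not occur in the part of $s_j$ after $s_i$. * $\mathbb M_k(A)$, for modal signatures (a single constant $c_0$, a single binary symbol $E$, finitely many unary symbols): words $[a_1,\dots,a_m]$, $m\le k$, with $E^A(c_0^A,a_1)$ and $E^A(a_i,a_{i+1})$ for all $i<m$; $E(s,s')$ holds iff $s=c_0$ and $s'$ has length one, or $s,s'$ are words and $s'$ covers $s$ in the prefix order; $P(s)$ iff $P^A(\varepsilon(s))$ for unary $P$. **Open pathwise-embeddings.** Let $\mathbb C$ be one of these comonads, $\mathrm{EM}(\mathbb C)$ its category of coalgebras, and $F^{\mathbb C}$ the cofree coalgebra functor. A coalgebra morphism is an embedding if its underlying homomorphism is. A coalgebra $(P,\pi)$ is a *path* if only finitely many elements of $P$ are sent by $\pi$ to words, and these words are pairwise comparable in the prefix order. A coalgebra morphism $h\colon X\to Y$ is an *open pathwise-embedding* if (i) $h\circ e$ is an embedding for every embedding $e\colon P\to X$ with $P$ a path, and (ii) for all embeddings $e\colon P\to X$, $j\colon P\to Q$, $m\colon Q\to Y$ with $P,Q$ paths and $h\circ e=m\circ j$, there is $d\colon Q\to X$ with $d\circ j=e$ and $h\circ d=m$. **Smoothness.**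 Let $\mathbb C_i$ ($1\le i\le n+1$) be such comonads on categories $\mathcal C_i$. A *Kleisli law* for a functor $H'\colon\prod_{i\le n}\mathcal C_i\to\mathcal C_{n+1}$ is a natural transformation $\kappa\colon\mathbb C_{n+1}\circ H'\to H'\circ\prod_i\mathbb C_i$ with $H'(\vec\varepsilon)\circ\kappa=\varepsilon$ and $H'(\vec\delta)\circ\kappa=\kappa\circ\mathbb C_{n+1}\kappa\circ\delta$. The lifting $\widehat{H'}(\vec\alpha)$ of $H'$ at coalgebras $(A_i,\alpha_i)$ is the equaliser in $\mathrm{EM}(\mathbb C_{n+1})$ of $$F^{\mathbb C_{n+1}}(\kappa)\circ\delta,\ F^{\mathbb C_{n+1}}(H'(\vec\alpha))\colon\ F^{\mathbb C_{n+1}}(H'(\vec{A}))\rightrightarrows F^{\mathbb C_{n+1}}(H'(\overrightarrow{\mathbb C_iA_i})),$$ and $\widehat{H'}(\vec f)$ is the morphism of equalisers induced by $F^{\mathbb C_{n+1}}(H'(\vec f))$. The law $\kappa$ is *smooth* if $\widehat{H'}(\vec f)$ is an open pathwise-embedding for every tuple $\vec f$ of open pathwise-embeddings. An operation (a functor) $H\colon\prod_{i\le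 n}\mathcal R_0(\sigma_i)\to\mathcal R_0(\sigma_{n+1})$ is *smooth relative to* functors $\mathfrak t_i\colon\mathcal R_0(\sigma_i)\to\mathcal C_i$ if there are a functor $H'\colon\prod_{i\le n}\mathcal C_i\to\mathcal C_{n+1}$, a smooth Kleisli law $\kappa$ for $H'$, and a natural transformation $\theta\colon H'\circ\prod_i\mathfrak t_i\to\mathfrak t_{n+1}\circ H$ such that every component of $F^{\mathbb C_{n+1}}(\theta)$ is an open pathwise-embedding. $H$ is *FO-$\mathbb E_k$-smooth* (resp. *FO-$\mathbb P_k$-smooth*) if this holds with $\mathfrak t_i=\mathfrak t^I$ and all $\mathbb C_i$ the comonad $\mathbb E_k$ (resp. $\mathbb P_k$) on $\mathcal R(\sigma_i^I)$. For modal signatures $H$ is *$\mathbb M_k$-smooth* if this holds with $\mathfrak t_i$ the inclusion $\mathcal R_0(\sigma_i)\to\mathcal R(\sigma_i)$ and all $\mathbb C_i=\mathbb M_k$. **Corollary.** Let $k\ge1$, $n\ge0$, and let $H\colon\prod_{i=1}^n\mathcal R_0(\sigma_i)\to\mathcal R_0(\sigma_{n+1})$ be an operation. Let $A_i,B_i$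 be $\sigma_i$-structures ($1\le i\le n$). 1. Suppose $\sigma_1,\dots,\sigma_n$ are finite and $H$ is FO-$\mathbb E_k$-smooth. If, for every $i$, $A_i$ and $B_i$ satisfy the same first-order sentences (with equality) of quantifier rank $\le k$, then so do $H(A_1,\dots,A_n)$ and $H(B_1,\dots,B_n)$. 2. Suppose $H$ is FO-$\mathbb P_k$-smooth. If, for every $i$, $A_i$ and $B_i$ satisfy the same sentences of the infinitary $k$-variable logic $L^k_{\infty\omega}$ (with equality), then so do $H(A_1,\dots,A_n)$ and $H(B_1,\dots,B_n)$. If all $A_i,B_i$ are finite and, for every $i$, $A_i$ and $B_i$ satisfy the same $k$-variable first-order sentences, then so do $H(A_1,\dots,A_n)$ and $H(B_1,\dots,B_n)$. 3. Suppose all $\sigma_i$ are modal signatures and $H$ is $\mathbb M_k$-smooth. If, for every $i$, $A_i$ and $B_i$ satisfy at their distinguished points $c_0$ the same modal formulas of modal depth $\le k$, then so do $H(A_1,\dots,A_n)$ and $H(B_1,\dots,B_n)$. -/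

import Mathlib

open CategoryTheory CategoryTheory.Limits

universe v u

/-! ## Signatures, structures, homomorphisms -/

/-- A signature: relation symbols of positive arity, and constant symbols. -/
structure Signature : Type (u + 1) where
  Rel : Type u
  arity : Rel → ℕ
  arity_pos : ∀ R, 0 < arity R
  Const : Type u

/-- A `σ`-structure. -/
structure Str (σ : Signature.{u}) : Type (u + 1) where
  carrier : Type u
  rel : ∀ R : σ.Rel, (Fin (σ.arity R) → carrier) → Prop
  con : σ.Const → carrier

/-- Homomorphisms of `σ`-structures: functions preserving relations and constants. -/
@[ext]
structure StrHom {σ : Signature.{u}} (A B : Str σ) : Type u where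
  toFun : A.carrier → B.carrier
  map_rel : ∀ (R : σ.Rel) (x : Fin (σ.arity R) → A.carrier),
    A.rel R x → B.rel R (fun i => toFun (x i))
  map_con : ∀ c : σ.Const, toFun (A.con c) = B.con c

/-- The category of `σ`-structures and homomorphisms. -/
instance Str.category (σ : Signature.{u}) : Category.{u} (Str σ) where
  Hom A B := StrHom A B
  id A := ⟨fun x => x, fun _ _ h => h, fun _ => rfl⟩
  comp f g := ⟨fun x => g.toFun (f.toFun x), fun R x h => g.map_rel R _ (f.map_rel R x h),
    fun c => by rw [f.map_con, g.map_con]⟩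

/-- Embeddings of `σ`-structures: injective homomorphisms that reflect relations. -/
def strongInj (σ : Signature.{u}) : MorphismProperty (Str σ) := fun A B f =>
  Function.Injective (StrHom.toFun f) ∧
    ∀ (R : σ.Rel) (x : Fin (σ.arity R) → A.carrier),
      B.rel R (fun i => StrHom.toFun f (x i)) → A.rel R x

/-- The signature `σ` extended by a fresh binary relation symbol `I` (here `none`). -/
def Signature.addI (σ : Signature.{u}) : Signature.{u} where
  Rel := Option σ.Rel
  arity R := match R with
    | some R => σ.arity R
    | none => 2
  arity_pos R := match R with
    | some R => σ.arity_pos R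
    | none => Nat.two_pos
  Const := σ.Const

/-- The structure `(A, I)` where `I` is interpreted as equality. -/
def Str.withI {σ : Signature.{u}} (A : Str σ) : Str σ.addI where
  carrier := A.carrier
  rel R := match R with
    | some R => A.rel R
    | none => fun x : Fin 2 → A.carrier => x 0 = x 1
  con := A.con

/-- The translation functor from the discrete category of `σ`-structures, which interprets the
fresh relation symbol `I` as equality. -/
def trI (σ : Signature.{u}) : Discrete (Str σ) ⥤ Str σ.addI :=
  Discrete.functor Str.withI

/-- The inclusion of the discrete category of `σ`-structures (the translation functor used for
logics without equality). -/
def trIncl (σ : Signature.{u}) : Discrete (Str σ) ⥤ Str σ :=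
  Discrete.functor fun A => A

/-! ## Comonads in Kleisli form -/

/-- A comonad in Kleisli form. -/
structure KleisliComonad (C : Type v) [Category.{u} C] where
  obj : C → C
  counit : ∀ A, obj A ⟶ A
  coext : ∀ {A B}, (obj A ⟶ B) → (obj A ⟶ obj B)
  coext_counit : ∀ A, coext (counit A) = 𝟙 (obj A)
  coext_comp_counit : ∀ {A B} (f : obj A ⟶ B), coext f ≫ counit B = f
  coext_comp : ∀ {A B D} (f : obj A ⟶ B) (g : obj B ⟶ D),
    coext (coext f ≫ g) = coext f ≫ coext g

/-- The comonad given by a comonad in Kleisli form: `G f = (f ∘ ε)^*` and `δ = id^*`. -/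
def KleisliComonad.toComonad {C : Type v} [Category.{u} C] (K : KleisliComonad C) :
    Comonad C where
  obj := K.obj
  map {A _} f := K.coext (K.counit A ≫ f)
  map_id A := by rw [Category.comp_id, K.coext_counit]
  map_comp {A B D} f g := by
    rw [← K.coext_comp, ← Category.assoc (K.coext _), K.coext_comp_counit, Category.assoc]
  ε :=
    { app := K.counit
      naturality := fun A B f => K.coext_comp_counit _ }
  δ :=
    { app := fun A => K.coext (𝟙 (K.obj A))
      naturality := fun A B f => by
        change K.coext (K.counit A ≫ f) ≫ K.coext (𝟙 _) =
          K.coext (𝟙 _) ≫ K.coext (K.counit _ ≫ K.coext (K.counit A ≫ f))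
        rw [← K.coext_comp, ← K.coext_comp, ← Category.assoc (K.coext _), K.coext_comp_counit,
          Category.comp_id, Category.id_comp] }
  coassoc A := by
    change K.coext (𝟙 _) ≫ K.coext (K.counit _ ≫ K.coext (𝟙 _)) =
      K.coext (𝟙 _) ≫ K.coext (𝟙 _)
    rw [← K.coext_comp, ← K.coext_comp, ← Category.assoc (K.coext _), K.coext_comp_counit,
      Category.comp_id, Category.id_comp]
  left_counit A := K.coext_comp_counit _
  right_counit A := by
    change K.coext (𝟙 _) ≫ K.coext (K.counit _ ≫ K.counit A) = 𝟙 _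
    rw [← K.coext_comp, ← Category.assoc (K.coext _), K.coext_comp_counit, Category.id_comp,
      K.coext_counit]

/-! ## Open pathwise-embeddings, Kleisli laws and smoothness, for arbitrary comonads -/

section General

variable {C : Type v} [Category.{u} C]

/-- Embeddings of coalgebras: the coalgebra morphisms whose underlying morphism is an embedding. -/
def coalgEmb (emb : MorphismProperty C) (G : Comonad C) : MorphismProperty G.Coalgebra :=
  fun _ _ h => emb (Comonad.Coalgebra.Hom.f h)

/-- `h` is a pathwise-embedding: its composite with any path embedding is an embedding. -/
def IsPathwiseEmb (emb : MorphismProperty C) (path : ObjectProperty C) {X Y : C} (h : X ⟶ Y) :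
    Prop :=
  ∀ (P : C) (e : P ⟶ X), path P → emb e → emb (e ≫ h)

/-- `h` is open: every square with embeddings `P ↣ X`, `P ↣ Q`, `Q ↣ Y`, where `P` and `Q` are
paths, has a diagonal filler. -/
def IsOpenMor (emb : MorphismProperty C) (path : ObjectProperty C) {X Y : C} (h : X ⟶ Y) :
    Prop :=
  ∀ (P Q : C) (e : P ⟶ X) (j : P ⟶ Q) (m : Q ⟶ Y), path P → path Q → emb e → emb j → emb m →
    e ≫ h = j ≫ m → ∃ d : Q ⟶ X, j ≫ d = e ∧ d ≫ h = m

/-- Open pathwise-embeddings in the category of `G`-coalgebras. -/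
def IsOPE (emb : MorphismProperty C) (G : Comonad C) (path : ObjectProperty G.Coalgebra)
    {X Y : G.Coalgebra} (h : X ⟶ Y) : Prop :=
  IsPathwiseEmb (coalgEmb emb G) path h ∧ IsOpenMor (coalgEmb emb G) path h

/-- The coalgebra morphism `G f ∘ δ` from the cofree coalgebra on `X` to the one on `Y`. -/
def cofreeLift (G : Comonad C) {X Y : C} (f : G.obj X ⟶ Y) :
    G.cofree.obj X ⟶ G.cofree.obj Y where
  f := G.δ.app X ≫ G.map f
  h := by
    change G.δ.app X ≫ G.map (G.δ.app X ≫ G.map f) = (G.δ.app X ≫ G.map f) ≫ G.δ.app Y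
    rw [Functor.map_comp, Category.assoc, G.delta_naturality, Comonad.coassoc_assoc]

variable {n : ℕ} {B : Fin n → Type v} [∀ i, Category.{u} (B i)]

/-- A Kleisli law `D ∘ H → H ∘ ∏ G i`. -/
structure KleisliLaw (H : (∀ i, B i) ⥤ C) (G : ∀ i, Comonad (B i)) (D : Comonad C) where
  κ : H ⋙ D.toFunctor ⟶ Functor.pi (fun i => (G i).toFunctor) ⋙ H
  /-- `H(ε) ∘ κ = ε`. -/
  counit : ∀ X : ∀ i, B i,
    κ.app X ≫ H.map (Y := X) (fun i => (G i).ε.app (X i)) = D.ε.app (H.obj X)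
  /-- `H(δ) ∘ κ = κ ∘ D κ ∘ δ`. -/
  comult : ∀ X : ∀ i, B i,
    κ.app X ≫ H.map (X := fun i => (G i).obj (X i)) (Y := fun i => (G i).obj ((G i).obj (X i)))
        (fun i => (G i).δ.app (X i)) =
      D.δ.app (H.obj X) ≫ D.map (κ.app X) ≫ κ.app (fun i => (G i).obj (X i))

namespace KleisliLaw

variable {H : (∀ i, B i) ⥤ C} {G : ∀ i, Comonad (B i)} {D : Comonad C} (L : KleisliLaw H G D)

/-- The first of the two parallel morphisms `F(H(X)) ⇉ F(H(G X))` whose equaliser is the lifting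
of `H` at a tuple of coalgebras, where `F` is the cofree coalgebra functor: `F(κ) ∘ δ`. -/
def parLeft (α : ∀ i, (G i).Coalgebra) :
    D.cofree.obj (H.obj fun i => (α i).A) ⟶
      D.cofree.obj (H.obj fun i => (G i).obj (α i).A) :=
  cofreeLift D (L.κ.app fun i => (α i).A)

/-- The second of the two parallel morphisms: `F(H(α))`. -/
def parRight (_ : KleisliLaw H G D) (α : ∀ i, (G i).Coalgebra) :
    D.cofree.obj (H.obj fun i => (α i).A) ⟶
      D.cofree.obj (H.obj fun i => (G i).obj (α i).A) :=
  D.cofree.map (H.map (X := fun i => (α i).A) (Y := fun i => (G i).obj (α i).A)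
    fun i => (α i).a)

/-- `h` is (a representative of) the lifting of `H` at the tuple `f` of coalgebra morphisms: its
source and target are equalisers of the pairs above, and it is the morphism induced between them
by `F(H(f))`. -/
def IsLift {α β : ∀ i, (G i).Coalgebra} (f : ∀ i, α i ⟶ β i)
    (s : Fork (L.parLeft α) (L.parRight α)) (t : Fork (L.parLeft β) (L.parRight β))
    (h : s.pt ⟶ t.pt) : Prop :=
  Nonempty (IsLimit s) ∧ Nonempty (IsLimit t) ∧
    h ≫ t.ι = s.ι ≫ D.cofree.map (H.map (X := fun i => (α i).A) (Y := fun i => (β i).A)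
      fun i => (f i).f)

/-- The Kleisli law is smooth: the lifting of `H` to coalgebras sends tuples of open
pathwise-embeddings to open pathwise-embeddings. -/
def IsSmooth (embB : ∀ i, MorphismProperty (B i)) (embC : MorphismProperty C)
    (pathB : ∀ i, ObjectProperty (G i).Coalgebra) (pathC : ObjectProperty D.Coalgebra) : Prop :=
  ∀ (α β : ∀ i, (G i).Coalgebra) (f : ∀ i, α i ⟶ β i),
    (∀ i, IsOPE (embB i) (G i) (pathB i) (f i)) →
    ∀ (s : Fork (L.parLeft α) (L.parRight α)) (t : Fork (L.parLeft β) (L.parRight β))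
      (h : s.pt ⟶ t.pt), L.IsLift f s t h → IsOPE embC D pathC h

end KleisliLaw

/-- The operation `H` is `(G 1, …, G n, D)`-smooth relative to the translation functors
`tr 1, …, tr n, trD`. -/
def IsSmoothRel {σ : Fin n → Signature.{u}} {τ : Signature.{u}}
    (H : (∀ i, Discrete (Str (σ i))) ⥤ Discrete (Str τ))
    (tr : ∀ i, Discrete (Str (σ i)) ⥤ B i) (trD : Discrete (Str τ) ⥤ C)
    (embB : ∀ i, MorphismProperty (B i)) (embC : MorphismProperty C)
    (G : ∀ i, Comonad (B i)) (D : Comonad C)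
    (pathB : ∀ i, ObjectProperty (G i).Coalgebra) (pathC : ObjectProperty D.Coalgebra) : Prop :=
  ∃ (Htr : (∀ i, B i) ⥤ C) (θ : Functor.pi tr ⋙ Htr ⟶ H ⋙ trD) (L : KleisliLaw Htr G D),
    L.IsSmooth embB embC pathB pathC ∧
      ∀ X, IsOPE embC D pathC (D.cofree.map (θ.app X))

end General

/-- `H` preserves a family of relations on structures. -/
def Preserves {n : ℕ} {σ : Fin n → Signature.{u}} {τ : Signature.{u}}
    (H : (∀ i, Discrete (Str (σ i))) ⥤ Discrete (Str τ))
    (E : ∀ i, Str (σ i) → Str (σ i) → Prop) (E' : Str τ → Str τ → Prop) : Prop :=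
  ∀ A B : ∀ i, Str (σ i), (∀ i, E i (A i) (B i)) →
    E' (H.obj fun i => ⟨A i⟩).as (H.obj fun i => ⟨B i⟩).as

/-! ## Words -/

/-- Non-empty words over `A`; `len` is the length minus one. -/
structure Word (A : Type u) : Type u where
  len : ℕ
  val : Fin (len + 1) → A

namespace Word

variable {A : Type u}

/-- The last letter. -/
def last (w : Word A) : A := w.val (Fin.last w.len)

/-- The initial segment of `w` that ends at position `i`. -/
def take (w : Word A) (i : Fin (w.len + 1)) : Word A :=
  ⟨i.1, fun j => w.val (Fin.castLE i.2 j)⟩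

/-- `w` is a (not necessarily proper) initial segment of `w'`. -/
def Le (w w' : Word A) : Prop := ∃ i, w'.take i = w

def Comparable (w w' : Word A) : Prop := w.Le w' ∨ w'.Le w

end Word

/-- For the underlying function `α` of a coalgebra: the elements that are sent to words (i.e. the
non-constant elements) are finitely many, and their words are pairwise comparable. -/
def IsFiniteChain {X W C : Type u} (cmp : W → W → Prop) (α : X → W ⊕ C) : Prop :=
  {x | ∃ w, α x = Sum.inl w}.Finite ∧
    ∀ x y w w', α x = Sum.inl w → α y = Sum.inl w' → cmp w w'

/-! ## The Ehrenfeucht–Fraïssé comonad -/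

namespace EF

variable {σ : Signature.{u}} (k : ℕ)

/-- The universe: non-empty words of length at most `k`, and the constant symbols. -/
abbrev Carrier (A : Str σ) : Type u := {w : Word A.carrier // w.len < k} ⊕ σ.Const

variable {k}

def eps (A : Str σ) : Carrier k A → A.carrier
  | Sum.inl w => w.1.last
  | Sum.inr c => A.con c

variable (k)

def obj (A : Str σ) : Str σ where
  carrier := Carrier k A
  rel R s := (∀ i j w w', s i = Sum.inl w → s j = Sum.inl w' → w.1.Comparable w'.1) ∧
    A.rel R (fun i => eps A (s i))
  con c := Sum.inr c

def counit (A : Str σ) : obj k A ⟶ A where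
  toFun := eps A
  map_rel _ _ h := h.2
  map_con _ := rfl

variable {k}

/-- The initial segment of a word, as an element of the universe. -/
def seg {A : Str σ} (w : {w : Word A.carrier // w.len < k}) (i : Fin (w.1.len + 1)) :
    Carrier k A :=
  Sum.inl ⟨w.1.take i, lt_of_le_of_lt (Nat.lt_succ_iff.mp i.2) w.2⟩

/-- Replace every letter by the value of `h` at the initial segment ending there. -/
def wordMap {A B : Str σ} (h : Carrier k A → B.carrier)
    (w : {w : Word A.carrier // w.len < k}) : {w : Word B.carrier // w.len < k} :=
  ⟨⟨w.1.len, fun i => h (seg w i)⟩, w.2⟩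

def coextFun {A B : Str σ} (h : Carrier k A → B.carrier) : Carrier k A → Carrier k B
  | Sum.inl w => Sum.inl (wordMap h w)
  | Sum.inr c => Sum.inr c

theorem eps_coextFun {A B : Str σ} (h : obj k A ⟶ B) (x : Carrier k A) :
    eps B (coextFun h.toFun x) = h.toFun x := by
  cases x with
  | inl w => rfl
  | inr c => exact (h.map_con c).symm

theorem le_wordMap {A B : Str σ} (h : Carrier k A → B.carrier)
    {w w' : {w : Word A.carrier // w.len < k}} (hw : w.1.Le w'.1) :
    (wordMap h w).1.Le (wordMap h w').1 := by
  obtain ⟨w, hk⟩ := w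
  obtain ⟨i, rfl⟩ := hw
  exact ⟨i, rfl⟩

theorem exists_of_coextFun {A B : Str σ} {h : Carrier k A → B.carrier} {x : Carrier k A}
    {w : {w : Word B.carrier // w.len < k}} (hx : coextFun h x = Sum.inl w) :
    ∃ v, x = Sum.inl v ∧ w = wordMap h v := by
  cases x with
  | inl v => exact ⟨v, rfl, (Sum.inl.inj hx).symm⟩
  | inr c => cases hx

def coext {A B : Str σ} (h : obj k A ⟶ B) : obj k A ⟶ obj k B where
  toFun := coextFun h.toFun
  map_rel R s hs := by
    refine ⟨?_, ?_⟩
    · intro i j w w' hi hj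
      obtain ⟨v, hv, rfl⟩ := exists_of_coextFun hi
      obtain ⟨v', hv', rfl⟩ := exists_of_coextFun hj
      exact (hs.1 i j v v' hv hv').imp (le_wordMap _) (le_wordMap _)
    · have he : (fun i => eps B (coextFun h.toFun (s i))) = fun i => h.toFun (s i) :=
        funext fun i => eps_coextFun h (s i)
      exact he ▸ h.map_rel R s hs
  map_con _ := rfl

variable (σ) (k)

/-- The comonad `E_k` in Kleisli form. -/
def kleisli : KleisliComonad (Str σ) where
  obj := obj k
  counit := counit k
  coext := coext
  coext_counit A := by
    apply StrHom.ext
    funext x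
    cases x <;> rfl
  coext_comp_counit f := by
    apply StrHom.ext
    funext x
    exact eps_coextFun f x
  coext_comp f g := by
    apply StrHom.ext
    funext x
    cases x <;> rfl

/-- The Ehrenfeucht–Fraïssé comonad `E_k` on `σ`-structures. -/
def comonad : Comonad (Str σ) := (kleisli σ k).toComonad

/-- Paths: the coalgebras whose order is a finite linear order. -/
def path : ObjectProperty (comonad σ k).Coalgebra := fun X =>
  IsFiniteChain (C := σ.Const) (fun w w' : {w : Word X.A.carrier // w.len < k} =>
    w.1.Comparable w'.1) (StrHom.toFun X.a)

end EF

/-! ## The pebbling comonad -/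

namespace Pebble

variable {σ : Signature.{u}} (k : ℕ)

/-- The universe: non-empty words of pairs (pebble index, element), and the constant symbols. -/
abbrev Carrier (A : Str σ) : Type u := Word (Fin k × A.carrier) ⊕ σ.Const

variable {k}

def eps (A : Str σ) : Carrier k A → A.carrier
  | Sum.inl w => w.last.2
  | Sum.inr c => A.con c

/-- The pebble index of the last letter of `w` does not occur in `w'` after position `w.len`. -/
def Active {X : Type u} (w w' : Word (Fin k × X)) : Prop :=
  ∀ m : Fin (w'.len + 1), w.len < m.1 → (w'.val m).1 ≠ w.last.1

variable (k)

def obj (A : Str σ) : Str σ where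
  carrier := Carrier k A
  rel R s := (∀ i j w w', s i = Sum.inl w → s j = Sum.inl w' → w.Comparable w') ∧
    (∀ i j w w', s i = Sum.inl w → s j = Sum.inl w' → w.Le w' → Active w w') ∧
    A.rel R (fun i => eps A (s i))
  con c := Sum.inr c

def counit (A : Str σ) : obj k A ⟶ A where
  toFun := eps A
  map_rel _ _ h := h.2.2
  map_con _ := rfl

variable {k}

/-- Replace the element in every letter by the value of `h` at the initial segment ending there. -/
def wordMap {A B : Str σ} (h : Carrier k A → B.carrier) (w : Word (Fin k × A.carrier)) :
    Word (Fin k × B.carrier) :=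
  ⟨w.len, fun i => ((w.val i).1, h (Sum.inl (w.take i)))⟩

def coextFun {A B : Str σ} (h : Carrier k A → B.carrier) : Carrier k A → Carrier k B
  | Sum.inl w => Sum.inl (wordMap h w)
  | Sum.inr c => Sum.inr c

theorem eps_coextFun {A B : Str σ} (h : obj k A ⟶ B) (x : Carrier k A) :
    eps B (coextFun h.toFun x) = h.toFun x := by
  cases x with
  | inl w => rfl
  | inr c => exact (h.map_con c).symm

theorem le_wordMap {A B : Str σ} (h : Carrier k A → B.carrier) {w w' : Word (Fin k × A.carrier)}
    (hw : w.Le w') : (wordMap h w).Le (wordMap h w') := by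
  obtain ⟨i, rfl⟩ := hw
  exact ⟨i, rfl⟩

theorem exists_of_coextFun {A B : Str σ} {h : Carrier k A → B.carrier} {x : Carrier k A}
    {w : Word (Fin k × B.carrier)} (hx : coextFun h x = Sum.inl w) :
    ∃ v, x = Sum.inl v ∧ w = wordMap h v := by
  cases x with
  | inl v => exact ⟨v, rfl, (Sum.inl.inj hx).symm⟩
  | inr c => cases hx

theorem eq_take_of_le {X : Type u} {w w' : Word X} (h : w.Le w') :
    ∃ hl : w.len < w'.len + 1, w = w'.take ⟨w.len, hl⟩ := by
  obtain ⟨i, rfl⟩ := h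
  exact ⟨i.2, rfl⟩

theorem le_antisymm' {X : Type u} {w w' : Word X} (h : w.Le w') (hl : w'.len ≤ w.len) :
    w = w' := by
  obtain ⟨i, rfl⟩ := h
  have hi : i = Fin.last w'.len := Fin.ext (le_antisymm (Nat.lt_succ_iff.mp i.2) hl)
  subst hi
  rfl

def coext {A B : Str σ} (h : obj k A ⟶ B) : obj k A ⟶ obj k B where
  toFun := coextFun h.toFun
  map_rel R s hs := by
    refine ⟨?_, ?_, ?_⟩
    · intro i j w w' hi hj
      obtain ⟨v, hv, rfl⟩ := exists_of_coextFun hi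
      obtain ⟨v', hv', rfl⟩ := exists_of_coextFun hj
      exact (hs.1 i j v v' hv hv').imp (le_wordMap _) (le_wordMap _)
    · intro i j w w' hi hj hle
      obtain ⟨v, hv, rfl⟩ := exists_of_coextFun hi
      obtain ⟨v', hv', rfl⟩ := exists_of_coextFun hj
      have key : v.Le v' := by
        rcases hs.1 i j v v' hv hv' with hc | hc
        · exact hc
        · obtain ⟨hl, -⟩ := eq_take_of_le hle
          rw [le_antisymm' hc (Nat.lt_succ_iff.mp hl)]
          exact ⟨Fin.last _, rfl⟩
      exact hs.2.1 i j v v' hv hv' key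
    · have he : (fun i => eps B (coextFun h.toFun (s i))) = fun i => h.toFun (s i) :=
        funext fun i => eps_coextFun h (s i)
      exact he ▸ h.map_rel R s hs
  map_con _ := rfl

variable (σ) (k)

/-- The comonad `P_k` in Kleisli form. -/
def kleisli : KleisliComonad (Str σ) where
  obj := obj k
  counit := counit k
  coext := coext
  coext_counit A := by
    apply StrHom.ext
    funext x
    cases x <;> rfl
  coext_comp_counit f := by
    apply StrHom.ext
    funext x
    exact eps_coextFun f x
  coext_comp f g := by
    apply StrHom.ext
    funext x
    cases x <;> rfl

/-- The pebbling comonad `P_k` on `σ`-structures. -/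
def comonad : Comonad (Str σ) := (kleisli σ k).toComonad

/-- Paths: the coalgebras whose order is a finite linear order. -/
def path : ObjectProperty (comonad σ k).Coalgebra := fun X =>
  IsFiniteChain (C := σ.Const) (fun w w' : Word (Fin k × X.A.carrier) => w.Comparable w')
    (StrHom.toFun X.a)

end Pebble

/-! ## The modal comonad -/

/-- Relation symbols of a modal signature: a binary `E`, and unary symbols indexed by `P`. -/
inductive ModalRel (P : Type u) : Type u
  | E : ModalRel P
  | prop (p : P) : ModalRel P

/-- The modal signature with unary relation symbols `P` and a single constant. -/
def modalSig (P : Type u) : Signature.{u} where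
  Rel := ModalRel P
  arity R := match R with
    | ModalRel.E => 2
    | ModalRel.prop _ => 1
  arity_pos R := match R with
    | ModalRel.E => Nat.two_pos
    | ModalRel.prop _ => Nat.one_pos
  Const := PUnit

namespace Modal

variable {P : Type u} (k : ℕ)

/-- The accessibility relation of a structure over a modal signature. -/
def acc (A : Str (modalSig P)) (x y : A.carrier) : Prop :=
  A.rel ModalRel.E (fun i : Fin 2 => ![x, y] i)

/-- The unary predicates of a structure over a modal signature. -/
def holds (A : Str (modalSig P)) (p : P) (x : A.carrier) : Prop :=
  A.rel (ModalRel.prop p) (fun _ : Fin 1 => x)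

/-- The distinguished point of a structure over a modal signature. -/
def point (A : Str (modalSig P)) : A.carrier := A.con PUnit.unit

/-- `w` lists the elements visited by a walk along `E` from the distinguished point. -/
def IsWalk (A : Str (modalSig P)) (w : Word A.carrier) : Prop :=
  acc A (point A) (w.val 0) ∧
    ∀ (i : ℕ) (hi : i + 1 < w.len + 1), acc A (w.val ⟨i, Nat.lt_of_succ_lt hi⟩) (w.val ⟨i + 1, hi⟩)

/-- The universe: walks of at most `k` steps from the distinguished point, and the constant. -/
abbrev Carrier (A : Str (modalSig P)) : Type u :=
  {w : Word A.carrier // w.len < k ∧ IsWalk A w} ⊕ PUnit.{u + 1}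

variable {k}

def eps (A : Str (modalSig P)) : Carrier k A → A.carrier
  | Sum.inl w => w.1.last
  | Sum.inr _ => point A

/-- Either `s` is the constant and `s'` a word of length one, or both are words and `s'` covers `s`
in the order of initial segments. -/
def Step {A : Str (modalSig P)} : Carrier k A → Carrier k A → Prop
  | Sum.inr _, Sum.inl w' => w'.1.len = 0
  | Sum.inl w, Sum.inl w' => w.1.Le w'.1 ∧ w'.1.len = w.1.len + 1
  | _, Sum.inr _ => False

variable (k)

def obj (A : Str (modalSig P)) : Str (modalSig P) where
  carrier := Carrier k A
  rel R := match R with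
    | ModalRel.E => fun s : Fin 2 → Carrier k A => Step (s 0) (s 1)
    | ModalRel.prop p => fun s : Fin 1 → Carrier k A => holds A p (eps A (s 0))
  con _ := Sum.inr PUnit.unit

variable {k}

theorem acc_of_rel {A : Str (modalSig P)} (x : Fin 2 → A.carrier) :
    A.rel ModalRel.E x ↔ acc A (x 0) (x 1) := by
  have : (fun i : Fin 2 => ![x 0, x 1] i) = x := by
    funext i
    fin_cases i <;> rfl
  unfold acc
  rw [this]

theorem holds_of_rel {A : Str (modalSig P)} (p : P) (x : Fin 1 → A.carrier) :
    A.rel (ModalRel.prop p) x ↔ holds A p (x 0) := by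
  have : (fun _ : Fin 1 => x 0) = x := by
    funext i
    fin_cases i
    rfl
  unfold holds
  rw [this]

theorem map_acc {A B : Str (modalSig P)} (h : A ⟶ B) {x y : A.carrier} (hxy : acc A x y) :
    acc B (h.toFun x) (h.toFun y) :=
  (acc_of_rel _).mp (h.map_rel ModalRel.E _ hxy)

theorem map_holds {A B : Str (modalSig P)} (h : A ⟶ B) {p : P} {x : A.carrier}
    (hx : holds A p x) : holds B p (h.toFun x) :=
  (holds_of_rel _ _).mp (h.map_rel (ModalRel.prop p) _ hx)

theorem acc_eps_of_step {A : Str (modalSig P)} {s s' : Carrier k A} (h : Step s s') :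
    acc A (eps A s) (eps A s') := by
  match s, s', h with
  | Sum.inr _, Sum.inl ⟨⟨m, v⟩, hv⟩, h =>
    have hm : m = 0 := h
    subst hm
    exact hv.2.1
  | Sum.inl ⟨w, hw⟩, Sum.inl ⟨⟨m, v⟩, hv⟩, h =>
    obtain ⟨⟨⟨i, hi⟩, hi'⟩, hl⟩ := h
    change Word.take ⟨m, v⟩ ⟨i, hi⟩ = w at hi'
    subst hi'
    change m = i + 1 at hl
    subst hl
    exact hv.2.2 i (Nat.lt_succ_self _)

variable (k)

def counit (A : Str (modalSig P)) : obj k A ⟶ A where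
  toFun := eps A
  map_rel R s h := match R, s, h with
    | ModalRel.E, s, h => (acc_of_rel (A := A) (fun i => eps A (s i))).mpr (acc_eps_of_step h)
    | ModalRel.prop p, s, h => (holds_of_rel (A := A) p (fun i => eps A (s i))).mpr h
  map_con _ := rfl

variable {k}

/-- The initial segment of a walk, as an element of the universe. -/
def seg {A : Str (modalSig P)} (w : {w : Word A.carrier // w.len < k ∧ IsWalk A w})
    (i : Fin (w.1.len + 1)) : Carrier k A :=
  Sum.inl ⟨w.1.take i, lt_of_le_of_lt (Nat.lt_succ_iff.mp i.2) w.2.1, w.2.2.1,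
    fun j hj => w.2.2.2 j (lt_of_lt_of_le hj i.2)⟩

/-- Replace every letter by the value of `h` at the initial segment ending there. -/
def wordMap {A B : Str (modalSig P)} (h : Carrier k A → B.carrier)
    (w : {w : Word A.carrier // w.len < k ∧ IsWalk A w}) : Word B.carrier :=
  ⟨w.1.len, fun i => h (seg w i)⟩

theorem acc_of_step {A B : Str (modalSig P)} (h : obj k A ⟶ B) {s s' : Carrier k A}
    (hs : Step s s') : acc B (h.toFun s) (h.toFun s') :=
  map_acc h (x := s) (y := s') ((acc_of_rel (A := obj k A) ![s, s']).mp hs)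

theorem isWalk_wordMap {A B : Str (modalSig P)} (h : obj k A ⟶ B)
    (w : {w : Word A.carrier // w.len < k ∧ IsWalk A w}) : IsWalk B (wordMap h.toFun w) := by
  refine ⟨?_, fun i hi => ?_⟩
  · have hc : h.toFun (Sum.inr PUnit.unit : Carrier k A) = point B := h.map_con PUnit.unit
    rw [← hc]
    exact acc_of_step h (s := Sum.inr PUnit.unit) (s' := seg w 0) rfl
  · exact acc_of_step h (s := seg w ⟨i, Nat.lt_of_succ_lt hi⟩) (s' := seg w ⟨i + 1, hi⟩)
      ⟨⟨⟨i, Nat.lt_succ_of_lt (Nat.lt_succ_self i)⟩, rfl⟩, rfl⟩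

def coextFun {A B : Str (modalSig P)} (h : obj k A ⟶ B) : Carrier k A → Carrier k B
  | Sum.inl w => Sum.inl ⟨wordMap h.toFun w, w.2.1, isWalk_wordMap h w⟩
  | Sum.inr c => Sum.inr c

theorem eps_coextFun {A B : Str (modalSig P)} (h : obj k A ⟶ B) (x : Carrier k A) :
    eps B (coextFun h x) = h.toFun x := by
  cases x with
  | inl w => rfl
  | inr c => exact (h.map_con c).symm

theorem step_coextFun {A B : Str (modalSig P)} (h : obj k A ⟶ B) {s s' : Carrier k A}
    (hs : Step s s') : Step (coextFun h s) (coextFun h s') := by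
  match s, s', hs with
  | Sum.inr _, Sum.inl _, hs => exact hs
  | Sum.inl ⟨w, _⟩, Sum.inl w', hs =>
    obtain ⟨⟨i, rfl⟩, hl⟩ := hs
    exact ⟨⟨i, rfl⟩, hl⟩

def coext {A B : Str (modalSig P)} (h : obj k A ⟶ B) : obj k A ⟶ obj k B where
  toFun := coextFun h
  map_rel R s hs := match R, s, hs with
    | ModalRel.E, _, hs => step_coextFun h hs
    | ModalRel.prop p, s, hs =>
      (congrArg (holds B p) (eps_coextFun h (s (0 : Fin 1)))).mpr
        (map_holds h ((holds_of_rel (A := obj k A) p s).mp hs))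
  map_con _ := rfl

variable (P) (k)

/-- The comonad `M_k` in Kleisli form. -/
def kleisli : KleisliComonad (Str (modalSig P)) where
  obj := obj k
  counit := counit k
  coext := coext
  coext_counit A := by
    apply StrHom.ext
    funext x
    cases x <;> rfl
  coext_comp_counit f := by
    apply StrHom.ext
    funext x
    exact eps_coextFun f x
  coext_comp f g := by
    apply StrHom.ext
    funext x
    cases x <;> rfl

/-- The modal comonad `M_k` on structures over a modal signature. -/
def comonad : Comonad (Str (modalSig P)) := (kleisli P k).toComonad

/-- Paths: the coalgebras whose order is a finite linear order. -/
def path : ObjectProperty (comonad P k).Coalgebra := fun X =>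
  IsFiniteChain (C := PUnit.{u + 1})
    (fun w w' : {w : Word X.A.carrier // w.len < k ∧ IsWalk X.A w} => w.1.Comparable w'.1)
    (StrHom.toFun X.a)

end Modal

/-! ## The logics -/

/-- The first-order language of a signature. -/
def Signature.language (σ : Signature.{u}) : FirstOrder.Language.{u, u} where
  Functions n := match n with
    | 0 => σ.Const
    | _ + 1 => PEmpty
  Relations n := {R : σ.Rel // σ.arity R = n}

instance Str.languageStructure {σ : Signature.{u}} (A : Str σ) :
    σ.language.Structure A.carrier where
  funMap {n} f _ := match n, f with
    | 0, c => A.con c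
    | _ + 1, f => PEmpty.elim f
  RelMap R x := A.rel R.1 (fun i => x (Fin.cast R.2 i))

/-- Quantifier rank of a first-order formula. -/
def quantRank {L : FirstOrder.Language.{u, u}} {V : Type} :
    ∀ {n : ℕ}, L.BoundedFormula V n → ℕ
  | _, .falsum => 0
  | _, .equal _ _ => 0
  | _, .rel _ _ => 0
  | _, .imp φ ψ => max (quantRank φ) (quantRank ψ)
  | _, .all φ => quantRank φ + 1

/-- Equivalence with respect to first-order sentences of quantifier rank at most `k`. -/
def FOEquiv {σ : Signature.{u}} (k : ℕ) (A B : Str σ) : Prop :=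
  ∀ φ : σ.language.Sentence, quantRank φ ≤ k → (A.carrier ⊨ φ ↔ B.carrier ⊨ φ)

/-- Formulas of the infinitary `k`-variable logic over `σ`, with equality: the variables are
`Fin k`, each of which may be quantified repeatedly, and conjunctions may be infinite. The index
`s` is a set of variables that contains all free variables of the formula. -/
inductive VarFormula (σ : Signature.{u}) (k : ℕ) : Set (Fin k) → Type (u + 1)
  | rel {s : Set (Fin k)} (R : σ.Rel) (t : Fin (σ.arity R) → s ⊕ σ.Const) : VarFormula σ k s
  | equal {s : Set (Fin k)} (t t' : s ⊕ σ.Const) : VarFormula σ k s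
  | neg {s : Set (Fin k)} (φ : VarFormula σ k s) : VarFormula σ k s
  | conj {s : Set (Fin k)} (ι : Type u) (φ : ι → VarFormula σ k s) : VarFormula σ k s
  | all {s : Set (Fin k)} (x : Fin k) (φ : VarFormula σ k (insert x s)) : VarFormula σ k s

namespace VarFormula

variable {σ : Signature.{u}} {k : ℕ}

/-- The value of a term (a variable or a constant). -/
def termVal (A : Str σ) {s : Set (Fin k)} (v : s → A.carrier) : s ⊕ σ.Const → A.carrier
  | Sum.inl x => v x
  | Sum.inr c => A.con c

/-- The assignment `v[x ↦ a]`. -/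
def update {X : Type u} {s : Set (Fin k)} (v : s → X) (x : Fin k) (a : X) :
    ↥(insert x s) → X :=
  fun y => if h : y.1 = x then a else v ⟨y.1, (Set.mem_insert_iff.mp y.2).resolve_left h⟩

/-- Satisfaction. -/
def Realize (A : Str σ) : ∀ {s : Set (Fin k)}, VarFormula σ k s → (s → A.carrier) → Prop
  | _, .rel R t, v => A.rel R (fun i => termVal A v (t i))
  | _, .equal t t', v => termVal A v t = termVal A v t'
  | _, .neg φ, v => ¬ Realize A φ v
  | _, .conj _ φ, v => ∀ i, Realize A (φ i) v
  | _, .all x φ, v => ∀ a, Realize A φ (update v x a)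

/-- The formula is an ordinary first-order formula: all its conjunctions are finite. -/
def IsFinitary : ∀ {s : Set (Fin k)}, VarFormula σ k s → Prop
  | _, .rel _ _ => True
  | _, .equal _ _ => True
  | _, .neg φ => IsFinitary φ
  | _, .conj ι φ => Finite ι ∧ ∀ i, IsFinitary (φ i)
  | _, .all _ φ => IsFinitary φ

/-- Truth of a sentence in a structure. -/
def Sat (A : Str σ) (φ : VarFormula σ k ∅) : Prop := φ.Realize A (fun x => x.2.elim)

end VarFormula

/-- Equivalence with respect to infinitary `k`-variable sentences. -/
def InfVarEquiv {σ : Signature.{u}} (k : ℕ) (A B : Str σ) : Prop :=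
  ∀ φ : VarFormula σ k ∅, φ.Sat A ↔ φ.Sat B

/-- Equivalence with respect to first-order `k`-variable sentences. -/
def VarEquiv {σ : Signature.{u}} (k : ℕ) (A B : Str σ) : Prop :=
  ∀ φ : VarFormula σ k ∅, φ.IsFinitary → (φ.Sat A ↔ φ.Sat B)

/-- Formulas of basic modal logic with propositional variables `P`. -/
inductive ModalFormula (P : Type u) : Type u
  | atom (p : P) : ModalFormula P
  | falsum : ModalFormula P
  | imp (φ ψ : ModalFormula P) : ModalFormula P
  | box (φ : ModalFormula P) : ModalFormula P

namespace ModalFormula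

variable {P : Type u}

/-- Modal depth. -/
def depth : ModalFormula P → ℕ
  | atom _ => 0
  | falsum => 0
  | imp φ ψ => max φ.depth ψ.depth
  | box φ => φ.depth + 1

/-- Truth at an element. -/
def Holds (A : Str (modalSig P)) : ModalFormula P → A.carrier → Prop
  | atom p, a => Modal.holds A p a
  | falsum, _ => False
  | imp φ ψ, a => φ.Holds A a → ψ.Holds A a
  | box φ, a => ∀ b, Modal.acc A a b → φ.Holds A b

end ModalFormula

/-- Equivalence of pointed structures with respect to modal formulas of depth at most `k`. -/
def ModalEquiv {P : Type u} (k : ℕ) (A B : Str (modalSig P)) : Prop :=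
  ∀ φ : ModalFormula P, φ.depth ≤ k →
    (φ.Holds A (Modal.point A) ↔ φ.Holds B (Modal.point B))

/-! ## Smoothness for the three game comonads -/

/-- `H` is FO-`E_k`-smooth. -/
def IsFOSmoothEF {n : ℕ} {σ : Fin n → Signature.{u}} {τ : Signature.{u}} (k : ℕ)
    (H : (∀ i, Discrete (Str (σ i))) ⥤ Discrete (Str τ)) : Prop :=
  IsSmoothRel H (fun i => trI (σ i)) (trI τ)
    (fun i => strongInj (σ i).addI) (strongInj τ.addI)
    (fun i => EF.comonad (σ i).addI k) (EF.comonad τ.addI k)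
    (fun i => EF.path (σ i).addI k) (EF.path τ.addI k)

/-- `H` is FO-`P_k`-smooth. -/
def IsFOSmoothPebble {n : ℕ} {σ : Fin n → Signature.{u}} {τ : Signature.{u}} (k : ℕ)
    (H : (∀ i, Discrete (Str (σ i))) ⥤ Discrete (Str τ)) : Prop :=
  IsSmoothRel H (fun i => trI (σ i)) (trI τ)
    (fun i => strongInj (σ i).addI) (strongInj τ.addI)
    (fun i => Pebble.comonad (σ i).addI k) (Pebble.comonad τ.addI k)
    (fun i => Pebble.path (σ i).addI k) (Pebble.path τ.addI k)

/-- `H` is `M_k`-smooth; modal logic has no equality, so the translations are the inclusions. -/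
def IsSmoothModal {n : ℕ} {P : Fin n → Type u} {Q : Type u} (k : ℕ)
    (H : (∀ i, Discrete (Str (modalSig (P i)))) ⥤ Discrete (Str (modalSig Q))) : Prop :=
  IsSmoothRel H (fun i => trIncl (modalSig (P i))) (trIncl (modalSig Q))
    (fun i => strongInj (modalSig (P i))) (strongInj (modalSig Q))
    (fun i => Modal.comonad (P i) k) (Modal.comonad Q k)
    (fun i => Modal.path (P i) k) (Modal.path Q k)

/-! ### Spans of open pathwise-embeddings and smooth operations -/

section General

variable {C : Type v} [Category.{u} C]

/-! Each logical equivalence in question holds as soon as there is a span of open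
pathwise-embeddings between the cofree coalgebras on the translated structures (`IsSpanned`), and
conversely; finiteness assumptions enter only in the passage from logic to spans. Smooth operations
preserve such spans for formal reasons.

Preservation is `IsSmoothRel.isSpanned`. The lifting of `H'` sends the legs of the given spans to
open pathwise-embeddings with a common source, the equaliser at the tuple of apexes. At cofree
coalgebras the lifting is again cofree, because the laws for `κ` make the parallel pair a split one
(`KleisliLaw.cofreeFork_isLimit`). So the legs end at `F (H' (t A))` and `F (H' (t B))`, and
composing them with `F θ` leads to `F (t (H A))` and `F (t (H B))`. Equalisers of coalgebras exist
because the set on which two morphisms agree is closed under predecessors and so carries a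
subcoalgebra.

The link with logic is a back-and-forth game, treated at once for all comonads whose elements are
words and constants (`WordComonad`). From logic to spans: the positions at which the two sides agree
on the relevant formulas form a `Strategy`. The words over the product `A × B` whose initial
segments are all such positions form a subcoalgebra of the cofree coalgebra on `A × B`. Its two
projections are open pathwise-embeddings (`Winning.isOPE`): the winning condition makes them reflect
relations on paths, and the answers to moves fill the squares. From spans to logic: the images of
initial segments of the apex form a `BackForth` system (`exists_backForth`), since openness answers
moves and pathwise-embeddings respect relations. An induction on formulas finishes.

To answer a move, one formula has to describe the element moved to. For bounded quantifier rank or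
depth over a finite signature, finitely many formulas determine all others. For `k`-variable logic,
a conjunction indexed by the elements of the opposite structure suffices, and it is finite when that
structure is. The relation `I` puts equality into the winning condition, because different words may
end in the same element. -/

/-- Open pathwise-embeddings compose. -/
theorem IsOPE.comp {emb : MorphismProperty C} {G : Comonad C} {path : ObjectProperty G.Coalgebra}
    (hemb : ∀ {X Y Z : C} (f : X ⟶ Y) (g : Y ⟶ Z), emb (f ≫ g) → emb f)
    {X Y Z : G.Coalgebra} {f : X ⟶ Y} {g : Y ⟶ Z} (hf : IsOPE emb G path f)
    (hg : IsOPE emb G path g) : IsOPE emb G path (f ≫ g) := by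
  refine ⟨fun P e hP he => ?_, fun P Q e j m hP hQ he hj hm hsq => ?_⟩
  · rw [← Category.assoc]
    exact hg.1 P _ hP (hf.1 P e hP he)
  · obtain ⟨d, hd, hd'⟩ := hg.2 P Q (e ≫ f) j m hP hQ (hf.1 P e hP he) hj hm
      (by rw [Category.assoc, hsq])
    -- The filler for `g` is itself an embedding, as a first factor of `m`; hence it can serve as
    -- the lower edge of a square for `f`.
    have hdm : coalgEmb emb G d := by
      refine hemb d.f g.f ?_
      have := hm
      rw [← hd'] at this
      exact this
    obtain ⟨d', h1, h2⟩ := hf.2 P Q e j d hP hQ he hj hdm hd.symm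
    exact ⟨d', h1, by rw [← Category.assoc, h2, hd']⟩

theorem cofreeLift_comp (G : Comonad C) {X Y Z : C} (f : G.obj X ⟶ Y) (g : G.obj Y ⟶ Z) :
    cofreeLift G f ≫ cofreeLift G g = cofreeLift G ((cofreeLift G f).f ≫ g) := by
  ext
  change (G.δ.app X ≫ G.map f) ≫ G.δ.app Y ≫ G.map g =
    G.δ.app X ≫ G.map ((G.δ.app X ≫ G.map f) ≫ g)
  simp only [Functor.map_comp, Category.assoc]
  rw [G.delta_naturality_assoc, Comonad.coassoc_assoc]

theorem cofreeLift_comp_map (G : Comonad C) {X Y Z : C} (f : G.obj X ⟶ Y) (g : Y ⟶ Z) :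
    cofreeLift G f ≫ G.cofree.map g = cofreeLift G (f ≫ g) := by
  ext
  change (G.δ.app X ≫ G.map f) ≫ G.map g = G.δ.app X ≫ G.map (f ≫ g)
  simp

theorem map_comp_cofreeLift (G : Comonad C) {X Y Z : C} (f : X ⟶ Y) (g : G.obj Y ⟶ Z) :
    G.cofree.map f ≫ cofreeLift G g = cofreeLift G (G.map f ≫ g) := by
  ext
  change G.map f ≫ G.δ.app Y ≫ G.map g = G.δ.app X ≫ G.map (G.map f ≫ g)
  simp

theorem cofreeLift_counit (G : Comonad C) (X : C) : cofreeLift G (G.ε.app X) = 𝟙 _ := by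
  ext
  exact G.right_counit X

theorem equalizes_comp {W X Y X' Y' : C} {a : W ⟶ X} {l r : X ⟶ Y} {l' r' : X' ⟶ Y'} {F : X ⟶ X'}
    {F' : Y ⟶ Y'} (h : a ≫ l = a ≫ r) (hl : F ≫ l' = l ≫ F') (hr : F ≫ r' = r ≫ F') :
    (a ≫ F) ≫ l' = (a ≫ F) ≫ r' := by
  rw [Category.assoc, Category.assoc, hl, hr, ← Category.assoc, h, Category.assoc]

variable {n : ℕ} {B : Fin n → Type v} [∀ i, Category.{u} (B i)]

namespace KleisliLaw

variable {H : (∀ i, B i) ⥤ C} {G : ∀ i, Comonad (B i)} {D : Comonad C} (L : KleisliLaw H G D)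

/-- The fork that exhibits the cofree coalgebra on `H X` as the lifting of `H` at the tuple of
cofree coalgebras on `X`. -/
def cofreeFork (X : ∀ i, B i) :
    Fork (L.parLeft fun i => (G i).cofree.obj (X i)) (L.parRight fun i => (G i).cofree.obj (X i)) :=
  Fork.ofι (P := D.cofree.obj (H.obj X)) (cofreeLift D (L.κ.app X)) (by
    unfold parLeft parRight
    erw [cofreeLift_comp, cofreeLift_comp_map]
    congr 1
    refine Eq.trans ?_ (L.comult X).symm
    exact Category.assoc _ _ _)

/-- The retraction of `cofreeFork`. -/
def cofreeRetract (_ : KleisliLaw H G D) (X : ∀ i, B i) :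
    D.cofree.obj (H.obj fun i => (G i).obj (X i)) ⟶ D.cofree.obj (H.obj X) :=
  D.cofree.map (H.map (X := fun i => (G i).obj (X i)) (Y := X) fun i => (G i).ε.app (X i))

theorem cofreeLift_comp_retract (X : ∀ i, B i) :
    cofreeLift D (L.κ.app X) ≫ L.cofreeRetract X = 𝟙 (D.cofree.obj (H.obj X)) := by
  unfold cofreeRetract
  erw [cofreeLift_comp_map, L.counit, cofreeLift_counit]

/-- Naturality of the Kleisli law at the counits. -/
theorem retract_comp_cofreeLift (X : ∀ i, B i) :
    L.cofreeRetract X ≫ cofreeLift D (L.κ.app X) =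
      L.parLeft (fun i => (G i).cofree.obj (X i)) ≫
        D.cofree.map (H.map (X := fun i => (G i).obj ((G i).obj (X i)))
          (Y := fun i => (G i).obj (X i)) fun i => (G i).map ((G i).ε.app (X i))) := by
  unfold parLeft cofreeRetract
  erw [map_comp_cofreeLift, cofreeLift_comp_map]
  congr 1
  exact L.κ.naturality (X := fun i => (G i).obj (X i)) (Y := X) fun i => (G i).ε.app (X i)

theorem parRight_comp (X : ∀ i, B i) :
    L.parRight (fun i => (G i).cofree.obj (X i)) ≫
        D.cofree.map (H.map (X := fun i => (G i).obj ((G i).obj (X i)))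
          (Y := fun i => (G i).obj (X i)) fun i => (G i).map ((G i).ε.app (X i))) = 𝟙 _ := by
  unfold parRight
  erw [← Functor.map_comp, ← Functor.map_comp]
  rw [← D.cofree.map_id]
  congr 1
  refine Eq.trans ?_ (H.map_id _)
  congr 1
  funext i
  exact (G i).right_counit (X i)

/-- The lifting of `H` preserves cofree coalgebras. -/
theorem cofreeFork_isLimit (X : ∀ i, B i) : Nonempty (IsLimit (L.cofreeFork X)) := by
  -- The fork commutes by the law of `κ` for `δ`. The splitting identities are the law of `κ` for
  -- `ε`, the counit law of each `G i`, and naturality of `κ` at the counits.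
  let S : IsSplitEqualizer (L.parLeft fun i => (G i).cofree.obj (X i))
      (L.parRight fun i => (G i).cofree.obj (X i)) (cofreeLift D (L.κ.app X)) :=
    { leftRetraction := L.cofreeRetract X
      rightRetraction := D.cofree.map (H.map (X := fun i => (G i).obj ((G i).obj (X i)))
          (Y := fun i => (G i).obj (X i)) fun i => (G i).map ((G i).ε.app (X i)))
      condition := (L.cofreeFork X).condition
      ι_leftRetraction := L.cofreeLift_comp_retract X
      bottom_rightRetraction := L.parRight_comp X
      top_rightRetraction := (L.retract_comp_cofreeLift X).symm }
  exact ⟨S.isEqualizer⟩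

/-- The lifting of a smooth law sends open pathwise-embeddings into cofree coalgebras to an open
pathwise-embedding into a cofree coalgebra. -/
theorem IsSmooth.exists_isOPE {embB : ∀ i, MorphismProperty (B i)} {embC : MorphismProperty C}
    {pathB : ∀ i, ObjectProperty (G i).Coalgebra} {pathC : ObjectProperty D.Coalgebra}
    {L : KleisliLaw H G D} (hL : L.IsSmooth embB embC pathB pathC)
    {Z : ∀ i, (G i).Coalgebra} (s : Fork (L.parLeft Z) (L.parRight Z)) (hs : IsLimit s)
    (X : ∀ i, B i) (p : ∀ i, Z i ⟶ (G i).cofree.obj (X i))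
    (hp : ∀ i, IsOPE (embB i) (G i) (pathB i) (p i)) :
    ∃ h : s.pt ⟶ D.cofree.obj (H.obj X), IsOPE embC D pathC h := by
  obtain ⟨ht⟩ := L.cofreeFork_isLimit X
  let F := D.cofree.map (H.map (X := fun i => (Z i).A) (Y := fun i => (G i).obj (X i))
      fun i => (p i).f)
  let F' := D.cofree.map (H.map (X := fun i => (G i).obj (Z i).A)
    (Y := fun i => (G i).obj ((G i).obj (X i))) fun i => (G i).map (p i).f)
  -- `F` and `F'` form a morphism of parallel pairs: for the first arrows by naturality of `κ`, for
  -- the second because every `p i` is a coalgebra morphism.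
  have hl : F ≫ L.parLeft (fun i => (G i).cofree.obj (X i)) = L.parLeft Z ≫ F' := by
    unfold parLeft
    erw [map_comp_cofreeLift, cofreeLift_comp_map]
    congr 1
    exact L.κ.naturality (X := fun i => (Z i).A) (Y := fun i => (G i).obj (X i)) fun i => (p i).f
  have hr : F ≫ L.parRight (fun i => (G i).cofree.obj (X i)) = L.parRight Z ≫ F' := by
    unfold parRight
    erw [← Functor.map_comp, ← Functor.map_comp]
    erw [← Functor.map_comp, ← Functor.map_comp]
    congr 2
    funext i
    exact (p i).h.symm
  have hw : (s.ι ≫ F) ≫ L.parLeft (fun i => (G i).cofree.obj (X i)) =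
      (s.ι ≫ F) ≫ L.parRight (fun i => (G i).cofree.obj (X i)) :=
    equalizes_comp s.condition hl hr
  exact ⟨Fork.IsLimit.lift ht (s.ι ≫ F) hw, hL Z _ p hp s (L.cofreeFork X) _
    ⟨⟨hs⟩, ⟨ht⟩, Fork.IsLimit.lift_ι' ht (s.ι ≫ F) hw⟩⟩

end KleisliLaw

/-- The objects `X` and `Y` are connected by a span of open pathwise-embeddings between their
cofree coalgebras. -/
def IsSpanned (emb : MorphismProperty C) (G : Comonad C) (path : ObjectProperty G.Coalgebra)
    (X Y : C) : Prop :=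
  ∃ (Z : G.Coalgebra) (p : Z ⟶ G.cofree.obj X) (q : Z ⟶ G.cofree.obj Y),
    IsOPE emb G path p ∧ IsOPE emb G path q

/-- Smooth operations preserve the existence of spans of open pathwise-embeddings. -/
theorem IsSmoothRel.isSpanned {σ : Fin n → Signature.{u}} {τ : Signature.{u}}
    {H : (∀ i, Discrete (Str (σ i))) ⥤ Discrete (Str τ)}
    {tr : ∀ i, Discrete (Str (σ i)) ⥤ B i} {trD : Discrete (Str τ) ⥤ C}
    {embB : ∀ i, MorphismProperty (B i)} {embC : MorphismProperty C}
    {G : ∀ i, Comonad (B i)} {D : Comonad C}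
    {pathB : ∀ i, ObjectProperty (G i).Coalgebra} {pathC : ObjectProperty D.Coalgebra}
    (hH : IsSmoothRel H tr trD embB embC G D pathB pathC)
    (hemb : ∀ {X Y Z : C} (f : X ⟶ Y) (g : Y ⟶ Z), embC (f ≫ g) → embC f)
    (heq : ∀ {X Y : D.Coalgebra} (f g : X ⟶ Y), ∃ s : Fork f g, Nonempty (IsLimit s))
    (X Y : ∀ i, Discrete (Str (σ i)))
    (hXY : ∀ i, IsSpanned (embB i) (G i) (pathB i) ((tr i).obj (X i)) ((tr i).obj (Y i))) :
    IsSpanned embC D pathC (trD.obj (H.obj X)) (trD.obj (H.obj Y)) := by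
  obtain ⟨Htr, θ, L, hL, hθ⟩ := hH
  choose Z p q hp hq using hXY
  -- The same equaliser serves both legs, so that they share a source.
  obtain ⟨s, ⟨hs⟩⟩ := heq (L.parLeft Z) (L.parRight Z)
  obtain ⟨p', hp'⟩ := hL.exists_isOPE s hs _ p hp
  obtain ⟨q', hq'⟩ := hL.exists_isOPE s hs _ q hq
  exact ⟨s.pt, p' ≫ D.cofree.map (θ.app X), q' ≫ D.cofree.map (θ.app Y),
    hp'.comp hemb (hθ X), hq'.comp hemb (hθ Y)⟩

end General

/-! ### Words and their initial segments -/

namespace Word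

variable {X Y : Type u}

/-- Apply a function to every letter. -/
def map (f : X → Y) (w : Word X) : Word Y := ⟨w.len, fun i => f (w.val i)⟩

/-- The word formed by the entries of a tuple up to position `i`. -/
def initSeg {m : ℕ} (v : Fin m → X) (i : Fin m) : Word X :=
  ⟨i.1, fun j => v (Fin.castLE i.2 j)⟩

theorem map_initSeg {m : ℕ} (f : X → Y) (v : Fin m → X) (i : Fin m) :
    (initSeg v i).map f = initSeg (fun j => f (v j)) i := rfl

theorem initSeg_val (w : Word X) (i : Fin (w.len + 1)) : initSeg w.val i = w.take i := rfl

theorem initSeg_eq {m m' : ℕ} {v : Fin m → X} {v' : Fin m' → X} {i : Fin m} {i' : Fin m'}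
    (hi : i.1 = i'.1)
    (h : ∀ (j : ℕ) (hj : j < m) (hj' : j < m'), j ≤ i.1 → v ⟨j, hj⟩ = v' ⟨j, hj'⟩) :
    initSeg v i = initSeg v' i' := by
  obtain ⟨i, hm⟩ := i
  obtain ⟨i', hm'⟩ := i'
  obtain rfl : i = i' := hi
  unfold initSeg
  congr 1
  funext j
  exact h j.1 _ _ (Nat.lt_succ_iff.mp j.2)

theorem initSeg_snoc_castSucc {m : ℕ} (v : Fin m → X) (x : X) (i : Fin m) :
    initSeg (Fin.snoc (α := fun _ => X) v x) i.castSucc = initSeg v i :=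
  initSeg_eq rfl fun _ _ hj' _ => Fin.snoc_castSucc (α := fun _ => X) x v ⟨_, hj'⟩

theorem eq_of_initSeg_eq {m m' : ℕ} {v : Fin m → X} {v' : Fin m' → X} {i : Fin m} {i' : Fin m'}
    (h : initSeg v i = initSeg v' i') : i.1 = i'.1 ∧ v i = v' i' :=
  ⟨congrArg Word.len h, congrArg Word.last h⟩

theorem comparable_initSeg {m : ℕ} (v : Fin m → X) (i j : Fin m) :
    (initSeg v i).Comparable (initSeg v j) := by
  rcases le_total i.1 j.1 with h | h
  · exact Or.inl ⟨⟨i.1, Nat.lt_succ_of_le h⟩, rfl⟩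
  · exact Or.inr ⟨⟨j.1, Nat.lt_succ_of_le h⟩, rfl⟩

theorem Le.map {w w' : Word X} (h : w.Le w') (f : X → Y) : (w.map f).Le (w'.map f) := by
  obtain ⟨i, rfl⟩ := h
  exact ⟨i, rfl⟩

theorem Comparable.map {w w' : Word X} (h : w.Comparable w') (f : X → Y) :
    (w.map f).Comparable (w'.map f) := h.imp (fun h => h.map f) fun h => h.map f

theorem map_injective {f : X → Y} (hf : Function.Injective f) :
    Function.Injective (Word.map f) := by
  rintro ⟨m, v⟩ ⟨m', v'⟩ h
  obtain rfl : m = m' := congrArg Word.len h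
  have h2 : (fun i => f (v i)) = fun i => f (v' i) := by
    unfold Word.map at h
    injection h with _ h
  congr 1
  funext i
  exact hf (congrFun h2 i)

theorem Le.eq_of_len_le {w w' : Word X} (h : w.Le w') (hl : w'.len ≤ w.len) : w = w' :=
  Pebble.le_antisymm' h hl

theorem le_of_map_le {f : X → Y} (hf : Function.Injective f) {w w' : Word X}
    (h : (w.map f).Le (w'.map f)) : w.Le w' := by
  obtain ⟨i, hi⟩ := h
  exact ⟨i, map_injective hf hi⟩

theorem comparable_of_map {f : X → Y} (hf : Function.Injective f) {w w' : Word X}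
    (h : (w.map f).Comparable (w'.map f)) : w.Comparable w' :=
  h.imp (le_of_map_le hf) (le_of_map_le hf)

theorem Comparable.le_of_len_le {w w' : Word X} (h : w.Comparable w') (hl : w.len ≤ w'.len) :
    w.Le w' := by
  rcases h with h | h
  · exact h
  · rw [h.eq_of_len_le hl]
    exact ⟨Fin.last _, rfl⟩

theorem Comparable.eq_of_len_eq {w w' : Word X} (h : w.Comparable w') (hl : w.len = w'.len) :
    w = w' :=
  (h.le_of_len_le hl.le).eq_of_len_le hl.ge

/-- The words in a finite family of pairwise comparable words and constants are the initial
segments of a single tuple, which is one of them unless it is empty. -/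
theorem exists_chain {ι : Type*} [Finite ι] {D : Type*} (x : ι → Word X ⊕ D)
    (hx : ∀ i j w w', x i = Sum.inl w → x j = Sum.inl w' → w.Comparable w') :
    ∃ (m : ℕ) (v : Fin m → X),
      (∀ i, (∃ c, x i = Sum.inr c) ∨ ∃ l, x i = Sum.inl (initSeg v l)) ∧
      ∀ l : Fin m, l.1 + 1 = m → ∃ i, x i = Sum.inl (initSeg v l) := by
  by_cases hne : ∃ i w, x i = Sum.inl w
  · obtain ⟨i₁, w₁, h₁⟩ := hne
    let ι' := {i // ∃ w, x i = Sum.inl w}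
    have : Nonempty ι' := ⟨⟨i₁, w₁, h₁⟩⟩
    choose W hW using fun i : ι' => i.2
    -- Every word of the family is comparable with a longest one, hence an initial segment of it.
    obtain ⟨i₀, hi₀⟩ := Finite.exists_max fun i : ι' => (W i).len
    refine ⟨(W i₀).len + 1, (W i₀).val, fun i => ?_, fun l hl => ⟨i₀.1, ?_⟩⟩
    · cases h : x i with
      | inr c => exact Or.inl ⟨c, rfl⟩
      | inl w =>
        have hw : w = W ⟨i, w, h⟩ := Sum.inl.inj (h.symm.trans (hW ⟨i, w, h⟩))
        have hle : w.Le (W i₀) := (hx _ _ _ _ h (hW i₀)).le_of_len_le (hw ▸ hi₀ ⟨i, w, h⟩)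
        obtain ⟨l, hl⟩ := hle
        exact Or.inr ⟨l, by rw [initSeg_val, hl]⟩
    · have : l = Fin.last _ := Fin.ext (Nat.succ.inj hl)
      rw [this]
      exact hW i₀
  · push Not at hne
    refine ⟨0, Fin.elim0, fun i => ?_, fun l => l.elim0⟩
    cases h : x i with
    | inr c => exact Or.inl ⟨c, rfl⟩
    | inl w => exact absurd h (hne i w)

end Word

/-! ### Comonads of words and their coalgebras -/

open Word

/-- A comonad on structures whose elements are words with letters in `K × A` and constants. -/
structure WordComonad {σ : Signature.{u}} (G : Comonad (Str σ)) (path : ObjectProperty G.Coalgebra)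
    (K : Type) where
  word : ∀ A : Str σ, (G.obj A).carrier → Word (K × A.carrier) ⊕ σ.Const
  word_injective : ∀ A, Function.Injective (word A)
  word_con : ∀ A c, word A ((G.obj A).con c) = Sum.inr c
  eps_word : ∀ A x w, word A x = Sum.inl w → StrHom.toFun (G.ε.app A) x = w.last.2
  word_map : ∀ {A B : Str σ} (f : A ⟶ B) x w, word A x = Sum.inl w →
    word B (StrHom.toFun (G.map f) x) = Sum.inl (w.map (Prod.map id (StrHom.toFun f)))
  word_delta : ∀ A x w, word A x = Sum.inl w →
    ∃ s : Fin (w.len + 1) → (G.obj A).carrier, (∀ i, word A (s i) = Sum.inl (w.take i)) ∧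
      word (G.obj A) (StrHom.toFun (G.δ.app A) x) = Sum.inl ⟨w.len, fun i => ((w.val i).1, s i)⟩
  -- Which words occur may depend on the relations (walks in the modal case), so validity is pulled
  -- back along homomorphisms that jointly reflect relations. It is applied to the two projections
  -- of a product and to the inclusion of a substructure, taken twice.
  range_lift : ∀ {A : Str σ} (B : Bool → Str σ) (f : ∀ b, A ⟶ B b),
    (∀ (R : σ.Rel) (x : Fin (σ.arity R) → A.carrier),
      (∀ b, (B b).rel R fun i => StrHom.toFun (f b) (x i)) → A.rel R x) →
    ∀ w : Word (K × A.carrier),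
      (∀ b, ∃ y, word (B b) y = Sum.inl (w.map (Prod.map id (StrHom.toFun (f b))))) →
      ∃ y, word A y = Sum.inl w
  rel_comparable : ∀ {A : Str σ} {R : σ.Rel} {s : Fin (σ.arity R) → (G.obj A).carrier},
    (G.obj A).rel R s → ∀ i j w w', word A (s i) = Sum.inl w → word A (s j) = Sum.inl w' →
      w.Comparable w'
  -- Conditions on lengths and indices of words are unaffected by letterwise maps and can be read
  -- off in `G.obj B`; comparability and the relation between last elements have to be supplied in
  -- `A`.
  rel_lift : ∀ {A B : Str σ} (f : A ⟶ B) {R : σ.Rel} {s : Fin (σ.arity R) → (G.obj A).carrier},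
    (∀ i j w w', word A (s i) = Sum.inl w → word A (s j) = Sum.inl w' → w.Comparable w') →
    ((G.obj B).rel R fun i => StrHom.toFun (G.map f) (s i)) →
    (A.rel R fun i => StrHom.toFun (G.ε.app A) (s i)) → (G.obj A).rel R s
  path_iff : ∀ X : G.Coalgebra,
    path X ↔ IsFiniteChain Word.Comparable fun x => word X.A (StrHom.toFun X.a x)

namespace Str

variable {σ : Signature.{u}}

theorem hom_ext {A B : Str σ} {f g : A ⟶ B} (h : ∀ x, StrHom.toFun f x = StrHom.toFun g x) :
    f = g := StrHom.ext (funext h)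

theorem congr_toFun {A B : Str σ} {f g : A ⟶ B} (h : f = g) (x : A.carrier) :
    StrHom.toFun f x = StrHom.toFun g x := by rw [h]

/-- The induced substructure. -/
def sub (A : Str σ) (S : Set A.carrier) (hS : ∀ c, A.con c ∈ S) : Str σ where
  carrier := S
  rel R x := A.rel R fun i => (x i).1
  con c := ⟨A.con c, hS c⟩

/-- The inclusion of a substructure. -/
def subIncl (A : Str σ) (S : Set A.carrier) (hS : ∀ c, A.con c ∈ S) : A.sub S hS ⟶ A where
  toFun x := x.1
  map_rel _ _ h := h
  map_con _ := rfl

/-- A relation between images under `f` is preserved by `g` and then reflected by the composite.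
This cancellation property is what makes fillers and corestrictions embeddings. -/
theorem strongInj_of_comp {A B D : Str σ} (f : A ⟶ B) (g : B ⟶ D) (h : strongInj σ (f ≫ g)) :
    strongInj σ f :=
  ⟨fun _ _ hxy => h.1 (congrArg (StrHom.toFun g) hxy), fun R x hx =>
    h.2 R x (g.map_rel R _ hx)⟩

theorem eq_of_comp_injective {A B D : Str σ} {f g : A ⟶ B} (i : B ⟶ D)
    (hi : Function.Injective (StrHom.toFun i)) (h : f ≫ i = g ≫ i) : f = g :=
  hom_ext fun x => hi (congr_toFun h x)

end Str

namespace WordComonad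

variable {σ : Signature.{u}} {G : Comonad (Str σ)} {path : ObjectProperty G.Coalgebra} {K : Type}
  (W : WordComonad G path K)

/-- The letterwise action of a function on elements. -/
abbrev letter (K : Type) {A B : Type u} (f : A → B) : K × A → K × B := Prod.map id f

omit W in
theorem letter_injective {A B : Type u} {f : A → B} (hf : Function.Injective f) :
    Function.Injective (letter K f) := Function.injective_id.prodMap hf

include W

theorem eq_con {A : Str σ} {x : (G.obj A).carrier} {c : σ.Const} (h : W.word A x = Sum.inr c) :
    x = (G.obj A).con c :=
  W.word_injective A (h.trans (W.word_con A c).symm)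

/-- `G.map f` preserves constants, so only words are sent to words. -/
theorem map_eq_inl {A B : Str σ} (f : A ⟶ B) {x : (G.obj A).carrier} {w : Word (K × B.carrier)}
    (h : W.word B (StrHom.toFun (G.map f) x) = Sum.inl w) :
    ∃ w', W.word A x = Sum.inl w' ∧ w = w'.map (letter K (StrHom.toFun f)) := by
  cases hx : W.word A x with
  | inl w' => exact ⟨w', rfl, Sum.inl.inj (h.symm.trans (W.word_map f x w' hx))⟩
  | inr c =>
    rw [W.eq_con hx, (G.map f).map_con, W.word_con] at h
    cases h

theorem map_injective {A B : Str σ} {f : A ⟶ B} (hf : Function.Injective (StrHom.toFun f)) :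
    Function.Injective (StrHom.toFun (G.map f)) := by
  intro x y hxy
  have hxy' := congrArg (W.word B) hxy
  cases hx : W.word A x with
  | inl w =>
    rw [W.word_map f x w hx] at hxy'
    obtain ⟨w', hw', h⟩ := W.map_eq_inl f hxy'.symm
    exact W.word_injective A (hx.trans ((congrArg Sum.inl
      (Word.map_injective (letter_injective hf) h)).trans hw'.symm))
  | inr c =>
    rw [W.eq_con hx] at hxy' ⊢
    rw [(G.map f).map_con, W.word_con] at hxy'
    cases hy : W.word A y with
    | inl w =>
      rw [W.word_map f y w hy] at hxy'
      cases hxy'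
    | inr c' =>
      rw [W.eq_con hy] at hxy' ⊢
      rw [(G.map f).map_con, W.word_con] at hxy'
      cases hxy'
      rfl

/-! ### Words of elements of coalgebras -/

/-- The word (or constant) of an element of a coalgebra. -/
def wd (X : G.Coalgebra) (x : X.A.carrier) : Word (K × X.A.carrier) ⊕ σ.Const :=
  W.word X.A (StrHom.toFun X.a x)

theorem wd_con (X : G.Coalgebra) (c : σ.Const) : W.wd X (X.A.con c) = Sum.inr c := by
  unfold wd
  rw [X.a.map_con]
  exact W.word_con _ c

theorem eq_con_of_wd {X : G.Coalgebra} {x : X.A.carrier} {c : σ.Const}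
    (h : W.wd X x = Sum.inr c) : x = X.A.con c := by
  have h1 := W.eq_con h
  have h2 : StrHom.toFun (G.ε.app X.A) (StrHom.toFun X.a x) = x := Str.congr_toFun X.counit x
  rw [← h2, h1]
  exact (G.ε.app X.A).map_con c

theorem last_wd {X : G.Coalgebra} {x : X.A.carrier} {w : Word (K × X.A.carrier)}
    (h : W.wd X x = Sum.inl w) : w.last.2 = x := by
  rw [← W.eps_word _ _ _ h]
  exact Str.congr_toFun X.counit x

/-- By the counit law an element is the last letter of its word, or the interpretation of its
constant symbol. -/
theorem wd_injective (X : G.Coalgebra) : Function.Injective (W.wd X) := by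
  intro x y h
  cases hx : W.wd X x with
  | inl w => rw [← W.last_wd hx, ← W.last_wd (h.symm.trans hx)]
  | inr c => rw [W.eq_con_of_wd hx, W.eq_con_of_wd (h.symm.trans hx)]

theorem wd_hom {X Y : G.Coalgebra} (h : X ⟶ Y) {x : X.A.carrier} {w : Word (K × X.A.carrier)}
    (hx : W.wd X x = Sum.inl w) :
    W.wd Y (StrHom.toFun h.f x) = Sum.inl (w.map (letter K (StrHom.toFun h.f))) := by
  rw [← W.word_map h.f _ _ hx]
  exact congrArg (W.word Y.A) (Str.congr_toFun h.h x).symm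

theorem wd_hom_eq {X Y : G.Coalgebra} (h : X ⟶ Y) {x : X.A.carrier} {w : Word (K × Y.A.carrier)}
    (hx : W.wd Y (StrHom.toFun h.f x) = Sum.inl w) :
    ∃ w', W.wd X x = Sum.inl w' ∧ w = w'.map (letter K (StrHom.toFun h.f)) := by
  refine W.map_eq_inl h.f (x := StrHom.toFun X.a x) ?_
  rw [← hx]
  exact congrArg (W.word Y.A) (Str.congr_toFun h.h x)

/-- `v` lists an initial segment of the order of the coalgebra `X`, with its indices. -/
def Pos (X : G.Coalgebra) {m : ℕ} (v : Fin m → K × X.A.carrier) : Prop :=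
  ∀ i, W.wd X (v i).2 = Sum.inl (initSeg v i)

/-- This is coassociativity. Letter by letter, `δ` turns the word of `x` into its initial segments,
while `G.map X.a` turns it into the words of its letters. So a coalgebra carries a forest order in
which the word of `x` lists the elements below `x`. -/
theorem pos_wd {X : G.Coalgebra} {x : X.A.carrier} {w : Word (K × X.A.carrier)}
    (h : W.wd X x = Sum.inl w) : W.Pos X w.val := by
  intro i
  obtain ⟨s, hs, hδ⟩ := W.word_delta _ _ _ h
  have h1 : StrHom.toFun (G.δ.app X.A) (StrHom.toFun X.a x) =
      StrHom.toFun (G.map X.a) (StrHom.toFun X.a x) := Str.congr_toFun X.coassoc x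
  rw [h1, W.word_map _ _ _ h] at hδ
  have h2 := Sum.inl.inj hδ
  unfold Word.map at h2
  injection h2 with _ h2
  have h3 := congrArg Prod.snd (congrFun h2 i)
  change StrHom.toFun X.a (w.val i).2 = s i at h3
  unfold wd
  rw [h3, hs]
  rfl

theorem Pos.hom {X Y : G.Coalgebra} {m : ℕ} {v : Fin m → K × X.A.carrier} (hv : W.Pos X v)
    (h : X ⟶ Y) : W.Pos Y fun i => letter K (StrHom.toFun h.f) (v i) :=
  fun i => W.wd_hom h (hv i)

theorem Pos.of_hom {X Y : G.Coalgebra} {m : ℕ} {v : Fin m → K × X.A.carrier} {h : X ⟶ Y}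
    (hh : Function.Injective (StrHom.toFun h.f))
    (hv : W.Pos Y fun i => letter K (StrHom.toFun h.f) (v i)) : W.Pos X v := by
  intro i
  obtain ⟨w', hw', h2⟩ := W.wd_hom_eq h (hv i)
  rw [← map_initSeg (letter K (StrHom.toFun h.f))] at h2
  rw [hw', ← Word.map_injective (letter_injective hh) h2]

/-! ### Subcoalgebras -/

omit W in
theorem hom_ext_of_injective {X Y Z : G.Coalgebra} {f g : X ⟶ Y} (i : Y ⟶ Z)
    (hi : Function.Injective (StrHom.toFun i.f)) (h : f ≫ i = g ≫ i) : f = g :=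
  Comonad.Coalgebra.Hom.ext (Str.eq_of_comp_injective i.f hi
    (congrArg Comonad.Coalgebra.Hom.f h))

omit W in
/-- A coalgebra structure on a subobject, given on the underlying object. -/
def _root_.CategoryTheory.Comonad.Coalgebra.ofMono (X : G.Coalgebra) {A : Str σ} (i : A ⟶ X.A)
    (a : A ⟶ G.obj A) (ha : a ≫ G.map i = i ≫ X.a)
    (hi : Function.Injective (StrHom.toFun i))
    (hi' : Function.Injective (StrHom.toFun (G.map (G.map i)))) : G.Coalgebra where
  A := A
  a := a
  counit := by
    refine Str.eq_of_comp_injective i hi ?_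
    have h : G.ε.app A ≫ i = G.map i ≫ G.ε.app X.A := (G.ε.naturality i).symm
    rw [Category.assoc, h, ← Category.assoc, ha, Category.assoc, X.counit, Category.comp_id,
      Category.id_comp]
  coassoc := by
    refine Str.eq_of_comp_injective (G.map (G.map i)) hi' ?_
    have h : G.δ.app A ≫ G.map (G.map i) = G.map i ≫ G.δ.app X.A := (G.δ.naturality i).symm
    rw [Category.assoc, Category.assoc, h, ← Category.assoc, ha, Category.assoc,
      X.coassoc, ← Functor.map_comp, ha, Functor.map_comp, ← Category.assoc, ← Category.assoc, ha]

-- Maps into a subobject that carries a coalgebra structure satisfy the coalgebra square as soon as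
-- they do so in the ambient coalgebra, because `G.map i` is injective.
omit W in
theorem coalgebra_law_of_comp {X Y : G.Coalgebra} {A : Str σ} (i : A ⟶ X.A) (a : A ⟶ G.obj A)
    (ha : a ≫ G.map i = i ≫ X.a) (hi : Function.Injective (StrHom.toFun (G.map i)))
    (f : Y ⟶ X) (g : Y.A ⟶ A) (hg : g ≫ i = f.f) : Y.a ≫ G.map g = g ≫ a := by
  refine Str.eq_of_comp_injective (G.map i) hi ?_
  rw [Category.assoc, Category.assoc, ← Functor.map_comp, ha, hg, f.h, ← hg, Category.assoc]

variable {X : G.Coalgebra} {S : Set X.A.carrier} (hS : ∀ c, X.A.con c ∈ S)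
  (hd : ∀ x ∈ S, ∀ w, W.wd X x = Sum.inl w → ∀ i, (w.val i).2 ∈ S)

-- Closure under predecessors puts all letters of the word of `x` into `S`; since the inclusion
-- reflects relations, the restricted word is an element of the comonad at the substructure.
include hd in
theorem exists_sub (x : S) : ∃ y : (G.obj (X.A.sub S hS)).carrier,
    StrHom.toFun (G.map (X.A.subIncl S hS)) y = StrHom.toFun X.a x.1 := by
  cases hx : W.wd X x.1 with
  | inr c =>
    refine ⟨(G.obj (X.A.sub S hS)).con c, ?_⟩
    rw [(G.map (X.A.subIncl S hS)).map_con]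
    exact (W.eq_con hx).symm
  | inl w =>
    let w' : Word (K × (X.A.sub S hS).carrier) :=
      ⟨w.len, fun i => ((w.val i).1, ⟨(w.val i).2, hd x.1 x.2 w hx i⟩)⟩
    obtain ⟨y, hy⟩ := W.range_lift (A := X.A.sub S hS) (fun _ => X.A)
      (fun _ => X.A.subIncl S hS) (fun R x h => h true) w' fun _ => ⟨_, hx⟩
    exact ⟨y, W.word_injective _ ((W.word_map _ _ _ hy).trans hx.symm)⟩

omit W in
theorem subIncl_injective : Function.Injective (StrHom.toFun (X.A.subIncl S hS)) :=
  Subtype.val_injective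

/-- The structure map of a subcoalgebra. -/
noncomputable def subMap : X.A.sub S hS ⟶ G.obj (X.A.sub S hS) where
  toFun x := (W.exists_sub hS hd x).choose
  map_rel R x hx := by
    have hc := fun i => (W.exists_sub hS hd (x i)).choose_spec
    have hr : (G.obj X.A).rel R fun i => StrHom.toFun X.a (x i).1 := X.a.map_rel R _ hx
    have hr' : (G.obj X.A).rel R fun i => StrHom.toFun (G.map (X.A.subIncl S hS))
        (W.exists_sub hS hd (x i)).choose := by
      simp only [hc]
      exact hr
    refine W.rel_lift (X.A.subIncl S hS) (fun i j w w' hw hw' => ?_) hr' ?_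
    · exact Word.comparable_of_map (letter_injective (subIncl_injective hS))
        (W.rel_comparable hr' i j _ _ (W.word_map _ _ _ hw) (W.word_map _ _ _ hw'))
    · have h1 : ∀ y, (StrHom.toFun (G.ε.app (X.A.sub S hS)) y).1 = StrHom.toFun (G.ε.app X.A)
          (StrHom.toFun (G.map (X.A.subIncl S hS)) y) := fun y =>
        (Str.congr_toFun (G.ε.naturality (X.A.subIncl S hS)) y).symm
      have h2 : ∀ i, (StrHom.toFun (G.ε.app (X.A.sub S hS))
          (W.exists_sub hS hd (x i)).choose).1 = (x i).1 := fun i => by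
        rw [h1, hc]
        exact Str.congr_toFun X.counit _
      change X.A.rel R _
      simp only [h2]
      exact hx
  map_con c := by
    refine W.map_injective (subIncl_injective hS) ?_
    exact ((W.exists_sub hS hd ⟨X.A.con c, hS c⟩).choose_spec.trans (X.a.map_con c)).trans
      ((G.map (X.A.subIncl S hS)).map_con c).symm

/-- The subcoalgebra on a subset that contains the constants and is closed under predecessors. -/
noncomputable def sub : G.Coalgebra :=
  X.ofMono (X.A.subIncl S hS) (W.subMap hS hd)
    (Str.hom_ext fun x => (W.exists_sub hS hd x).choose_spec) (subIncl_injective hS)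
    (W.map_injective (W.map_injective (subIncl_injective hS)))

/-- The inclusion of a subcoalgebra. -/
noncomputable def incl : W.sub hS hd ⟶ X where
  f := X.A.subIncl S hS
  h := Str.hom_ext fun x => (W.exists_sub hS hd x).choose_spec

theorem incl_injective : Function.Injective (StrHom.toFun (W.incl hS hd).f) :=
  Subtype.val_injective

theorem incl_emb : coalgEmb (strongInj σ) G (W.incl hS hd) :=
  ⟨Subtype.val_injective, fun _ _ h => h⟩

theorem exists_lift {Y : G.Coalgebra} (f : Y ⟶ X) (hf : ∀ y, StrHom.toFun f.f y ∈ S) :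
    ∃ g : Y ⟶ W.sub hS hd, g ≫ W.incl hS hd = f := by
  let g₀ : Y.A ⟶ X.A.sub S hS :=
    { toFun := fun y => ⟨StrHom.toFun f.f y, hf y⟩
      map_rel := fun R y hy => f.f.map_rel R y hy
      map_con := fun c => Subtype.ext (f.f.map_con c) }
  exact ⟨⟨g₀, coalgebra_law_of_comp (X.A.subIncl S hS) (W.subMap hS hd) (W.incl hS hd).h
    (W.map_injective (subIncl_injective hS)) f g₀ rfl⟩, rfl⟩

/-- Equalisers of coalgebras exist. -/
theorem exists_equalizer {X Y : G.Coalgebra} (f g : X ⟶ Y) :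
    ∃ s : Fork f g, Nonempty (IsLimit s) := by
  let S : Set X.A.carrier := {x | StrHom.toFun f.f x = StrHom.toFun g.f x}
  have hS : ∀ c, X.A.con c ∈ S := fun c => (f.f.map_con c).trans (g.f.map_con c).symm
  -- If `f` and `g` agree at `x`, the two images of the word of `x` coincide letter by letter, so
  -- `f` and `g` agree at all predecessors of `x`.
  have hd : ∀ x ∈ S, ∀ w, W.wd X x = Sum.inl w → ∀ i, (w.val i).2 ∈ S := by
    intro x hx w hw i
    have h1 := W.wd_hom f hw
    have h2 := W.wd_hom g hw
    rw [show StrHom.toFun f.f x = StrHom.toFun g.f x from hx, h2] at h1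
    have h3 := Sum.inl.inj h1
    unfold Word.map at h3
    injection h3 with _ h3
    exact (congrArg Prod.snd (congrFun h3 i)).symm
  have hw : W.incl hS hd ≫ f = W.incl hS hd ≫ g :=
    Comonad.Coalgebra.Hom.ext (Str.hom_ext fun x => x.2)
  have key : ∀ s : Fork f g, ∃ l : s.pt ⟶ W.sub hS hd, l ≫ W.incl hS hd = s.ι := fun s =>
    W.exists_lift hS hd s.ι fun y =>
      Str.congr_toFun (congrArg Comonad.Coalgebra.Hom.f s.condition) y
  choose l hl using key
  exact ⟨Fork.ofι (W.incl hS hd) hw, ⟨Fork.IsLimit.mk _ l hl fun s m hm =>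
    hom_ext_of_injective _ (W.incl_injective hS hd) (hm.trans (hl s).symm)⟩⟩

end WordComonad

/-! ### Chains, paths and cofree coalgebras -/

namespace WordComonad

variable {σ : Signature.{u}} {G : Comonad (Str σ)} {path : ObjectProperty G.Coalgebra} {K : Type}
  (W : WordComonad G path K)

/-- The constants and the entries of a tuple. -/
def chainSet (X : G.Coalgebra) {m : ℕ} (v : Fin m → K × X.A.carrier) : Set X.A.carrier :=
  {x | (∃ c, x = X.A.con c) ∨ ∃ i, x = (v i).2}

theorem con_mem_chainSet (X : G.Coalgebra) {m : ℕ} (v : Fin m → K × X.A.carrier) (c : σ.Const) :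
    X.A.con c ∈ chainSet X v := Or.inl ⟨c, rfl⟩

include W

theorem chainSet_closed {X : G.Coalgebra} {m : ℕ} {v : Fin m → K × X.A.carrier}
    (hv : W.Pos X v) : ∀ x ∈ chainSet X v, ∀ w, W.wd X x = Sum.inl w →
      ∀ i, (w.val i).2 ∈ chainSet X v := by
  rintro x (⟨c, rfl⟩ | ⟨i, rfl⟩) w hw j
  · rw [W.wd_con] at hw
    cases hw
  · rw [hv i] at hw
    cases hw
    exact Or.inr ⟨_, rfl⟩

/-- The subcoalgebra formed by the constants and an initial segment of the order. -/
noncomputable def chain {X : G.Coalgebra} {m : ℕ} {v : Fin m → K × X.A.carrier}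
    (hv : W.Pos X v) : G.Coalgebra :=
  W.sub (con_mem_chainSet X v) (W.chainSet_closed hv)

/-- The inclusion of `chain`. -/
noncomputable def chainIncl {X : G.Coalgebra} {m : ℕ} {v : Fin m → K × X.A.carrier}
    (hv : W.Pos X v) : W.chain hv ⟶ X :=
  W.incl (con_mem_chainSet X v) (W.chainSet_closed hv)

theorem path_chain {X : G.Coalgebra} {m : ℕ} {v : Fin m → K × X.A.carrier}
    (hv : W.Pos X v) : path (W.chain hv) := by
  have hinj : Function.Injective (StrHom.toFun (W.chainIncl hv).f) := W.incl_injective _ _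
  have key : ∀ (x : (W.chain hv).A.carrier) w, W.wd (W.chain hv) x = Sum.inl w →
      ∃ i, StrHom.toFun (W.chainIncl hv).f x = (v i).2 ∧
        w.map (letter K (StrHom.toFun (W.chainIncl hv).f)) = initSeg v i := by
    intro x w hw
    have h1 := W.wd_hom (W.chainIncl hv) hw
    rcases x.2 with ⟨c, hc⟩ | ⟨i, hi⟩
    · have hc' : StrHom.toFun (W.chainIncl hv).f x = X.A.con c := hc
      rw [hc', W.wd_con] at h1
      cases h1
    · have hi' : StrHom.toFun (W.chainIncl hv).f x = (v i).2 := hi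
      rw [hi', hv i] at h1
      exact ⟨i, hi', (Sum.inl.inj h1).symm⟩
  refine (W.path_iff _).2 ⟨?_, fun x y w w' hw hw' => ?_⟩
  · refine Set.Finite.of_finite_image (f := StrHom.toFun (W.chainIncl hv).f) ?_ hinj.injOn
    refine (Set.finite_range fun i => (v i).2).subset ?_
    rintro _ ⟨x, ⟨w, hw⟩, rfl⟩
    obtain ⟨i, hi, -⟩ := key x w hw
    exact ⟨i, hi.symm⟩
  · obtain ⟨i, -, hi⟩ := key x w hw
    obtain ⟨j, -, hj⟩ := key y w' hw'
    refine Word.comparable_of_map (letter_injective (K := K) hinj) ?_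
    rw [hi, hj]
    exact comparable_initSeg v i j

/-- Pathwise-embeddings reflect relations along chains. -/
theorem rel_of_isPathwiseEmb {X Y : G.Coalgebra} {p : X ⟶ Y}
    (hp : IsPathwiseEmb (coalgEmb (strongInj σ) G) path p) {m : ℕ}
    {v : Fin m → K × X.A.carrier} (hv : W.Pos X v) {R : σ.Rel}
    {s : Fin (σ.arity R) → X.A.carrier} (hs : ∀ i, s i ∈ chainSet X v)
    (h : Y.A.rel R fun i => StrHom.toFun p.f (s i)) : X.A.rel R s :=
  (hp _ (W.chainIncl hv) (W.path_chain hv) (W.incl_emb _ _)).2 R (fun i => ⟨s i, hs i⟩) h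

/-- Open pathwise-embeddings lift extensions of chains. -/
theorem exists_of_isOPE {X Y : G.Coalgebra} {p : X ⟶ Y} (hp : IsOPE (strongInj σ) G path p)
    {m : ℕ} {v : Fin m → K × X.A.carrier} (hv : W.Pos X v) {y : K × Y.A.carrier}
    (hy : W.Pos Y (Fin.snoc (α := fun _ => K × Y.A.carrier)
      (fun i => letter K (StrHom.toFun p.f) (v i)) y)) :
    ∃ x, StrHom.toFun p.f x = y.2 ∧
      W.Pos X (Fin.snoc (α := fun _ => K × X.A.carrier) v (y.1, x)) := by
  set u : Fin (m + 1) → K × Y.A.carrier := Fin.snoc (α := fun _ => K × Y.A.carrier)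
      (fun i => letter K (StrHom.toFun p.f) (v i)) y with hu
  have hmem : ∀ x, StrHom.toFun (W.chainIncl hv ≫ p).f x ∈ chainSet Y u := by
    rintro ⟨x, ⟨c, rfl⟩ | ⟨i, rfl⟩⟩
    · exact Or.inl ⟨c, p.f.map_con c⟩
    · refine Or.inr ⟨i.castSucc, ?_⟩
      rw [hu, Fin.snoc_castSucc]
      rfl
  -- Openness is applied to the inclusion `j` of the chain of `v` into the chain of its image
  -- extended by `y`. As `j` is a first factor of the restriction of `p` to a path, it is an
  -- embedding.
  obtain ⟨j, hj⟩ := W.exists_lift _ (W.chainSet_closed hy) (W.chainIncl hv ≫ p) hmem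
  have he : coalgEmb (strongInj σ) G (W.chainIncl hv ≫ p) :=
    hp.1 _ _ (W.path_chain hv) (W.incl_emb _ _)
  have hje : coalgEmb (strongInj σ) G j := by
    refine Str.strongInj_of_comp j.f (W.chainIncl hy).f ?_
    rw [← hj] at he
    exact he
  obtain ⟨d, hd1, hd2⟩ := hp.2 _ _ (W.chainIncl hv) j (W.chainIncl hy) (W.path_chain hv)
    (W.path_chain hy) (W.incl_emb _ _) hje (W.incl_emb _ _) hj.symm
  let u' : Fin (m + 1) → K × (W.chain hy).A.carrier := fun i =>
    ((u i).1, ⟨(u i).2, Or.inr ⟨i, rfl⟩⟩)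
  have hu' : W.Pos (W.chain hy) u' := Pos.of_hom W (h := W.chainIncl hy) (W.incl_injective _ _) hy
  refine ⟨StrHom.toFun d.f (u' (Fin.last m)).2, ?_, ?_⟩
  · refine (Str.congr_toFun (congrArg Comonad.Coalgebra.Hom.f hd2) (u' (Fin.last m)).2).trans ?_
    change (u (Fin.last m)).2 = y.2
    rw [hu, Fin.snoc_last]
  · have h1 := hu'.hom W d
    convert h1 using 1
    funext i
    refine Fin.lastCases ?_ (fun i => ?_) i
    · rw [Fin.snoc_last]
      refine Prod.ext ?_ rfl
      change y.1 = (u (Fin.last m)).1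
      rw [hu, Fin.snoc_last]
    · rw [Fin.snoc_castSucc]
      have h2 : u i.castSucc = letter K (StrHom.toFun p.f) (v i) := by
        rw [hu, Fin.snoc_castSucc]
      let x : (W.chain hv).A.carrier := ⟨(v i).2, Or.inr ⟨i, rfl⟩⟩
      have h3 : StrHom.toFun d.f (StrHom.toFun j.f x) = (v i).2 :=
        Str.congr_toFun (congrArg Comonad.Coalgebra.Hom.f hd1) x
      have h4 : StrHom.toFun j.f x = (u' i.castSucc).2 := by
        refine Subtype.ext ?_
        refine (Str.congr_toFun (congrArg Comonad.Coalgebra.Hom.f hj) x).trans ?_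
        exact congrArg Prod.snd h2.symm
      rw [h4] at h3
      refine Prod.ext ?_ h3.symm
      exact (congrArg Prod.fst h2).symm

/-- The elements of a path are linearly ordered by an exhaustive initial segment. -/
theorem exists_pos_of_path {P : G.Coalgebra} (hP : path P) :
    ∃ (m : ℕ) (u : Fin m → K × P.A.carrier), W.Pos P u ∧
      ∀ x, (∃ c, W.wd P x = Sum.inr c) ∨ ∃ l, W.wd P x = Sum.inl (initSeg u l) := by
  obtain ⟨hfin, hcmp⟩ := (W.path_iff P).1 hP
  have : Finite {x | ∃ w, W.wd P x = Sum.inl w} := hfin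
  obtain ⟨m, u, h1, h2⟩ := exists_chain
    (fun x : {x | ∃ w, W.wd P x = Sum.inl w} => W.wd P x.1) fun i j => hcmp i.1 j.1
  refine ⟨m, u, fun i => ?_, fun x => ?_⟩
  · cases m with
    | zero => exact i.elim0
    | succ m =>
      obtain ⟨x, hx⟩ := h2 (Fin.last m) rfl
      exact W.pos_wd hx i
  · cases hx : W.wd P x with
    | inr c => exact Or.inl ⟨c, rfl⟩
    | inl w =>
      rcases h1 ⟨x, w, hx⟩ with ⟨c, hc⟩ | ⟨l, hl⟩
      · cases hc.symm.trans hx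
      · exact Or.inr ⟨l, hx.symm.trans hl⟩

/-- Morphisms are injective on paths. -/
theorem injective_of_path {P Y : G.Coalgebra} (hP : path P) (h : P ⟶ Y) :
    Function.Injective (StrHom.toFun h.f) := by
  intro x y hxy
  cases hx : W.wd P x with
  | inl w =>
    have h1 := W.wd_hom h hx
    rw [hxy] at h1
    obtain ⟨w', hy, hw⟩ := W.wd_hom_eq h h1
    -- Elements with the same image have words of the same length, and comparable words of the same
    -- length are equal.
    have hl := congrArg Word.len hw
    have := (((W.path_iff P).1 hP).2 x y w w' hx hy).eq_of_len_eq hl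
    exact W.wd_injective P (hx.trans (this ▸ hy.symm))
  | inr c =>
    have hx' := W.eq_con_of_wd hx
    cases hy : W.wd P y with
    | inl w =>
      have h1 := W.wd_hom h hy
      rw [← hxy, hx', h.f.map_con, W.wd_con] at h1
      cases h1
    | inr c' =>
      have hy' := W.eq_con_of_wd hy
      rw [hx', hy', h.f.map_con, h.f.map_con] at hxy
      have h1 := congrArg (W.wd Y) hxy
      rw [W.wd_con, W.wd_con] at h1
      cases h1
      rw [hx', hy']

/-! ### Cofree coalgebras -/

/-- The word `w` is an element of the comonad at `A`. -/
def Valid (A : Str σ) (w : Word (K × A.carrier)) : Prop := ∃ x, W.word A x = Sum.inl w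

/-- The structure map of a cofree coalgebra is `δ`, and applying the counit to every letter undoes
`δ`. -/
theorem word_of_wd_cofree {A : Str σ} {x : (G.obj A).carrier}
    {w : Word (K × (G.obj A).carrier)} (h : W.wd (G.cofree.obj A) x = Sum.inl w) :
    W.word A x = Sum.inl (w.map (letter K (StrHom.toFun (G.ε.app A)))) := by
  rw [← W.word_map (G.ε.app A) _ _ h]
  exact congrArg (W.word A) (Str.congr_toFun (G.right_counit A) x).symm

theorem Pos.word_cofree {A : Str σ} {m : ℕ} {v : Fin m → K × (G.obj A).carrier}
    (hv : W.Pos (G.cofree.obj A) v) (i : Fin m) : W.word A (v i).2 =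
      Sum.inl (initSeg (fun j => letter K (StrHom.toFun (G.ε.app A)) (v j)) i) :=
  W.word_of_wd_cofree (hv i)

/-- `δ` replaces the letters of a word by its initial segments, and `v` consists of exactly these
since words determine elements. -/
theorem pos_cofree {A : Str σ} {m : ℕ} {v : Fin m → K × (G.obj A).carrier}
    {a : Fin m → K × A.carrier} (ha : ∀ i, (v i).1 = (a i).1)
    (hv : ∀ i, W.word A (v i).2 = Sum.inl (initSeg a i)) : W.Pos (G.cofree.obj A) v := by
  intro i
  obtain ⟨s, hs, h⟩ := W.word_delta _ _ _ (hv i)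
  refine h.trans (congrArg Sum.inl ?_)
  unfold initSeg
  congr 1
  funext j
  refine Prod.ext (ha _).symm (W.word_injective A ((hs j).trans ?_))
  exact (hv (Fin.castLE i.2 j)).symm

end WordComonad

/-! ### Winning positions and open pathwise-embeddings -/

namespace WordComonad

variable {σ : Signature.{u}} {G : Comonad (Str σ)} {path : ObjectProperty G.Coalgebra} {K : Type}
  (W : WordComonad G path K)

/-- The set `S` of positions over `C` is winning for the player who has to answer, by elements of
`C`, to moves in `A`. -/
structure Winning {C A : Str σ} (f : C ⟶ A) (S : ∀ m, (Fin m → K × C.carrier) → Prop) :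
    Prop where
  zero : S 0 Fin.elim0
  valid : ∀ m v, S (m + 1) v → W.Valid C ⟨m, v⟩
  -- Only tuples that attain the whole of `v` are constrained: a relation is tested at the position
  -- given by the longest word involved, where activity of pebbles is decided. For empty `v` the
  -- third condition is vacuous and all entries are constants.
  reflect : ∀ m v, S m v → ∀ (R : σ.Rel) (s : Fin (σ.arity R) → (G.obj C).carrier),
    (∀ i, (∃ c, W.word C (s i) = Sum.inr c) ∨ ∃ l, W.word C (s i) = Sum.inl (initSeg v l)) →
    (∀ l : Fin m, l.1 + 1 = m → ∃ i, W.word C (s i) = Sum.inl (initSeg v l)) →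
    ((G.obj A).rel R fun i => StrHom.toFun (G.map f) (s i)) →
    C.rel R fun i => StrHom.toFun (G.ε.app C) (s i)
  forth : ∀ m v, S m v → ∀ a : K × A.carrier,
    W.Valid A ⟨m, Fin.snoc (α := fun _ => K × A.carrier)
      (fun i => letter K (StrHom.toFun f) (v i)) a⟩ →
    ∃ c, StrHom.toFun f c = a.2 ∧ S (m + 1) (Fin.snoc (α := fun _ => K × C.carrier) v (a.1, c))

/-- The elements of the cofree coalgebra all of whose initial segments belong to `S`. -/
def winSet (C : Str σ) (S : ∀ m, (Fin m → K × C.carrier) → Prop) :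
    Set (G.cofree.obj C).A.carrier :=
  {x | ∀ w, W.word C x = Sum.inl w → ∀ i : Fin (w.len + 1), S (i.1 + 1) (w.take i).val}

variable {C A : Str σ} {S : ∀ m, (Fin m → K × C.carrier) → Prop}

theorem con_mem_winSet (c : σ.Const) : (G.cofree.obj C).A.con c ∈ W.winSet C S := by
  intro w hw
  rw [show W.word C ((G.cofree.obj C).A.con c) = Sum.inr c from W.word_con C c] at hw
  cases hw

theorem winSet_closed : ∀ x ∈ W.winSet C S, ∀ w, W.wd (G.cofree.obj C) x = Sum.inl w →
    ∀ i, (w.val i).2 ∈ W.winSet C S := by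
  intro x hx w hw i u hu j
  have h1 := W.word_of_wd_cofree hw
  have h2 := (W.pos_wd hw).word_cofree W i
  rw [h2] at hu
  cases hu
  exact hx _ h1 (Fin.castLE i.2 j)

/-- The coalgebra of winning positions. -/
noncomputable def win (C : Str σ) (S : ∀ m, (Fin m → K × C.carrier) → Prop) : G.Coalgebra :=
  W.sub (X := G.cofree.obj C) W.con_mem_winSet (W.winSet_closed (S := S))

/-- The inclusion of the coalgebra of winning positions. -/
noncomputable def winIncl (C : Str σ) (S : ∀ m, (Fin m → K × C.carrier) → Prop) :
    W.win C S ⟶ G.cofree.obj C :=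
  W.incl (X := G.cofree.obj C) W.con_mem_winSet (W.winSet_closed (S := S))

theorem exists_win_lift {Q : G.Coalgebra} (d : Q ⟶ G.cofree.obj C)
    (hd : ∀ x, StrHom.toFun d.f x ∈ W.winSet C S) : ∃ d' : Q ⟶ W.win C S, d' ≫ W.winIncl C S = d :=
  W.exists_lift (X := G.cofree.obj C) W.con_mem_winSet (W.winSet_closed (S := S)) d hd

variable {f : C ⟶ A}

/-- The position to test is the longest word among the entries, or the empty position if all entries
are constants. It belongs to `S` because the entry that attains it lies in `winSet`. -/
theorem Winning.rel (hf : W.Winning f S) {R : σ.Rel} {s : Fin (σ.arity R) → (G.obj C).carrier}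
    (hs : ∀ i, s i ∈ W.winSet C S)
    (hc : ∀ i j w w', W.word C (s i) = Sum.inl w → W.word C (s j) = Sum.inl w' → w.Comparable w')
    (h : (G.obj A).rel R fun i => StrHom.toFun (G.map f) (s i)) : (G.obj C).rel R s := by
  refine W.rel_lift f hc h ?_
  obtain ⟨m, v, h1, h2⟩ := exists_chain (fun i => W.word C (s i)) hc
  refine hf.reflect m v ?_ R s h1 h2 h
  cases m with
  | zero =>
    rw [Subsingleton.elim v Fin.elim0]
    exact hf.zero
  | succ m =>
    obtain ⟨i, hi⟩ := h2 (Fin.last m) rfl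
    exact hs i _ hi (Fin.last m)

/-- The word of `e x` is a letterwise image of the word of `x` in `P`, and letterwise maps keep
comparability. -/
theorem comparable_of_path {P : G.Coalgebra} (hP : path P) (e : P ⟶ G.cofree.obj C)
    {ι : Type*} (x : ι → P.A.carrier) : ∀ i j w w',
      W.word C (StrHom.toFun e.f (x i)) = Sum.inl w →
      W.word C (StrHom.toFun e.f (x j)) = Sum.inl w' → w.Comparable w' := by
  have key : ∀ x w, W.word C (StrHom.toFun e.f x) = Sum.inl w → ∃ w', W.wd P x = Sum.inl w' ∧
      w = (w'.map (letter K (StrHom.toFun e.f))).map (letter K (StrHom.toFun (G.ε.app C))) := by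
    intro x w hw
    cases hx : W.wd P x with
    | inl w' =>
      refine ⟨w', rfl, Sum.inl.inj (hw.symm.trans ?_)⟩
      exact W.word_of_wd_cofree (W.wd_hom e hx)
    | inr c =>
      rw [W.eq_con_of_wd hx, e.f.map_con] at hw
      cases (W.word_con C c).symm.trans hw
  intro i j w w' hw hw'
  obtain ⟨u, hu, rfl⟩ := key _ w hw
  obtain ⟨u', hu', rfl⟩ := key _ w' hw'
  exact (((W.path_iff P).1 hP).2 _ _ u u' hu hu').map _ |>.map _

/-- Injectivity is automatic on paths. A relation between images in `G A` is pulled back to `G C` by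
the winning condition, and then to `P` because `e` is an embedding. -/
theorem Winning.isPathwiseEmb (hf : W.Winning f S) :
    IsPathwiseEmb (coalgEmb (strongInj σ) G) path (W.winIncl C S ≫ G.cofree.map f) := by
  intro P e hP he
  refine ⟨W.injective_of_path hP _, fun R x hx => he.2 R x ?_⟩
  exact hf.rel W (s := fun i => StrHom.toFun (e ≫ W.winIncl C S).f (x i))
    (fun i => (StrHom.toFun e.f (x i)).2) (W.comparable_of_path hP (e ≫ W.winIncl C S) x) hx

/-- Positions that are winning along with all their restrictions. -/
def Hereditary (S : ∀ m, (Fin m → K × C.carrier) → Prop) {m : ℕ} (v : Fin m → K × C.carrier) :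
    Prop := ∀ l (h : l ≤ m), S l fun i => v (Fin.castLE h i)

/-- A winning player can answer to a sequence of moves that extends a given position. -/
theorem Winning.exists_extension (hf : W.Winning f S) {m₀ m : ℕ} (hm : m₀ ≤ m)
    (a : Fin m → K × A.carrier) (ha : ∀ i, W.Valid A (initSeg a i))
    (v₀ : Fin m₀ → K × C.carrier)
    (hv₀ : ∀ i, letter K (StrHom.toFun f) (v₀ i) = a (Fin.castLE hm i)) (hS : Hereditary S v₀) :
    ∃ v : Fin m → K × C.carrier, (∀ i, letter K (StrHom.toFun f) (v i) = a i) ∧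
      (∀ i, v (Fin.castLE hm i) = v₀ i) ∧ Hereditary S v := by
  induction m, hm using Nat.le_induction with
  | base => exact ⟨v₀, hv₀, fun _ => rfl, hS⟩
  | succ m hm ih =>
    obtain ⟨v, h1, h2, h3⟩ := ih (fun i => a i.castSucc) (fun i => ha i.castSucc) hv₀
    have hsn : Fin.snoc (α := fun _ => K × A.carrier)
        (fun i => letter K (StrHom.toFun f) (v i)) (a (Fin.last m)) = a := by
      funext i
      refine Fin.lastCases ?_ (fun i => ?_) i
      · rw [Fin.snoc_last]
      · rw [Fin.snoc_castSucc, h1]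
    obtain ⟨c, hc, hSc⟩ := hf.forth m v (h3 m le_rfl) (a (Fin.last m))
      (by rw [hsn]; exact ha (Fin.last m))
    refine ⟨Fin.snoc (α := fun _ => K × C.carrier) v ((a (Fin.last m)).1, c), fun i => ?_,
      fun i => ?_, fun l hl => ?_⟩
    · refine Fin.lastCases ?_ (fun i => ?_) i
      · rw [Fin.snoc_last]
        exact Prod.ext rfl hc
      · rw [Fin.snoc_castSucc, h1]
    · rw [← h2 i]
      exact Fin.snoc_castSucc (α := fun _ => K × C.carrier) _ v (Fin.castLE hm i)
    · rcases Nat.lt_or_eq_of_le hl with hl' | rfl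
      · convert h3 l (Nat.lt_succ_iff.mp hl') using 1
        funext i
        exact Fin.snoc_castSucc (α := fun _ => K × C.carrier) _ v
          (Fin.castLE (Nat.lt_succ_iff.mp hl') i)
      · exact hSc

omit W in
/-- The coalgebra morphism into a cofree coalgebra induced by a homomorphism. -/
def transpose {Q : G.Coalgebra} (g : Q.A ⟶ C) : Q ⟶ G.cofree.obj C where
  f := Q.a ≫ G.map g
  h := by
    have h : G.map g ≫ G.δ.app C = G.δ.app Q.A ≫ G.map (G.map g) := G.δ.naturality g
    change Q.a ≫ G.map (Q.a ≫ G.map g) = (Q.a ≫ G.map g) ≫ G.δ.app C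
    rw [Category.assoc, h, Functor.map_comp, Q.coassoc_assoc]

/-- The path `Q` over `F A` is a sequence of moves in `A`, and `e` records answers to its initial
part `P`. The winning player extends these answers to all moves; sending the `l`-th element of `Q`
to the word of the answers up to `l` gives the filler. -/
theorem Winning.isOpenMor (hf : W.Winning f S) :
    IsOpenMor (coalgEmb (strongInj σ) G) path (W.winIncl C S ≫ G.cofree.map f) := by
  intro P Q e j m hP hQ he hj hm hsq
  obtain ⟨m₁, u₁, hu₁, hP'⟩ := W.exists_pos_of_path hP
  obtain ⟨m₀, u, hu, hQ'⟩ := W.exists_pos_of_path hQ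
  let e' : P ⟶ G.cofree.obj C := e ≫ W.winIncl C S
  -- `j` carries the enumeration of `P` to an initial part of the enumeration of `Q`.
  have hju : ∀ i : Fin m₁, ∃ l : Fin m₀, i.1 = l.1 ∧
      letter K (StrHom.toFun j.f) (u₁ i) = u l := by
    intro i
    have h1 := hu₁.hom W j i
    rcases hQ' (letter K (StrHom.toFun j.f) (u₁ i)).2 with ⟨c, hc⟩ | ⟨l, hl⟩
    · cases hc.symm.trans h1
    · exact ⟨l, eq_of_initSeg_eq (Sum.inl.inj (h1.symm.trans hl))⟩
  have hm₁ : m₁ ≤ m₀ := by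
    by_contra hlt
    obtain ⟨l, hl, -⟩ := hju ⟨m₀, not_le.mp hlt⟩
    exact absurd l.2 (by rw [← hl]; exact lt_irrefl _)
  have hju' : ∀ i : Fin m₁, letter K (StrHom.toFun j.f) (u₁ i) = u (Fin.castLE hm₁ i) := by
    intro i
    obtain ⟨l, hl, h⟩ := hju i
    rw [h]
    exact congrArg u (Fin.ext hl.symm)
  let a : Fin m₀ → K × A.carrier := fun i =>
    letter K (StrHom.toFun (G.ε.app A)) (letter K (StrHom.toFun m.f) (u i))
  have ha : ∀ i, W.word A (StrHom.toFun m.f (u i).2) = Sum.inl (initSeg a i) :=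
    (hu.hom W m).word_cofree W
  let v₀ : Fin m₁ → K × C.carrier := fun i =>
    letter K (StrHom.toFun (G.ε.app C)) (letter K (StrHom.toFun e'.f) (u₁ i))
  have hv₀ : ∀ i, W.word C (StrHom.toFun e'.f (u₁ i).2) = Sum.inl (initSeg v₀ i) :=
    (hu₁.hom W e').word_cofree W
  have hεf : ∀ x, StrHom.toFun f (StrHom.toFun (G.ε.app C) x) =
      StrHom.toFun (G.ε.app A) (StrHom.toFun (G.map f) x) := fun x =>
    (Str.congr_toFun (G.ε.naturality f) x).symm
  have hsq' : ∀ x, StrHom.toFun (G.map f) (StrHom.toFun e'.f x) =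
      StrHom.toFun m.f (StrHom.toFun j.f x) :=
    Str.congr_toFun (congrArg Comonad.Coalgebra.Hom.f hsq)
  obtain ⟨v, hv1, hv2, hvS⟩ := hf.exists_extension W hm₁ a (fun i => ⟨_, ha i⟩) v₀
    (fun i => by
      refine Prod.ext (congrArg (fun t => t.1) (hju' i) :) ?_
      change StrHom.toFun f (StrHom.toFun (G.ε.app C) (StrHom.toFun e'.f (u₁ i).2)) =
        StrHom.toFun (G.ε.app A) (StrHom.toFun m.f (u (Fin.castLE hm₁ i)).2)
      rw [hεf, hsq', ← hju' i]
      rfl)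
    (fun l hl => by
      cases l with
      | zero =>
        rw [Subsingleton.elim (fun i => v₀ (Fin.castLE hl i)) Fin.elim0]
        exact hf.zero
      | succ l =>
        exact (StrHom.toFun e.f (u₁ ⟨l, hl⟩).2).2 _ (hv₀ ⟨l, hl⟩) (Fin.last l))
  have hd : ∀ x, ∃ y, (∀ c, W.wd Q x = Sum.inr c → y = (G.obj C).con c) ∧
      ∀ l, W.wd Q x = Sum.inl (initSeg u l) → W.word C y = Sum.inl (initSeg v l) := by
    intro x
    rcases hQ' x with ⟨c, hc⟩ | ⟨l, hl⟩
    · refine ⟨(G.obj C).con c, fun c' hc' => ?_, fun l hl => ?_⟩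
      · rw [Sum.inr.inj (hc.symm.trans hc')]
      · cases hc.symm.trans hl
    · obtain ⟨y, hy⟩ := hf.valid l.1 _ (hvS (l.1 + 1) l.2)
      refine ⟨y, fun c' hc' => ?_, fun l' hl' => ?_⟩
      · cases hl.symm.trans hc'
      · rw [← Fin.ext (eq_of_initSeg_eq (Sum.inl.inj (hl.symm.trans hl'))).1]
        exact hy
  choose d hdc hdl using hd
  have hdcon : ∀ c, d (Q.A.con c) = (G.obj C).con c := fun c => hdc _ c (W.wd_con Q c)
  have hdmem : ∀ x, d x ∈ W.winSet C S := by
    intro x w hw i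
    rcases hQ' x with ⟨c, hc⟩ | ⟨l, hl⟩
    · rw [hdc x c hc, W.word_con] at hw
      cases hw
    · rw [hdl x l hl] at hw
      cases hw
      exact hvS (i.1 + 1) (le_trans i.2 l.2)
  have hdm : ∀ x, StrHom.toFun (G.map f) (d x) = StrHom.toFun m.f x := by
    intro x
    rcases hQ' x with ⟨c, hc⟩ | ⟨l, hl⟩
    · rw [hdc x c hc, W.eq_con_of_wd hc, (G.map f).map_con]
      exact (m.f.map_con c).symm
    · refine W.word_injective A ?_
      rw [W.word_map f _ _ (hdl x l hl)]
      refine Eq.trans ?_ (W.word_of_wd_cofree (W.wd_hom m hl)).symm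
      have h1 := congrArg (initSeg · l) (funext hv1)
      exact congrArg Sum.inl h1
  have hdcmp : ∀ x y w w', W.word C (d x) = Sum.inl w → W.word C (d y) = Sum.inl w' →
      w.Comparable w' := by
    have key : ∀ x w, W.word C (d x) = Sum.inl w → ∃ l, w = initSeg v l := by
      intro x w hw
      rcases hQ' x with ⟨c, hc⟩ | ⟨l, hl⟩
      · rw [hdc x c hc, W.word_con] at hw
        cases hw
      · exact ⟨l, Sum.inl.inj (hw.symm.trans (hdl x l hl))⟩
    intro x y w w' hw hw'
    obtain ⟨l, rfl⟩ := key x w hw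
    obtain ⟨l', rfl⟩ := key y w' hw'
    exact comparable_initSeg v l l'
  -- Relations of `Q` are sent by `m` to relations in `G A`, which the winning condition pulls back
  -- to `G C`.
  let D : Q.A ⟶ G.obj C :=
    { toFun := d
      map_rel := fun R x hx => by
        refine hf.rel W (fun i => hdmem (x i)) (fun i j => hdcmp (x i) (x j)) ?_
        simp only [hdm]
        exact m.f.map_rel R x hx
      map_con := hdcon }
  -- The map `d` is recovered from its last letters, so it underlies the coalgebra morphism that
  -- corresponds to `D ≫ ε`.
  have hD : ∀ x, StrHom.toFun (transpose (D ≫ G.ε.app C)).f x = d x := by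
    intro x
    rcases hQ' x with ⟨c, hc⟩ | ⟨l, hl⟩
    · rw [W.eq_con_of_wd hc, hdcon]
      exact (transpose (D ≫ G.ε.app C)).f.map_con c
    · refine W.word_injective C ?_
      rw [hdl x l hl]
      refine (W.word_map (D ≫ G.ε.app C) _ _ hl).trans ?_
      have h1 : ∀ i, letter K (StrHom.toFun (D ≫ G.ε.app C)) (u i) = v i := fun i =>
        Prod.ext (congrArg Prod.fst (hv1 i)).symm (W.eps_word C _ _ (hdl (u i).2 i (hu i)))
      have h2 := congrArg (initSeg · l) (funext h1)
      exact congrArg Sum.inl h2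
  obtain ⟨d', hd'⟩ := W.exists_win_lift (S := S) (transpose (D ≫ G.ε.app C))
    (fun x => by rw [hD]; exact hdmem x)
  refine ⟨d', hom_ext_of_injective (W.winIncl C S) (W.incl_injective _ _) ?_, ?_⟩
  · rw [Category.assoc, hd']
    refine Comonad.Coalgebra.Hom.ext (Str.hom_ext fun x => ?_)
    change StrHom.toFun (transpose (D ≫ G.ε.app C)).f (StrHom.toFun j.f x) = StrHom.toFun e'.f x
    rw [hD]
    rcases hP' x with ⟨c, hc⟩ | ⟨l, hl⟩
    · rw [W.eq_con_of_wd hc, j.f.map_con, hdcon]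
      exact (e'.f.map_con c).symm
    · refine W.word_injective C ?_
      have h1 : W.wd Q (StrHom.toFun j.f x) = Sum.inl (initSeg u (Fin.castLE hm₁ l)) := by
        have h2 := congrArg (initSeg · l) (funext hju')
        exact (W.wd_hom j hl).trans (congrArg Sum.inl h2)
      rw [hdl _ _ h1]
      refine Eq.trans ?_ (W.word_of_wd_cofree (W.wd_hom e' hl)).symm
      have h2 := congrArg (initSeg · l) (funext hv2)
      exact congrArg Sum.inl h2
  · rw [← Category.assoc, hd']
    refine Comonad.Coalgebra.Hom.ext (Str.hom_ext fun x => ?_)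
    change StrHom.toFun (G.map f) (StrHom.toFun (transpose (D ≫ G.ε.app C)).f x) = _
    rw [hD, hdm]

theorem Winning.isOPE (hf : W.Winning f S) :
    IsOPE (strongInj σ) G path (W.winIncl C S ≫ G.cofree.map f) :=
  ⟨hf.isPathwiseEmb W, hf.isOpenMor W⟩

end WordComonad

/-! ### Strategies, spans and back-and-forth systems -/

namespace Str

variable {σ : Signature.{u}}

/-- The product of two structures. -/
def prod (A B : Str σ) : Str σ where
  carrier := A.carrier × B.carrier
  rel R x := (A.rel R fun i => (x i).1) ∧ B.rel R fun i => (x i).2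
  con c := (A.con c, B.con c)

/-- The first projection. -/
def fst (A B : Str σ) : A.prod B ⟶ A where
  toFun x := x.1
  map_rel _ _ h := h.1
  map_con _ := rfl

/-- The second projection. -/
def snd (A B : Str σ) : A.prod B ⟶ B where
  toFun x := x.2
  map_rel _ _ h := h.2
  map_con _ := rfl

end Str

namespace WordComonad

variable {σ : Signature.{u}} {G : Comonad (Str σ)} {path : ObjectProperty G.Coalgebra} {K : Type}
  (W : WordComonad G path K)

/-- A winning strategy in the game on `A` and `B`: a set of positions that satisfies the winning
condition and in which every move can be answered. -/
structure Strategy (A B : Str σ) (S : ∀ m, (Fin m → K × (A.carrier × B.carrier)) → Prop) :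
    Prop where
  zero : S 0 Fin.elim0
  valid : ∀ m v, S (m + 1) v → W.Valid A ⟨m, fun i => letter K Prod.fst (v i)⟩ ∧
    W.Valid B ⟨m, fun i => letter K Prod.snd (v i)⟩
  reflect : ∀ m v, S m v → ∀ (R : σ.Rel) (s : Fin (σ.arity R) → (G.obj (A.prod B)).carrier),
    (∀ i, (∃ c, W.word _ (s i) = Sum.inr c) ∨ ∃ l, W.word _ (s i) = Sum.inl (initSeg v l)) →
    (∀ l : Fin m, l.1 + 1 = m → ∃ i, W.word _ (s i) = Sum.inl (initSeg v l)) →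
    (((G.obj A).rel R fun i => StrHom.toFun (G.map (A.fst B)) (s i)) →
      B.rel R fun i => (StrHom.toFun (G.ε.app (A.prod B)) (s i)).2) ∧
    (((G.obj B).rel R fun i => StrHom.toFun (G.map (A.snd B)) (s i)) →
      A.rel R fun i => (StrHom.toFun (G.ε.app (A.prod B)) (s i)).1)
  forth : ∀ m v, S m v → ∀ (κ : K) (a : A.carrier),
    W.Valid A ⟨m, Fin.snoc (α := fun _ => K × A.carrier)
      (fun i => letter K Prod.fst (v i)) (κ, a)⟩ →
    ∃ b, S (m + 1) (Fin.snoc (α := fun _ => K × (A.carrier × B.carrier)) v (κ, (a, b)))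
  back : ∀ m v, S m v → ∀ (κ : K) (b : B.carrier),
    W.Valid B ⟨m, Fin.snoc (α := fun _ => K × B.carrier)
      (fun i => letter K Prod.snd (v i)) (κ, b)⟩ →
    ∃ a, S (m + 1) (Fin.snoc (α := fun _ => K × (A.carrier × B.carrier)) v (κ, (a, b)))

variable {A B : Str σ}

/-- A winning strategy gives a span of open pathwise-embeddings. -/
theorem Strategy.isSpanned {S : ∀ m, (Fin m → K × (A.carrier × B.carrier)) → Prop}
    (hS : W.Strategy A B S) : IsSpanned (strongInj σ) G path A B := by
  have hvalid : ∀ m v, S (m + 1) v → W.Valid (A.prod B) ⟨m, v⟩ := by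
    intro m v hv
    obtain ⟨h1, h2⟩ := hS.valid m v hv
    refine W.range_lift (A := A.prod B) (fun b => bif b then A else B)
      (fun b => match b with
        | true => A.fst B
        | false => A.snd B) (fun R x h => ⟨h true, h false⟩) ⟨m, v⟩ fun b => ?_
    cases b
    · exact h2
    · exact h1
  have hε1 : ∀ x, (StrHom.toFun (G.ε.app (A.prod B)) x).1 =
      StrHom.toFun (G.ε.app A) (StrHom.toFun (G.map (A.fst B)) x) := fun x =>
    (Str.congr_toFun (G.ε.naturality (A.fst B)) x).symm
  have hε2 : ∀ x, (StrHom.toFun (G.ε.app (A.prod B)) x).2 =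
      StrHom.toFun (G.ε.app B) (StrHom.toFun (G.map (A.snd B)) x) := fun x =>
    (Str.congr_toFun (G.ε.naturality (A.snd B)) x).symm
  have h1 : W.Winning (A.fst B) S :=
    { zero := hS.zero
      valid := hvalid
      reflect := fun m v hv R s hs ht h => by
        -- A relation of the product has two components. The one in `A` holds because the counit is
        -- a homomorphism; only the one in `B` needs the strategy.
        refine ⟨?_, ((hS.reflect m v hv R s hs ht).1 h)⟩
        simp only [hε1]
        exact (G.ε.app A).map_rel R _ h
      forth := fun m v hv a ha => by
        obtain ⟨b, hb⟩ := hS.forth m v hv a.1 a.2 ha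
        exact ⟨(a.2, b), rfl, hb⟩ }
  have h2 : W.Winning (A.snd B) S :=
    { zero := hS.zero
      valid := hvalid
      reflect := fun m v hv R s hs ht h => by
        refine ⟨((hS.reflect m v hv R s hs ht).2 h), ?_⟩
        simp only [hε2]
        exact (G.ε.app B).map_rel R _ h
      forth := fun m v hv b hb => by
        obtain ⟨a, ha⟩ := hS.back m v hv b.1 b.2 hb
        exact ⟨(a, b.2), rfl, ha⟩ }
  exact ⟨_, _, _, h1.isOPE W, h2.isOPE W⟩

/-- A back-and-forth system between `A` and `B`. -/
structure BackForth (A B : Str σ)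
    (T : ∀ m, (Fin m → K × A.carrier) → (Fin m → K × B.carrier) → Prop) : Prop where
  zero : T 0 Fin.elim0 Fin.elim0
  index : ∀ m a b, T m a b → ∀ i, (a i).1 = (b i).1
  valid : ∀ m a b, T m a b → ∀ i, W.Valid A (initSeg a i) ∧ W.Valid B (initSeg b i)
  rel_iff : ∀ m a b, T m a b → ∀ (R : σ.Rel) (s : Fin (σ.arity R) → (G.obj A).carrier)
    (t : Fin (σ.arity R) → (G.obj B).carrier),
    (∀ i, (∃ c, s i = (G.obj A).con c ∧ t i = (G.obj B).con c) ∨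
      ∃ l, W.word A (s i) = Sum.inl (initSeg a l) ∧ W.word B (t i) = Sum.inl (initSeg b l)) →
    ((G.obj A).rel R s ↔ (G.obj B).rel R t)
  forth : ∀ m a b, T m a b → ∀ (κ : K) (x : A.carrier),
    W.Valid A ⟨m, Fin.snoc (α := fun _ => K × A.carrier) a (κ, x)⟩ →
    ∃ y, T (m + 1) (Fin.snoc (α := fun _ => K × A.carrier) a (κ, x))
      (Fin.snoc (α := fun _ => K × B.carrier) b (κ, y))
  back : ∀ m a b, T m a b → ∀ (κ : K) (y : B.carrier),
    W.Valid B ⟨m, Fin.snoc (α := fun _ => K × B.carrier) b (κ, y)⟩ →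
    ∃ x, T (m + 1) (Fin.snoc (α := fun _ => K × A.carrier) a (κ, x))
      (Fin.snoc (α := fun _ => K × B.carrier) b (κ, y))

/-- The positions that are images of initial segments of the apex of a span. -/
def SpanPos {Z : G.Coalgebra} (p : Z ⟶ G.cofree.obj A) (q : Z ⟶ G.cofree.obj B) (m : ℕ)
    (a : Fin m → K × A.carrier) (b : Fin m → K × B.carrier) : Prop :=
  ∃ v : Fin m → K × Z.A.carrier, W.Pos Z v ∧
    (∀ i, a i = letter K (StrHom.toFun (G.ε.app A)) (letter K (StrHom.toFun p.f) (v i))) ∧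
    ∀ i, b i = letter K (StrHom.toFun (G.ε.app B)) (letter K (StrHom.toFun q.f) (v i))

theorem SpanPos.symm {Z : G.Coalgebra} {p : Z ⟶ G.cofree.obj A} {q : Z ⟶ G.cofree.obj B} {m : ℕ}
    {a : Fin m → K × A.carrier} {b : Fin m → K × B.carrier} (h : W.SpanPos p q m a b) :
    W.SpanPos q p m b a := by
  obtain ⟨v, hv, h1, h2⟩ := h
  exact ⟨v, hv, h2, h1⟩

theorem Pos.word_hom {Z : G.Coalgebra} {m : ℕ} {v : Fin m → K × Z.A.carrier} (hv : W.Pos Z v)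
    (p : Z ⟶ G.cofree.obj A) {a : Fin m → K × A.carrier}
    (ha : ∀ i, a i = letter K (StrHom.toFun (G.ε.app A)) (letter K (StrHom.toFun p.f) (v i)))
    (i : Fin m) : W.word A (StrHom.toFun p.f (v i).2) = Sum.inl (initSeg a i) := by
  rw [funext ha]
  exact (hv.hom W p).word_cofree W i

/-- The extended word is an element of `G A` that prolongs the image of a chain of `Z`. Openness of
`p` lifts it to an element `z` of `Z`, and the answer is the last element of `q z`. -/
theorem SpanPos.forth {Z : G.Coalgebra} {p : Z ⟶ G.cofree.obj A} {q : Z ⟶ G.cofree.obj B}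
    (hp : IsOPE (strongInj σ) G path p) {m : ℕ}
    {a : Fin m → K × A.carrier} {b : Fin m → K × B.carrier} (h : W.SpanPos p q m a b)
    (κ : K) (x : A.carrier)
    (hx : W.Valid A ⟨m, Fin.snoc (α := fun _ => K × A.carrier) a (κ, x)⟩) :
    ∃ y, W.SpanPos p q (m + 1) (Fin.snoc (α := fun _ => K × A.carrier) a (κ, x))
      (Fin.snoc (α := fun _ => K × B.carrier) b (κ, y)) := by
  obtain ⟨v, hv, h1, h2⟩ := h
  obtain ⟨x', hx'⟩ := hx
  have hεx : StrHom.toFun (G.ε.app A) x' = x := by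
    rw [W.eps_word _ _ _ hx']
    exact congrArg Prod.snd (Fin.snoc_last (α := fun _ => K × A.carrier) (κ, x) a)
  have hpos : W.Pos (G.cofree.obj A) (Fin.snoc (α := fun _ => K × (G.obj A).carrier)
      (fun i => letter K (StrHom.toFun p.f) (v i)) (κ, x')) := by
    refine W.pos_cofree (a := Fin.snoc (α := fun _ => K × A.carrier) a (κ, x)) (fun i => ?_)
      fun i => ?_
    · refine Fin.lastCases ?_ (fun i => ?_) i
      · rw [Fin.snoc_last, Fin.snoc_last]
      · rw [Fin.snoc_castSucc, Fin.snoc_castSucc, h1]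
        rfl
    · refine Fin.lastCases ?_ (fun i => ?_) i
      · rw [Fin.snoc_last, hx']
        rfl
      · rw [Fin.snoc_castSucc, initSeg_snoc_castSucc]
        exact hv.word_hom W p h1 i
  obtain ⟨z, hz, hz'⟩ := W.exists_of_isOPE hp hv hpos
  refine ⟨StrHom.toFun (G.ε.app B) (StrHom.toFun q.f z), _, hz', fun i => ?_, fun i => ?_⟩
  · refine Fin.lastCases ?_ (fun i => ?_) i
    · rw [Fin.snoc_last, Fin.snoc_last, ← hεx]
      exact Prod.ext rfl (congrArg (StrHom.toFun (G.ε.app A)) hz).symm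
    · rw [Fin.snoc_castSucc, Fin.snoc_castSucc, h1]
  · refine Fin.lastCases ?_ (fun i => ?_) i
    · rw [Fin.snoc_last, Fin.snoc_last]
      rfl
    · rw [Fin.snoc_castSucc, Fin.snoc_castSucc, h2]

/-- Both tuples come from one tuple in a chain of `Z`, on which `p` reflects and `q` preserves
relations. -/
theorem SpanPos.rel {Z : G.Coalgebra} {p : Z ⟶ G.cofree.obj A} {q : Z ⟶ G.cofree.obj B}
    (hp : IsOPE (strongInj σ) G path p) {m : ℕ}
    {a : Fin m → K × A.carrier} {b : Fin m → K × B.carrier} (h : W.SpanPos p q m a b)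
    {R : σ.Rel} {s : Fin (σ.arity R) → (G.obj A).carrier}
    {t : Fin (σ.arity R) → (G.obj B).carrier}
    (hst : ∀ i, (∃ c, s i = (G.obj A).con c ∧ t i = (G.obj B).con c) ∨
      ∃ l, W.word A (s i) = Sum.inl (initSeg a l) ∧ W.word B (t i) = Sum.inl (initSeg b l))
    (hs : (G.obj A).rel R s) : (G.obj B).rel R t := by
  obtain ⟨v, hv, h1, h2⟩ := h
  have hz : ∀ i, ∃ z ∈ chainSet Z v, StrHom.toFun p.f z = s i ∧ StrHom.toFun q.f z = t i := by
    intro i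
    rcases hst i with ⟨c, hc, hc'⟩ | ⟨l, hl, hl'⟩
    · exact ⟨Z.A.con c, Or.inl ⟨c, rfl⟩, (p.f.map_con c).trans hc.symm,
        (q.f.map_con c).trans hc'.symm⟩
    · exact ⟨(v l).2, Or.inr ⟨l, rfl⟩,
        W.word_injective A ((hv.word_hom W p h1 l).trans hl.symm),
        W.word_injective B ((hv.word_hom W q h2 l).trans hl'.symm)⟩
  choose z hz hzp hzq using hz
  have h3 : Z.A.rel R z := by
    refine W.rel_of_isPathwiseEmb hp.1 hv hz ?_
    simp only [hzp]
    exact hs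
  have h4 := q.f.map_rel R z h3
  simp only [hzq] at h4
  exact h4

/-- A span of open pathwise-embeddings gives a back-and-forth system. -/
theorem exists_backForth (h : IsSpanned (strongInj σ) G path A B) :
    ∃ T : ∀ m, (Fin m → K × A.carrier) → (Fin m → K × B.carrier) → Prop,
      W.BackForth A B T := by
  obtain ⟨Z, p, q, hp, hq⟩ := h
  refine ⟨W.SpanPos p q, ⟨Fin.elim0, fun i => i.elim0, fun i => i.elim0, fun i => i.elim0⟩,
    ?_, ?_, ?_, ?_, ?_⟩
  · rintro m a b ⟨v, hv, h1, h2⟩ i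
    rw [h1, h2]
    rfl
  · rintro m a b ⟨v, hv, h1, h2⟩ i
    exact ⟨⟨_, hv.word_hom W p h1 i⟩, ⟨_, hv.word_hom W q h2 i⟩⟩
  · intro m a b hT R s t hst
    exact ⟨SpanPos.rel W hp hT hst, SpanPos.rel W hq (hT.symm W) fun i =>
      (hst i).imp (fun ⟨c, hc⟩ => ⟨c, hc.symm⟩) fun ⟨l, hl⟩ => ⟨l, hl.symm⟩⟩
  · intro m a b hT κ x hx
    exact SpanPos.forth W hp hT κ x hx
  · intro m a b hT κ y hy
    obtain ⟨x, hx⟩ := SpanPos.forth W hq (hT.symm W) κ y hy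
    exact ⟨x, hx.symm W⟩

end WordComonad

/-! ### The three comonads as comonads of words -/

namespace EF

variable {σ : Signature.{u}} {k : ℕ}

/-- The word of an element of `E_k A`, with trivial indices. -/
def word (A : Str σ) : Carrier k A → Word (Unit × A.carrier) ⊕ σ.Const
  | Sum.inl w => Sum.inl (w.1.map fun a => ((), a))
  | Sum.inr c => Sum.inr c

theorem unit_injective {X : Type u} : Function.Injective fun a : X => ((), a) :=
  fun _ _ h => congrArg Prod.snd h

theorem eq_of_word {A : Str σ} {x : Carrier k A} {w : Word (Unit × A.carrier)}
    (h : word A x = Sum.inl w) : ∃ u, x = Sum.inl u ∧ w = u.1.map fun a => ((), a) := by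
  cases x with
  | inl u => exact ⟨u, rfl, (Sum.inl.inj h).symm⟩
  | inr c => cases h

theorem exists_word_iff {A : Str σ} {w : Word (Unit × A.carrier)} :
    (∃ x : Carrier k A, word A x = Sum.inl w) ↔ w.len < k := by
  constructor
  · rintro ⟨x, hx⟩
    obtain ⟨u, rfl, rfl⟩ := eq_of_word hx
    exact u.2
  · intro h
    exact ⟨Sum.inl ⟨w.map Prod.snd, h⟩, rfl⟩

variable (σ k)

/-- `E_k` as a comonad of words. -/
def wordComonad : WordComonad (comonad σ k) (path σ k) Unit where
  word := word (k := k)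
  word_injective A x y h := by
    cases x with
    | inl w =>
      obtain ⟨u, rfl, hu⟩ := eq_of_word h.symm
      rw [Subtype.ext (Word.map_injective unit_injective hu)]
    | inr c =>
      cases y with
      | inl w => cases h
      | inr c' =>
        cases h
        rfl
  word_con _ _ := rfl
  eps_word A x w h := by
    obtain ⟨u, rfl, rfl⟩ := eq_of_word h
    rfl
  word_map f x w h := by
    obtain ⟨u, rfl, rfl⟩ := eq_of_word h
    rfl
  word_delta A x w h := by
    obtain ⟨u, rfl, rfl⟩ := eq_of_word h
    exact ⟨seg u, fun _ => rfl, rfl⟩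
  range_lift B f _ w h := by
    have h' := exists_word_iff.1 (h true)
    exact exists_word_iff.2 h'
  rel_comparable h i j w w' hw hw' := by
    obtain ⟨u, hu, rfl⟩ := eq_of_word hw
    obtain ⟨u', hu', rfl⟩ := eq_of_word hw'
    exact (h.1 i j u u' hu hu').map _
  rel_lift f R s hc _ hε := by
    refine ⟨fun i j w w' hw hw' => ?_, hε⟩
    refine Word.comparable_of_map unit_injective (hc i j _ _ ?_ ?_)
    · rw [hw]
      rfl
    · rw [hw']
      rfl
  path_iff X := by
    refine and_congr (Eq.to_iff (congrArg Set.Finite (Set.ext fun x => ?_))) ⟨fun h => ?_, fun h => ?_⟩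
    · constructor
      · rintro ⟨w, hw⟩
        exact ⟨_, congrArg (word X.A) hw⟩
      · rintro ⟨w, hw⟩
        obtain ⟨u, hu, -⟩ := eq_of_word hw
        exact ⟨u, hu⟩
    · intro x y w w' hw hw'
      obtain ⟨u, hu, rfl⟩ := eq_of_word hw
      obtain ⟨u', hu', rfl⟩ := eq_of_word hw'
      exact (h x y u u' hu hu').map _
    · intro x y w w' hw hw'
      exact Word.comparable_of_map unit_injective
        (h x y _ _ (congrArg (word X.A) hw) (congrArg (word X.A) hw'))

end EF

namespace Pebble

variable {σ : Signature.{u}} {k : ℕ}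

/-- Activity involves only pebble indices, and these are not changed by the map. -/
theorem active_of_map {X Y : Type u} (f : X → Y) {w w' : Word (Fin k × X)}
    (h : Active (w.map (Prod.map id f)) (w'.map (Prod.map id f))) : Active w w' := h

variable (σ k)

/-- `P_k` as a comonad of words. -/
def wordComonad : WordComonad (comonad σ k) (path σ k) (Fin k) where
  word _ x := x
  word_injective _ _ _ h := h
  word_con _ _ := rfl
  eps_word A x w h := by
    obtain rfl : x = Sum.inl w := h
    rfl
  word_map f x w h := by
    obtain rfl : x = Sum.inl w := h
    rfl
  word_delta A x w h := by
    obtain rfl : x = Sum.inl w := h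
    exact ⟨fun i => Sum.inl (w.take i), fun _ => rfl, rfl⟩
  range_lift _ _ _ w _ := ⟨Sum.inl w, rfl⟩
  rel_comparable h := h.1
  rel_lift {A B} f R s hc h hε := by
    refine ⟨hc, fun i j w w' hw hw' hle => ?_, hε⟩
    have key : ∀ i w, s i = Sum.inl w → StrHom.toFun ((comonad σ k).map f) (s i) =
        (Sum.inl (w.map (Prod.map id (StrHom.toFun f))) : Carrier k B) := by
      intro i w hw
      rw [hw]
      rfl
    exact active_of_map (StrHom.toFun f) (h.2.1 i j _ _ (key i w hw) (key j w' hw') (hle.map _))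
  path_iff _ := Iff.rfl

end Pebble

namespace Modal

variable {P : Type u} {k : ℕ}

/-- The word of an element of `M_k A`, with trivial indices. -/
def word (A : Str (modalSig P)) : Carrier k A → Word (Unit × A.carrier) ⊕ PUnit.{u + 1}
  | Sum.inl w => Sum.inl (w.1.map fun a => ((), a))
  | Sum.inr c => Sum.inr c

theorem eq_of_word {A : Str (modalSig P)} {x : Carrier k A} {w : Word (Unit × A.carrier)}
    (h : word A x = Sum.inl w) : ∃ u, x = Sum.inl u ∧ w = u.1.map fun a => ((), a) := by
  cases x with
  | inl u => exact ⟨u, rfl, (Sum.inl.inj h).symm⟩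
  | inr c => cases h

theorem exists_word_iff {A : Str (modalSig P)} {w : Word (Unit × A.carrier)} :
    (∃ x : Carrier k A, word A x = Sum.inl w) ↔ w.len < k ∧ IsWalk A (w.map Prod.snd) := by
  constructor
  · rintro ⟨x, hx⟩
    obtain ⟨u, rfl, rfl⟩ := eq_of_word hx
    exact u.2
  · intro h
    exact ⟨Sum.inl ⟨w.map Prod.snd, h⟩, rfl⟩

/-- For comparable words, covering is a statement about lengths, which letterwise maps keep. -/
theorem step_of_map {A B : Str (modalSig P)} (f : A ⟶ B) {x y : Carrier k A}
    (hc : ∀ w w', word A x = Sum.inl w → word A y = Sum.inl w' → w.Comparable w')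
    (h : Step (k := k) (StrHom.toFun ((comonad P k).map f) x)
      (StrHom.toFun ((comonad P k).map f) y)) : Step x y := by
  match x, y, h, hc with
  | Sum.inr _, Sum.inl w, h, _ => exact h
  | Sum.inl w, Sum.inl w', h, hc =>
    have hl : w'.1.len = w.1.len + 1 := h.2
    have h1 := Word.comparable_of_map EF.unit_injective (hc _ _ rfl rfl)
    exact ⟨h1.le_of_len_le (by omega), hl⟩
  | Sum.inl w, Sum.inr _, h, _ => exact h.elim
  | Sum.inr _, Sum.inr _, h, _ => exact h.elim

variable (P k)

/-- `M_k` as a comonad of words. -/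
def wordComonad : WordComonad (comonad P k) (path P k) Unit where
  word := word (k := k)
  word_injective A x y h := by
    cases x with
    | inl w =>
      obtain ⟨u, rfl, hu⟩ := eq_of_word h.symm
      rw [Subtype.ext (Word.map_injective EF.unit_injective hu)]
    | inr c =>
      cases y with
      | inl w => cases h
      | inr c' => rfl
  word_con _ _ := rfl
  eps_word A x w h := by
    obtain ⟨u, rfl, rfl⟩ := eq_of_word h
    rfl
  word_map f x w h := by
    obtain ⟨u, rfl, rfl⟩ := eq_of_word h
    rfl
  word_delta A x w h := by
    obtain ⟨u, rfl, rfl⟩ := eq_of_word h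
    exact ⟨seg u, fun _ => rfl, rfl⟩
  range_lift {A} B f hf w h := by
    have h' := fun b => exists_word_iff.1 (h b)
    have hacc : ∀ x y, (∀ b, acc (B b) (StrHom.toFun (f b) x) (StrHom.toFun (f b) y)) →
        acc A x y := by
      intro x y hxy
      refine hf ModalRel.E (fun i : Fin 2 => ![x, y] i) fun b => ?_
      exact (acc_of_rel (A := B b) _).mpr (hxy b)
    refine exists_word_iff.2 ⟨(h' true).1, hacc _ _ fun b => ?_, fun i hi => hacc _ _ fun b => ?_⟩
    · have h1 := (h' b).2.1
      have h2 : StrHom.toFun (f b) (point A) = point (B b) := (f b).map_con PUnit.unit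
      rw [h2]
      exact h1
    · exact (h' b).2.2 i hi
  rel_comparable {A R s} h i j w w' hw hw' := by
    obtain ⟨u, hu, rfl⟩ := eq_of_word hw
    obtain ⟨u', hu', rfl⟩ := eq_of_word hw'
    refine Word.Comparable.map ?_ _
    have hrefl : ∀ v : Word A.carrier, v.Comparable v := fun v => Or.inl ⟨Fin.last _, rfl⟩
    cases R with
    | prop p =>
      have hij : i = j := Subsingleton.elim (α := Fin 1) i j
      subst hij
      obtain rfl : u = u' := Sum.inl.inj (hu.symm.trans hu')
      exact hrefl _
    | E =>
      have hst : Step (s (0 : Fin 2)) (s (1 : Fin 2)) := h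
      have key : ∀ v v' : {w : Word A.carrier // w.len < k ∧ IsWalk A w},
          s (0 : Fin 2) = Sum.inl v → s (1 : Fin 2) = Sum.inl v' → v.1.Le v'.1 := by
        intro v v' hv hv'
        rw [hv, hv'] at hst
        exact hst.1
      change Fin 2 at i j
      fin_cases i <;> fin_cases j
      · obtain rfl : u = u' := Sum.inl.inj (hu.symm.trans hu')
        exact hrefl _
      · exact Or.inl (key u u' hu hu')
      · exact Or.inr (key u' u hu' hu)
      · obtain rfl : u = u' := Sum.inl.inj (hu.symm.trans hu')
        exact hrefl _
  rel_lift {A B} f R s hc h hε := by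
    cases R with
    | prop p => exact (holds_of_rel (A := A) p _).mp hε
    | E =>
      exact step_of_map f (hc (0 : Fin 2) (1 : Fin 2)) h
  path_iff X := by
    refine and_congr (Eq.to_iff (congrArg Set.Finite (Set.ext fun x => ?_))) ⟨fun h => ?_, fun h => ?_⟩
    · constructor
      · rintro ⟨w, hw⟩
        exact ⟨_, congrArg (word X.A) hw⟩
      · rintro ⟨w, hw⟩
        obtain ⟨u, hu, -⟩ := eq_of_word hw
        exact ⟨u, hu⟩
    · intro x y w w' hw hw'
      obtain ⟨u, hu, rfl⟩ := eq_of_word hw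
      obtain ⟨u', hu', rfl⟩ := eq_of_word hw'
      exact (h x y u u' hu hu').map _
    · intro x y w w' hw hw'
      exact Word.comparable_of_map EF.unit_injective
        (h x y _ _ (congrArg (word X.A) hw) (congrArg (word X.A) hw'))

end Modal

/-! ### First-order formulas of bounded quantifier rank -/

open Word FirstOrder.Language

namespace Signature

variable {σ : Signature.{u}}

/-- Variables and constants as terms. -/
def term {m : ℕ} : Fin m ⊕ σ.Const → σ.language.Term (Empty ⊕ Fin m)
  | Sum.inl i => .var (Sum.inr i)
  | Sum.inr c => .func (l := 0) c Fin.elim0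

/-- The value of a variable or constant. -/
def termVal (A : Str σ) {m : ℕ} (x : Fin m → A.carrier) : Fin m ⊕ σ.Const → A.carrier :=
  Sum.elim x A.con

theorem realize_term (A : Str σ) {m : ℕ} (x : Fin m → A.carrier) (t : Fin m ⊕ σ.Const) :
    (term t).realize (Sum.elim (default : Empty → A.carrier) x) = termVal A x t := by
  cases t <;> rfl

/-- The tuple `x` satisfies the formula `φ` in `A`. -/
def Realizes (A : Str σ) {m : ℕ} (φ : σ.language.BoundedFormula Empty m)
    (x : Fin m → A.carrier) : Prop := φ.Realize default x

theorem realizes_sentence (A : Str σ) (φ : σ.language.Sentence) (x : Fin 0 → A.carrier) :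
    Realizes A φ x ↔ A.carrier ⊨ φ := by
  rw [Subsingleton.elim x default]
  rfl

/-- All function symbols are constants, so terms cannot be nested. -/
theorem exists_term {m : ℕ} (t : σ.language.Term (Empty ⊕ Fin m)) : ∃ t', t = term t' := by
  match t with
  | .var (Sum.inr i) => exact ⟨Sum.inl i, rfl⟩
  | .func (l := 0) c ts =>
    refine ⟨Sum.inr c, ?_⟩
    rw [Subsingleton.elim ts Fin.elim0]
    rfl
  | .func (l := n + 1) f ts => exact PEmpty.elim f

/-- The atomic formula given by a relation symbol. -/
def relFormula {m : ℕ} (R : σ.Rel) (t : Fin (σ.arity R) → Fin m ⊕ σ.Const) :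
    σ.language.BoundedFormula Empty m :=
  .rel (l := σ.arity R) (⟨R, rfl⟩ : {R' : σ.Rel // σ.arity R' = σ.arity R}) fun i => term (t i)

theorem realize_relFormula (A : Str σ) {m : ℕ} (x : Fin m → A.carrier) (R : σ.Rel)
    (t : Fin (σ.arity R) → Fin m ⊕ σ.Const) :
    Realizes A (relFormula R t) x ↔ A.rel R fun i => termVal A x (t i) := by
  have h : (fun i => (term (t i)).realize (Sum.elim (default : Empty → A.carrier) x)) =
      fun i => termVal A x (t i) := funext fun i => realize_term A x (t i)
  rw [← h]
  exact Iff.rfl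

theorem realize_equal_term (A : Str σ) {m : ℕ} (x : Fin m → A.carrier)
    (t t' : Fin m ⊕ σ.Const) :
    Realizes A (.equal (term t) (term t')) x ↔
      termVal A x t = termVal A x t' := by
  rw [← realize_term, ← realize_term]
  exact Iff.rfl

theorem exists_relFormula {m n : ℕ} (R : σ.language.Relations n)
    (ts : Fin n → σ.language.Term (Empty ⊕ Fin m)) :
    ∃ R' t, BoundedFormula.rel R ts = relFormula R' t := by
  obtain ⟨R, rfl⟩ := R
  choose t ht using fun i => exists_term (ts i)
  exact ⟨R, t, by rw [funext ht]; rfl⟩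

theorem quantRank_foldr {m r : ℕ} (L : List (σ.language.BoundedFormula Empty m))
    (h : ∀ φ ∈ L, quantRank φ ≤ r) : quantRank (L.foldr (· ⊓ ·) ⊤) ≤ r := by
  induction L with
  | nil => exact Nat.zero_le r
  | cons φ L ih =>
    rw [List.forall_mem_cons] at h
    change max (max (quantRank φ) (max (quantRank (L.foldr (· ⊓ ·) ⊤)) 0)) 0 ≤ r
    have := ih h.2
    have := h.1
    omega

theorem quantRank_iInf {m r : ℕ} {ι : Type u} [Finite ι]
    (F : ι → σ.language.BoundedFormula Empty m) (h : ∀ i, quantRank (F i) ≤ r) :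
    quantRank (BoundedFormula.iInf F) ≤ r := by
  refine quantRank_foldr _ fun φ hφ => ?_
  obtain ⟨i, -, rfl⟩ := List.mem_map.1 hφ
  exact h i

/-- Truth values for the formulas in `F`, as a formula. -/
noncomputable def typeFormula {m : ℕ} {ι : Type u} [Finite ι]
    (F : ι → σ.language.BoundedFormula Empty m) (T : Set ι) :
    σ.language.BoundedFormula Empty m :=
  open Classical in BoundedFormula.iInf fun i => if i ∈ T then F i else (F i).not

theorem quantRank_typeFormula {m r : ℕ} {ι : Type u} [Finite ι]
    (F : ι → σ.language.BoundedFormula Empty m) (T : Set ι) (h : ∀ i, quantRank (F i) ≤ r) :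
    quantRank (typeFormula F T) ≤ r := by
  classical
  refine quantRank_iInf _ fun i => ?_
  by_cases hi : i ∈ T
  · simp only [hi, if_true]
    exact h i
  · simp only [hi, if_false]
    exact max_le (h i) (Nat.zero_le r)

theorem realize_typeFormula (A : Str σ) {m : ℕ} {ι : Type u} [Finite ι]
    (F : ι → σ.language.BoundedFormula Empty m) (T : Set ι) (x : Fin m → A.carrier) :
    Realizes A (typeFormula F T) x ↔ ∀ i, Realizes A (F i) x ↔ i ∈ T := by
  classical
  unfold typeFormula Realizes
  rw [BoundedFormula.realize_iInf]
  refine forall_congr' fun i => ?_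
  by_cases hi : i ∈ T
  · simp [hi]
  · simp [hi]

/-- If two tuples agree on the extension types for `F`, then every extension of one of them is
matched by an extension of the other which agrees on `F`. -/
theorem exists_extension {A B : Str σ} {m : ℕ} {ι : Type u} [Finite ι]
    {F : ι → σ.language.BoundedFormula Empty (m + 1)} {x : Fin m → A.carrier}
    {y : Fin m → B.carrier}
    (h : ∀ T : Set ι, Realizes A (typeFormula F T).ex x →
      Realizes B (typeFormula F T).ex y) (a : A.carrier) :
    ∃ b : B.carrier, ∀ i, Realizes A (F i) (Fin.snoc (α := fun _ => A.carrier) x a) ↔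
      Realizes B (F i) (Fin.snoc (α := fun _ => B.carrier) y b) := by
  have h1 := h {i | Realizes A (F i) (Fin.snoc (α := fun _ => A.carrier) x a)}
    (BoundedFormula.realize_ex.2 ⟨a, (realize_typeFormula A F _ _).2 fun i => Iff.rfl⟩)
  obtain ⟨b, hb⟩ := BoundedFormula.realize_ex.1 h1
  exact ⟨b, fun i => ((realize_typeFormula B F _ _).1 hb i).symm⟩

/-- Over a finite signature, finitely many formulas determine those of bounded quantifier rank. -/
theorem exists_finite_determining [Finite σ.Rel] [Finite σ.Const] (r : ℕ) : ∀ m : ℕ,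
    ∃ (ι : Type u) (_ : Finite ι) (F : ι → σ.language.BoundedFormula Empty m),
      (∀ i, quantRank (F i) ≤ r) ∧ ∀ (A B : Str σ) (x : Fin m → A.carrier) (y : Fin m → B.carrier),
        (∀ i, Realizes A (F i) x ↔ Realizes B (F i) y) →
        ∀ φ : σ.language.BoundedFormula Empty m, quantRank φ ≤ r →
          (Realizes A φ x ↔ Realizes B φ y) := by
  induction r with
  | zero =>
    intro m
    -- In rank zero the atomic formulas suffice; there are finitely many of them over a finite
    -- signature.
    refine ⟨(Σ R : σ.Rel, Fin (σ.arity R) → Fin m ⊕ σ.Const) ⊕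
      ((Fin m ⊕ σ.Const) × (Fin m ⊕ σ.Const)), inferInstance,
      Sum.elim (fun a => relFormula a.1 a.2) fun t => .equal (term t.1) (term t.2), ?_, ?_⟩
    · rintro (a | a) <;> exact le_rfl
    · intro A B x y h φ
      induction φ with
      | falsum => exact fun _ => Iff.rfl
      | equal t₁ t₂ =>
        obtain ⟨t₁, rfl⟩ := exists_term t₁
        obtain ⟨t₂, rfl⟩ := exists_term t₂
        exact fun _ => h (Sum.inr (t₁, t₂))
      | rel R ts =>
        obtain ⟨R', t, hR⟩ := exists_relFormula R ts
        rw [hR]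
        exact fun _ => h (Sum.inl ⟨R', t⟩)
      | imp φ ψ ih₁ ih₂ =>
        intro hr
        have hr' := max_le_iff.1 hr
        exact imp_congr (ih₁ x y h hr'.1) (ih₂ x y h hr'.2)
      | all φ => exact fun hr => absurd hr (Nat.not_succ_le_zero _)
  | succ r ih =>
    intro m
    obtain ⟨ι, _, F, hF, hdet⟩ := ih (m + 1)
    obtain ⟨ι₀, _, F₀, hF₀, hdet₀⟩ := ih m
    -- To the formulas for rank `r` one adds, for every set `T`, the statement that some extension
    -- of the tuple satisfies exactly the members of `T` among the formulas for rank `r` in one more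
    -- variable.
    refine ⟨ι₀ ⊕ Set ι, inferInstance, Sum.elim F₀ fun T => (typeFormula F T).ex, ?_, ?_⟩
    · rintro (i | T)
      · exact (hF₀ i).trans (Nat.le_succ r)
      · have := quantRank_typeFormula F T hF
        -- `∃` is `¬∀¬`, and each negation is an implication to `⊥`, which contributes a maximum
        -- with `0`.
        change max (max (quantRank (typeFormula F T)) 0 + 1) 0 ≤ r + 1
        omega
    · intro A B x y h φ
      have h₀ := hdet₀ A B x y fun i => h (Sum.inl i)
      induction φ with
      | falsum => exact fun _ => Iff.rfl
      | equal t₁ t₂ => exact fun _ => h₀ _ (Nat.zero_le r)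
      | rel R ts => exact fun _ => h₀ _ (Nat.zero_le r)
      | imp φ ψ ih₁ ih₂ =>
        intro hr
        have hr' := max_le_iff.1 hr
        exact imp_congr (ih₁ F hF hdet F₀ hF₀ hdet₀ x y h h₀ hr'.1)
          (ih₂ F hF hdet F₀ hF₀ hdet₀ x y h h₀ hr'.2)
      | all φ =>
        intro hr
        have hr' := Nat.succ_le_succ_iff.1 hr
        unfold Realizes
        rw [BoundedFormula.realize_all, BoundedFormula.realize_all]
        constructor
        · intro hA b
          obtain ⟨a, ha⟩ := exists_extension (fun T => (h (Sum.inr T)).2) b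
          exact (hdet _ _ _ _ ha φ hr').2 (hA a)
        · intro hB a
          obtain ⟨b, hb⟩ := exists_extension (fun T => (h (Sum.inr T)).1) a
          exact (hdet _ _ _ _ hb φ hr').2 (hB b)

end Signature

namespace Word

theorem snoc_comp {X Y : Type u} (f : X → Y) {m : ℕ} (v : Fin m → X) (x : X) :
    (fun i => f (Fin.snoc (α := fun _ => X) v x i)) = Fin.snoc (α := fun _ => Y)
      (fun i => f (v i)) (f x) := by
  funext i
  refine Fin.lastCases ?_ (fun i => ?_) i
  · rw [Fin.snoc_last, Fin.snoc_last]
  · rw [Fin.snoc_castSucc, Fin.snoc_castSucc]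

end Word

/-! ### The Ehrenfeucht–Fraïssé game and quantifier rank -/

namespace EF

variable {σ : Signature.{u}} {k : ℕ} {A B : Str σ}

theorem valid_iff {w : Word (Unit × A.carrier)} :
    (wordComonad σ k).Valid A w ↔ w.len < k := exists_word_iff

/-- The winning condition of the game for `E_k`, in terms of atomic formulas. -/
theorem reflect_of_rel_iff {m : ℕ} {v : Fin m → Unit × (A.prod B).carrier}
    (h : ∀ (R : σ.Rel) (t : Fin (σ.arity R) → Fin m ⊕ σ.Const),
      (A.rel R fun i => Signature.termVal A (fun i => (v i).2.1) (t i)) ↔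
        B.rel R fun i => Signature.termVal B (fun i => (v i).2.2) (t i))
    {R : σ.Rel} {s : Fin (σ.arity R) → Carrier k (A.prod B)}
    (hs : ∀ i, (∃ c, word _ (s i) = Sum.inr c) ∨ ∃ l, word _ (s i) = Sum.inl (initSeg v l)) :
    (((obj k A).rel R fun i => StrHom.toFun ((comonad σ k).map (A.fst B)) (s i)) →
      B.rel R fun i => (eps (A.prod B) (s i)).2) ∧
    (((obj k B).rel R fun i => StrHom.toFun ((comonad σ k).map (A.snd B)) (s i)) →
      A.rel R fun i => (eps (A.prod B) (s i)).1) := by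
  have ht : ∀ i, ∃ t : Fin m ⊕ σ.Const,
      (eps _ (s i)).1 = Signature.termVal A (fun i => (v i).2.1) t ∧
      (eps _ (s i)).2 = Signature.termVal B (fun i => (v i).2.2) t := by
    intro i
    rcases hs i with ⟨c, hc⟩ | ⟨l, hl⟩
    · refine ⟨Sum.inr c, ?_⟩
      have hc' : s i = Sum.inr c := (wordComonad σ k).eq_con hc
      rw [hc']
      exact ⟨rfl, rfl⟩
    · refine ⟨Sum.inl l, ?_⟩
      have h1 : eps _ (s i) = (initSeg v l).last.2 :=
        (wordComonad σ k).eps_word _ _ _ hl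
      rw [h1]
      exact ⟨rfl, rfl⟩
  choose t ht1 ht2 using ht
  have hε1 : ∀ i, eps A (StrHom.toFun ((comonad σ k).map (A.fst B)) (s i)) =
      Signature.termVal A (fun i => (v i).2.1) (t i) :=
    fun i => (Str.congr_toFun ((comonad σ k).ε.naturality (A.fst B)) (s i)).trans (ht1 i)
  have hε2 : ∀ i, eps B (StrHom.toFun ((comonad σ k).map (A.snd B)) (s i)) =
      Signature.termVal B (fun i => (v i).2.2) (t i) :=
    fun i => (Str.congr_toFun ((comonad σ k).ε.naturality (A.snd B)) (s i)).trans (ht2 i)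
  refine ⟨fun hA => ?_, fun hB => ?_⟩
  · have h1 := hA.2
    simp only [hε1] at h1
    simp only [ht2]
    exact (h R t).1 h1
  · have h1 := hB.2
    simp only [hε2] at h1
    simp only [ht1]
    exact (h R t).2 h1

/-- The positions whose two sides agree on all formulas of the remaining quantifier rank. -/
def Agree (k : ℕ) (A B : Str σ) (m : ℕ) (v : Fin m → Unit × (A.carrier × B.carrier)) : Prop :=
  m ≤ k ∧ ∀ φ : σ.language.BoundedFormula Empty m, quantRank φ ≤ k - m →
    (Signature.Realizes A φ (fun i => (v i).2.1) ↔ Signature.Realizes B φ fun i => (v i).2.2)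

theorem Agree.rel_iff {m : ℕ} {v : Fin m → Unit × (A.carrier × B.carrier)}
    (h : Agree k A B m v) (R : σ.Rel) (t : Fin (σ.arity R) → Fin m ⊕ σ.Const) :
    (A.rel R fun i => Signature.termVal A (fun i => (v i).2.1) (t i)) ↔
      B.rel R fun i => Signature.termVal B (fun i => (v i).2.2) (t i) := by
  rw [← Signature.realize_relFormula, ← Signature.realize_relFormula]
  exact h.2 (Signature.relFormula R t) (Nat.zero_le _)

theorem Agree.eq_iff {m : ℕ} {v : Fin m → Unit × (A.carrier × B.carrier)}
    (h : Agree k A B m v) (t t' : Fin m ⊕ σ.Const) :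
    Signature.termVal A (fun i => (v i).2.1) t = Signature.termVal A (fun i => (v i).2.1) t' ↔
    Signature.termVal B (fun i => (v i).2.2) t = Signature.termVal B (fun i => (v i).2.2) t' := by
  rw [← Signature.realize_equal_term, ← Signature.realize_equal_term]
  exact h.2 (.equal (Signature.term t) (Signature.term t')) (Nat.zero_le _)

theorem Agree.zero (h : FOEquiv k A B) (v : Fin 0 → Unit × (A.carrier × B.carrier)) :
    Agree k A B 0 v := by
  refine ⟨Nat.zero_le k, fun φ hφ => ?_⟩
  rw [Signature.realizes_sentence, Signature.realizes_sentence]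
  exact h φ hφ

/-- Since `m < k`, the rank `k - m` exceeds `k - (m + 1)` by one, which is just the quantifier in
front of a type formula for the next position. -/
theorem Agree.forth [Finite σ.Rel] [Finite σ.Const] {m : ℕ}
    {v : Fin m → Unit × (A.carrier × B.carrier)} (h : Agree k A B m v) (hm : m < k) (κ : Unit)
    (a : A.carrier) : ∃ b, Agree k A B (m + 1)
      (Fin.snoc (α := fun _ => Unit × (A.carrier × B.carrier)) v (κ, (a, b))) := by
  obtain ⟨ι, _, F, hF, hdet⟩ := Signature.exists_finite_determining (σ := σ) (k - (m + 1)) (m + 1)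
  obtain ⟨b, hb⟩ := Signature.exists_extension (F := F) (A := A) (B := B)
    (x := fun i => (v i).2.1) (y := fun i => (v i).2.2)
    (fun T => (h.2 (Signature.typeFormula F T).ex (by
      have := Signature.quantRank_typeFormula F T hF
      change max (max (quantRank (Signature.typeFormula F T)) 0 + 1) 0 ≤ k - m
      omega)).1) a
  refine ⟨b, hm, fun φ hφ => ?_⟩
  rw [Word.snoc_comp (fun x : Unit × (A.carrier × B.carrier) => x.2.1) v,
    Word.snoc_comp (fun x : Unit × (A.carrier × B.carrier) => x.2.2) v]
  exact hdet A B _ _ hb φ hφ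

theorem Agree.back [Finite σ.Rel] [Finite σ.Const] {m : ℕ}
    {v : Fin m → Unit × (A.carrier × B.carrier)} (h : Agree k A B m v) (hm : m < k) (κ : Unit)
    (b : B.carrier) : ∃ a, Agree k A B (m + 1)
      (Fin.snoc (α := fun _ => Unit × (A.carrier × B.carrier)) v (κ, (a, b))) := by
  obtain ⟨ι, _, F, hF, hdet⟩ := Signature.exists_finite_determining (σ := σ) (k - (m + 1)) (m + 1)
  obtain ⟨a, ha⟩ := Signature.exists_extension (F := F) (A := B) (B := A)
    (x := fun i => (v i).2.2) (y := fun i => (v i).2.1)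
    (fun T => (h.2 (Signature.typeFormula F T).ex (by
      have := Signature.quantRank_typeFormula F T hF
      change max (max (quantRank (Signature.typeFormula F T)) 0 + 1) 0 ≤ k - m
      omega)).2) b
  refine ⟨a, hm, fun φ hφ => ?_⟩
  rw [Word.snoc_comp (fun x : Unit × (A.carrier × B.carrier) => x.2.1) v,
    Word.snoc_comp (fun x : Unit × (A.carrier × B.carrier) => x.2.2) v]
  exact hdet A B _ _ (fun i => (ha i).symm) φ hφ

theorem strategy_agree [Finite σ.Rel] [Finite σ.Const] (h : FOEquiv k A B) :
    (wordComonad σ.addI k).Strategy A.withI B.withI (Agree k A B) where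
  zero := Agree.zero h _
  valid m v hv := ⟨valid_iff.2 hv.1, valid_iff.2 hv.1⟩
  reflect m v hv R s hs _ := by
    refine reflect_of_rel_iff (v := v) (fun R t => ?_) hs
    cases R with
    | some R => exact Agree.rel_iff hv R t
    -- The symbol `I` is equality in both structures, so its winning condition is agreement on
    -- equations between entries and constants.
    | none => exact Agree.eq_iff hv (t (0 : Fin 2)) (t (1 : Fin 2))
  forth m v hv κ a ha := Agree.forth hv (valid_iff.1 ha) κ a
  back m v hv κ b hb := Agree.back hv (valid_iff.1 hb) κ b

/-- Structures over a finite signature that agree on sentences of quantifier rank at most `k` are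
connected by a span of open pathwise-embeddings. -/
theorem isSpanned_of_foEquiv [Finite σ.Rel] [Finite σ.Const] (h : FOEquiv k A B) :
    IsSpanned (strongInj σ.addI) (comonad σ.addI k) (path σ.addI k) A.withI B.withI :=
  (strategy_agree h).isSpanned

/-- Initial segments of one tuple are comparable, so only the relation between last elements
remains. -/
theorem rel_initSeg_iff {m : ℕ} {d : Fin m → Unit × A.carrier} {x : Fin m → Carrier k A}
    (hx : ∀ l, word A (x l) = Sum.inl (initSeg d l)) (R : σ.Rel)
    (t : Fin (σ.arity R) → Fin m ⊕ σ.Const) :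
    ((obj k A).rel R fun i => Sum.elim x Sum.inr (t i)) ↔
      A.rel R fun i => Signature.termVal A (fun i => (d i).2) (t i) := by
  have hε : ∀ t, eps A (Sum.elim x Sum.inr t) = Signature.termVal A (fun i => (d i).2) t := by
    rintro (l | c)
    · exact (wordComonad σ k).eps_word _ _ _ (hx l)
    · rfl
  have h1 : ∀ t w, Sum.elim x Sum.inr t = Sum.inl w →
      ∃ l, w.1.map (fun a => ((), a)) = initSeg d l := by
    rintro (l | c) w hw
    · refine ⟨l, Sum.inl.inj (Eq.trans ?_ (hx l))⟩
      have hw' : x l = Sum.inl w := hw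
      rw [hw']
      rfl
    · cases hw
  have hcmp : ∀ i j w w', Sum.elim x Sum.inr (t i) = Sum.inl w →
      Sum.elim x Sum.inr (t j) = Sum.inl w' → w.1.Comparable w'.1 := by
    intro i j w w' hw hw'
    obtain ⟨l, hl⟩ := h1 _ w hw
    obtain ⟨l', hl'⟩ := h1 _ w' hw'
    refine Word.comparable_of_map unit_injective ?_
    rw [hl, hl']
    exact comparable_initSeg d l l'
  exact (and_iff_right hcmp).trans (Iff.of_eq (congrArg (A.rel R) (funext fun i => hε (t i))))

theorem backForth_rel_iff
    {T : ∀ m, (Fin m → Unit × A.carrier) → (Fin m → Unit × B.carrier) → Prop}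
    (hT : (wordComonad σ k).BackForth A B T) {m : ℕ} {a : Fin m → Unit × A.carrier}
    {b : Fin m → Unit × B.carrier} (hab : T m a b) (R : σ.Rel)
    (t : Fin (σ.arity R) → Fin m ⊕ σ.Const) :
    (A.rel R fun i => Signature.termVal A (fun i => (a i).2) (t i)) ↔
      B.rel R fun i => Signature.termVal B (fun i => (b i).2) (t i) := by
  have ha : ∀ l, ∃ x : Carrier k A, word A x = Sum.inl (initSeg a l) := fun l =>
    (hT.valid m a b hab l).1
  have hb : ∀ l, ∃ x : Carrier k B, word B x = Sum.inl (initSeg b l) := fun l =>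
    (hT.valid m a b hab l).2
  choose x hx using ha
  choose y hy using hb
  refine (rel_initSeg_iff hx R t).symm.trans (Iff.trans ?_ (rel_initSeg_iff hy R t))
  refine hT.rel_iff m a b hab R _ _ fun i => ?_
  cases t i with
  | inl l => exact Or.inr ⟨l, hx l, hy l⟩
  | inr c => exact Or.inl ⟨c, rfl, rfl⟩

/-- Equations are instances of `I`. For a quantifier, `quantRank φ + 1 ≤ k - m` gives `m < k`, so
that the word extended by any element is still valid and the system answers the move. -/
theorem realizes_iff_of_backForth
    {T : ∀ m, (Fin m → Unit × A.carrier) → (Fin m → Unit × B.carrier) → Prop}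
    (hT : (wordComonad σ.addI k).BackForth A.withI B.withI T) {m : ℕ}
    (φ : σ.language.BoundedFormula Empty m) (a : Fin m → Unit × A.carrier)
    (b : Fin m → Unit × B.carrier) (hab : T m a b) (hm : m ≤ k) (hφ : quantRank φ ≤ k - m) :
    Signature.Realizes A φ (fun i => (a i).2) ↔ Signature.Realizes B φ fun i => (b i).2 := by
  induction φ with
  | falsum => exact Iff.rfl
  | equal t₁ t₂ =>
    obtain ⟨t₁, rfl⟩ := Signature.exists_term t₁
    obtain ⟨t₂, rfl⟩ := Signature.exists_term t₂
    rw [Signature.realize_equal_term, Signature.realize_equal_term]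
    exact backForth_rel_iff hT hab none (fun i : Fin 2 => ![t₁, t₂] i)
  | rel R ts =>
    obtain ⟨R', t, hR⟩ := Signature.exists_relFormula R ts
    rw [hR, Signature.realize_relFormula, Signature.realize_relFormula]
    exact backForth_rel_iff hT hab (some R') t
  | imp φ ψ ih₁ ih₂ =>
    have hr := max_le_iff.1 hφ
    exact imp_congr (ih₁ a b hab hm hr.1) (ih₂ a b hab hm hr.2)
  | @all m φ ih =>
    have hr : quantRank φ + 1 ≤ k - m := hφ
    unfold Signature.Realizes
    rw [BoundedFormula.realize_all, BoundedFormula.realize_all]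
    constructor
    · intro hA y
      obtain ⟨x, hx⟩ : ∃ x : A.carrier,
          T (m + 1) (Fin.snoc (α := fun _ => Unit × A.carrier) a ((), x))
            (Fin.snoc (α := fun _ => Unit × B.carrier) b ((), y)) :=
        hT.back m a b hab () y (valid_iff.2 (show m < k by omega))
      have h1 := ih _ _ hx (by omega) (by omega)
      rw [Word.snoc_comp (fun x : Unit × A.carrier => x.2),
        Word.snoc_comp (fun x : Unit × B.carrier => x.2)] at h1
      exact h1.1 (hA x)
    · intro hB x
      obtain ⟨y, hy⟩ : ∃ y : B.carrier,
          T (m + 1) (Fin.snoc (α := fun _ => Unit × A.carrier) a ((), x))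
            (Fin.snoc (α := fun _ => Unit × B.carrier) b ((), y)) :=
        hT.forth m a b hab () x (valid_iff.2 (show m < k by omega))
      have h1 := ih _ _ hy (by omega) (by omega)
      rw [Word.snoc_comp (fun x : Unit × A.carrier => x.2),
        Word.snoc_comp (fun x : Unit × B.carrier => x.2)] at h1
      exact h1.2 (hB y)

/-- Structures that are connected by a span of open pathwise-embeddings agree on sentences of
quantifier rank at most `k`. -/
theorem foEquiv_of_isSpanned
    (h : IsSpanned (strongInj σ.addI) (comonad σ.addI k) (path σ.addI k) A.withI B.withI) :
    FOEquiv k A B := by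
  obtain ⟨T, hT⟩ := (wordComonad σ.addI k).exists_backForth h
  intro φ hφ
  exact (Signature.realizes_sentence A φ _).symm.trans
    ((realizes_iff_of_backForth hT φ _ _ hT.zero (Nat.zero_le k) hφ).trans
      (Signature.realizes_sentence B φ _))

end EF

/-! ### Classes of `k`-variable formulas -/

namespace VarFormula

variable {σ : Signature.{u}} {k : ℕ}

/-- A class of formulas that contains the atomic ones and is closed under negation, quantification
and conjunctions indexed by `D`. -/
structure IsClosedClass (Φ : ∀ s : Set (Fin k), VarFormula σ k s → Prop) (D : Type u) : Prop where
  rel : ∀ s R t, Φ s (.rel R t)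
  equal : ∀ s t t', Φ s (.equal t t')
  neg : ∀ s φ, Φ s φ → Φ s (.neg φ)
  conj : ∀ s (φ : D → VarFormula σ k s), (∀ d, Φ s (φ d)) → Φ s (.conj D φ)
  all : ∀ s x φ, Φ (insert x s) φ → Φ s (.all x φ)

theorem isClosedClass_true (D : Type u) :
    IsClosedClass (σ := σ) (k := k) (fun _ _ => True) D :=
  ⟨fun _ _ _ => trivial, fun _ _ _ => trivial, fun _ _ _ => trivial, fun _ _ _ => trivial,
    fun _ _ _ _ => trivial⟩

theorem isClosedClass_isFinitary (D : Type u) [Finite D] :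
    IsClosedClass (σ := σ) (k := k) (fun _ φ => φ.IsFinitary) D :=
  ⟨fun _ _ _ => trivial, fun _ _ _ => trivial, fun _ _ h => h, fun _ _ h => ⟨inferInstance, h⟩,
    fun _ _ _ h => h⟩

/-- Two assignments agree on the formulas in `Φ`. -/
def Agree (Φ : ∀ s : Set (Fin k), VarFormula σ k s → Prop) (A B : Str σ) {s : Set (Fin k)}
    (f : s → A.carrier) (g : s → B.carrier) : Prop :=
  ∀ φ, Φ s φ → (φ.Realize A f ↔ φ.Realize B g)

variable {Φ : ∀ s : Set (Fin k), VarFormula σ k s → Prop} {A B : Str σ} {s : Set (Fin k)}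
  {f : s → A.carrier} {g : s → B.carrier}

theorem Agree.symm (h : Agree Φ A B f g) : Agree Φ B A g f := fun φ hφ => (h φ hφ).symm

/-- If no `b` matched `a`, each `b` would have a formula `φ b` in `Φ` that holds for `a` and fails
for `b`. Then `∀ x, ¬ ⋀ b, φ b` would hold in `B` but not in `A`. The conjunction is indexed by the
elements of `B`. -/
theorem Agree.forth (h : Agree Φ A B f g) (hΦ : IsClosedClass Φ B.carrier) (x : Fin k)
    (a : A.carrier) : ∃ b, Agree Φ A B (update f x a) (update g x b) := by
  by_contra hne
  have key : ∀ b, ∃ φ, Φ _ φ ∧ φ.Realize A (update f x a) ∧ ¬ φ.Realize B (update g x b) := by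
    intro b
    by_contra hb
    refine hne ⟨b, fun φ hφ => ⟨fun hA => ?_, fun hB => ?_⟩⟩
    · by_contra hB
      exact hb ⟨φ, hφ, hA, hB⟩
    · by_contra hA
      -- A formula that separates in the opposite direction is replaced by its negation.
      exact hb ⟨.neg φ, hΦ.neg _ _ hφ, hA, fun h => h hB⟩
  choose φ hφ hA hB using key
  have h1 := h (.all x (.neg (.conj B.carrier φ))) (hΦ.all _ _ _ (hΦ.neg _ _ (hΦ.conj _ _ hφ)))
  exact h1.2 (fun b hb => hB b (hb b)) a hA

theorem Agree.rel_iff (h : Agree Φ A B f g) {D : Type u} (hΦ : IsClosedClass Φ D) (R : σ.Rel)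
    (t : Fin (σ.arity R) → s ⊕ σ.Const) :
    (A.rel R fun i => Sum.elim f A.con (t i)) ↔ B.rel R fun i => Sum.elim g B.con (t i) := by
  have h1 : ∀ (D : Str σ) (f : s → D.carrier), termVal D f = Sum.elim f D.con := fun D f => by
    funext t
    cases t <;> rfl
  have h2 := h (.rel R t) (hΦ.rel _ _ _)
  unfold Realize at h2
  rwa [h1, h1] at h2

theorem Agree.eq_iff (h : Agree Φ A B f g) {D : Type u} (hΦ : IsClosedClass Φ D)
    (t t' : s ⊕ σ.Const) :
    Sum.elim f A.con t = Sum.elim f A.con t' ↔ Sum.elim g B.con t = Sum.elim g B.con t' := by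
  have h1 : ∀ (D : Str σ) (f : s → D.carrier), termVal D f = Sum.elim f D.con := fun D f => by
    funext t
    cases t <;> rfl
  have h2 := h (.equal t t') (hΦ.equal _ _ _)
  unfold Realize at h2
  rwa [h1, h1] at h2

end VarFormula

/-! ### The pebble game and `k`-variable logic -/

namespace Pebble

variable {σ : Signature.{u}} {k : ℕ} {A B : Str σ}

section Selection

variable {X : Type u} {m : ℕ} {s : Set (Fin k)}

/-- `t` selects, for every pebble in `s`, its last occurrence in `v`. -/
def Selects (v : Fin m → Fin k × X) (t : s → Fin m) : Prop :=
  ∀ x, (v (t x)).1 = x ∧ ∀ r, t x < r → (v r).1 ≠ x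

open Classical in
/-- The selection after the pebble `x` has been moved. -/
noncomputable def selectUpdate (t : s → Fin m) (x : Fin k) : ↥(insert x s) → Fin (m + 1) :=
  fun y => if h : y.1 = x then Fin.last m
    else (t ⟨y.1, (Set.mem_insert_iff.mp y.2).resolve_left h⟩).castSucc

/-- The new letter is the last occurrence of `x` and does not disturb those of the other pebbles. -/
theorem Selects.snoc {v : Fin m → Fin k × X} {t : s → Fin m} (h : Selects v t) (x : Fin k)
    (c : X) : Selects (Fin.snoc (α := fun _ => Fin k × X) v (x, c)) (selectUpdate t x) := by
  intro y
  unfold selectUpdate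
  by_cases hy : y.1 = x
  · rw [dif_pos hy]
    refine ⟨?_, fun r hr => absurd hr (not_lt.2 (Fin.le_last r))⟩
    rw [Fin.snoc_last]
    exact hy.symm
  · rw [dif_neg hy]
    refine ⟨?_, fun r => ?_⟩
    · rw [Fin.snoc_castSucc]
      exact (h _).1
    · refine Fin.lastCases (fun _ => ?_) (fun r hr => ?_) r
      · rw [Fin.snoc_last]
        exact Ne.symm hy
      · rw [Fin.snoc_castSucc]
        exact (h _).2 r hr

/-- Moving the pebble `x` is the same as reassigning the variable `x`; this matches moves with
quantifiers. -/
theorem comp_selectUpdate {Y : Type u} (f : X → Y) (v : Fin m → Fin k × X) (t : s → Fin m)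
    (x : Fin k) (c : X) :
    (fun y => f (Fin.snoc (α := fun _ => Fin k × X) v (x, c) (selectUpdate t x y)).2) =
      VarFormula.update (fun y => f (v (t y)).2) x (f c) := by
  funext y
  unfold selectUpdate VarFormula.update
  by_cases hy : y.1 = x
  · rw [dif_pos hy, dif_pos hy, Fin.snoc_last]
  · rw [dif_neg hy, dif_neg hy, Fin.snoc_castSucc]

end Selection

/-- The winning condition of the game for `P_k`, in terms of atomic formulas. -/
theorem reflect_of_rel_iff {m : ℕ} {v : Fin m → Fin k × (A.prod B).carrier} {s : Set (Fin k)}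
    {t : s → Fin m} (ht : Selects v t) (hs : ∀ i, (∀ r, i < r → (v r).1 ≠ (v i).1) → (v i).1 ∈ s)
    (h : ∀ (R : σ.Rel) (τ : Fin (σ.arity R) → s ⊕ σ.Const),
      (A.rel R fun i => Sum.elim (fun x => (v (t x)).2.1) A.con (τ i)) ↔
        B.rel R fun i => Sum.elim (fun x => (v (t x)).2.2) B.con (τ i))
    {R : σ.Rel} {w : Fin (σ.arity R) → Carrier k (A.prod B)}
    (hw : ∀ i, (∃ c, w i = Sum.inr c) ∨ ∃ l, w i = Sum.inl (initSeg v l))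
    (htop : ∀ l : Fin m, l.1 + 1 = m → ∃ i, w i = Sum.inl (initSeg v l)) :
    (((obj k A).rel R fun i => StrHom.toFun ((comonad σ k).map (A.fst B)) (w i)) →
      B.rel R fun i => (eps (A.prod B) (w i)).2) ∧
    (((obj k B).rel R fun i => StrHom.toFun ((comonad σ k).map (A.snd B)) (w i)) →
      A.rel R fun i => (eps (A.prod B) (w i)).1) := by
  have key : ∀ {D : Str σ} (f : A.prod B ⟶ D),
      ((obj k D).rel R fun i => StrHom.toFun ((comonad σ k).map f) (w i)) →
      ∀ i, ∃ τ : s ⊕ σ.Const,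
        (eps _ (w i)).1 = Sum.elim (fun x => (v (t x)).2.1) A.con τ ∧
        (eps _ (w i)).2 = Sum.elim (fun x => (v (t x)).2.2) B.con τ := by
    intro D f hR i
    rcases hw i with ⟨c, hc⟩ | ⟨l, hl⟩
    · refine ⟨Sum.inr c, ?_⟩
      rw [hc]
      exact ⟨rfl, rfl⟩
    · have hm : 0 < m := lt_of_le_of_lt (Nat.zero_le _) l.2
      obtain ⟨j, hj⟩ := htop ⟨m - 1, by omega⟩ (by simp only; omega)
      -- The tuple attains the whole of `v`, so activity of the word at `l` says that its pebble is
      -- not moved later. Hence `l` is the occurrence selected by `t`, and the entry is the value of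
      -- a variable in `s`.
      have hlast : ∀ r, l < r → (v r).1 ≠ (v l).1 := by
        have h1 : ∀ i w', w i = Sum.inl w' → StrHom.toFun ((comonad σ k).map f) (w i) =
            (Sum.inl (w'.map (Prod.map id (StrHom.toFun f))) : Carrier k D) := by
          intro i w' hw'
          rw [hw']
          rfl
        have h2 := active_of_map (StrHom.toFun f) (hR.2.1 i j _ _ (h1 i _ hl) (h1 j _ hj)
          ⟨⟨l.1, by have := l.2; change l.1 < m - 1 + 1; omega⟩, rfl⟩)
        intro r hr
        exact h2 ⟨r.1, by have := r.2; change r.1 < m - 1 + 1; omega⟩ hr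
      have htl : t ⟨(v l).1, hs l hlast⟩ = l := by
        obtain ⟨h1, h2⟩ := ht ⟨(v l).1, hs l hlast⟩
        rcases lt_trichotomy (t ⟨(v l).1, hs l hlast⟩) l with h3 | h3 | h3
        · exact absurd rfl (h2 l h3)
        · exact h3
        · exact absurd h1 (hlast _ h3)
      refine ⟨Sum.inl ⟨(v l).1, hs l hlast⟩, ?_⟩
      rw [hl, Sum.elim_inl, Sum.elim_inl, htl]
      exact ⟨rfl, rfl⟩
  refine ⟨fun hA => ?_, fun hB => ?_⟩
  · choose τ h1 h2 using key (A.fst B) hA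
    have h3 : ∀ i, eps A (StrHom.toFun ((comonad σ k).map (A.fst B)) (w i)) =
        Sum.elim (fun x => (v (t x)).2.1) A.con (τ i) :=
      fun i => (Str.congr_toFun ((comonad σ k).ε.naturality (A.fst B)) (w i)).trans (h1 i)
    have h4 := hA.2.2
    simp only [h3] at h4
    simp only [h2]
    exact (h R τ).1 h4
  · choose τ h1 h2 using key (A.snd B) hB
    have h3 : ∀ i, eps B (StrHom.toFun ((comonad σ k).map (A.snd B)) (w i)) =
        Sum.elim (fun x => (v (t x)).2.2) B.con (τ i) :=
      fun i => (Str.congr_toFun ((comonad σ k).ε.naturality (A.snd B)) (w i)).trans (h2 i)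
    have h4 := hB.2.2
    simp only [h3] at h4
    simp only [h1]
    exact (h R τ).2 h4

/-- The positions at which the placements of the pebbles in `A` and in `B` agree on all formulas
in `Φ`. -/
def Agree (Φ : ∀ s : Set (Fin k), VarFormula σ k s → Prop) (A B : Str σ) (m : ℕ)
    (v : Fin m → Fin k × (A.carrier × B.carrier)) : Prop :=
  ∃ (s : Set (Fin k)) (t : s → Fin m), Selects v t ∧
    (∀ i, (∀ r, i < r → (v r).1 ≠ (v i).1) → (v i).1 ∈ s) ∧
    VarFormula.Agree Φ A B (fun x => (v (t x)).2.1) fun x => (v (t x)).2.2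

theorem mem_insert_of_last {X : Type u} {m : ℕ} {v : Fin m → Fin k × X} {s : Set (Fin k)}
    (hs : ∀ i, (∀ r, i < r → (v r).1 ≠ (v i).1) → (v i).1 ∈ s) (x : Fin k) (c : X) :
    let v' := Fin.snoc (α := fun _ => Fin k × X) v (x, c)
    ∀ i, (∀ r, i < r → (v' r).1 ≠ (v' i).1) → (v' i).1 ∈ insert x s := by
  intro v' i
  refine Fin.lastCases (fun _ => ?_) (fun i hi => ?_) i
  · change (Fin.snoc (α := fun _ => Fin k × X) v (x, c) (Fin.last m)).1 ∈ _
    rw [Fin.snoc_last]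
    exact Set.mem_insert x s
  · have h1 : ∀ j : Fin m, v' j.castSucc = v j := fun j =>
      Fin.snoc_castSucc (α := fun _ => Fin k × X) (x, c) v j
    rw [h1] at hi ⊢
    refine Set.mem_insert_of_mem x (hs i fun r hr => ?_)
    have h2 := hi r.castSucc hr
    rwa [h1] at h2

variable {Φ : ∀ s : Set (Fin k), VarFormula σ k s → Prop}

theorem Agree.forth (hΦ : VarFormula.IsClosedClass Φ B.carrier) {m : ℕ}
    {v : Fin m → Fin k × (A.carrier × B.carrier)} (h : Agree Φ A B m v) (x : Fin k)
    (a : A.carrier) : ∃ b, Agree Φ A B (m + 1)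
      (Fin.snoc (α := fun _ => Fin k × (A.carrier × B.carrier)) v (x, (a, b))) := by
  obtain ⟨s, t, ht, hs, hE⟩ := h
  obtain ⟨b, hb⟩ := hE.forth hΦ x a
  refine ⟨b, insert x s, selectUpdate t x, ht.snoc x _, mem_insert_of_last hs x _, ?_⟩
  rw [comp_selectUpdate Prod.fst, comp_selectUpdate Prod.snd]
  exact hb

theorem Agree.back (hΦ : VarFormula.IsClosedClass Φ A.carrier) {m : ℕ}
    {v : Fin m → Fin k × (A.carrier × B.carrier)} (h : Agree Φ A B m v) (x : Fin k)
    (b : B.carrier) : ∃ a, Agree Φ A B (m + 1)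
      (Fin.snoc (α := fun _ => Fin k × (A.carrier × B.carrier)) v (x, (a, b))) := by
  obtain ⟨s, t, ht, hs, hE⟩ := h
  obtain ⟨a, ha⟩ := hE.symm.forth hΦ x b
  refine ⟨a, insert x s, selectUpdate t x, ht.snoc x _, mem_insert_of_last hs x _, ?_⟩
  rw [comp_selectUpdate Prod.fst, comp_selectUpdate Prod.snd]
  exact ha.symm

/-- Moves in `A` are answered by conjunctions over `B`, and moves in `B` by conjunctions over `A`;
so closure under both index types is required. -/
theorem strategy_agree (hA : VarFormula.IsClosedClass Φ A.carrier)
    (hB : VarFormula.IsClosedClass Φ B.carrier)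
    (h : ∀ φ : VarFormula σ k ∅, Φ ∅ φ → (φ.Sat A ↔ φ.Sat B)) :
    (wordComonad σ.addI k).Strategy A.withI B.withI (Agree Φ A B) where
  zero := by
    refine ⟨∅, fun x => x.2.elim, fun x => x.2.elim, fun i => i.elim0, fun φ hφ => ?_⟩
    have h1 := h φ hφ
    unfold VarFormula.Sat at h1
    convert h1 using 2 <;> exact Subsingleton.elim _ _
  valid _ _ _ := ⟨⟨_, rfl⟩, ⟨_, rfl⟩⟩
  reflect m v hv R s hs htop := by
    obtain ⟨s, t, ht, hs', hE⟩ := hv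
    refine reflect_of_rel_iff (v := v) ht hs' (fun R τ => ?_) hs htop
    cases R with
    | some R => exact hE.rel_iff hA R τ
    | none => exact hE.eq_iff hA (τ (0 : Fin 2)) (τ (1 : Fin 2))
  forth _ _ hv κ a _ := Agree.forth hB hv κ a
  back _ _ hv κ b _ := Agree.back hA hv κ b

/-- Structures that agree on infinitary `k`-variable sentences are connected by a span of open
pathwise-embeddings. -/
theorem isSpanned_of_infVarEquiv (h : InfVarEquiv k A B) :
    IsSpanned (strongInj σ.addI) (comonad σ.addI k) (path σ.addI k) A.withI B.withI :=
  (strategy_agree (VarFormula.isClosedClass_true _) (VarFormula.isClosedClass_true _)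
    fun φ _ => h φ).isSpanned

/-- Finite structures that agree on first-order `k`-variable sentences are connected by a span of
open pathwise-embeddings. -/
theorem isSpanned_of_varEquiv [Finite A.carrier] [Finite B.carrier] (h : VarEquiv k A B) :
    IsSpanned (strongInj σ.addI) (comonad σ.addI k) (path σ.addI k) A.withI B.withI :=
  (strategy_agree (VarFormula.isClosedClass_isFinitary _)
    (VarFormula.isClosedClass_isFinitary _) h).isSpanned

/-- Selected positions are last occurrences, so their words are active in each other wherever
comparison requires it; what is left is the relation between last elements. -/
theorem rel_initSeg_iff {m : ℕ} {d : Fin m → Fin k × A.carrier} {s : Set (Fin k)} {t : s → Fin m}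
    (ht : Selects d t) (R : σ.Rel) (τ : Fin (σ.arity R) → s ⊕ σ.Const) :
    ((obj k A).rel R fun i => Sum.elim (fun x => Sum.inl (initSeg d (t x))) Sum.inr (τ i)) ↔
      A.rel R fun i => Sum.elim (fun x => (d (t x)).2) A.con (τ i) := by
  have hε : ∀ τ : s ⊕ σ.Const,
      eps (k := k) A (Sum.elim (fun x => Sum.inl (initSeg d (t x))) Sum.inr τ) =
        Sum.elim (fun x => (d (t x)).2) A.con τ := by
    rintro (x | c) <;> rfl
  have h1 : ∀ (τ : s ⊕ σ.Const) w,
      (Sum.elim (fun x => Sum.inl (initSeg d (t x))) Sum.inr τ : Carrier k A) = Sum.inl w →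
      ∃ x, w = initSeg d (t x) := by
    rintro (x | c) w hw
    · exact ⟨x, (Sum.inl.inj hw).symm⟩
    · cases hw
  refine Iff.trans (and_iff_right ?_) (Iff.trans (and_iff_right ?_)
    (Iff.of_eq (congrArg (A.rel R) (funext fun i => hε (τ i)))))
  · intro i j w w' hw hw'
    obtain ⟨x, rfl⟩ := h1 _ w hw
    obtain ⟨x', rfl⟩ := h1 _ w' hw'
    exact comparable_initSeg d _ _
  · intro i j w w' hw hw' _ r hr
    obtain ⟨x, rfl⟩ := h1 _ w hw
    obtain ⟨x', rfl⟩ := h1 _ w' hw'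
    have h2 := (ht x).2 (Fin.castLE (t x').2 r) hr
    rw [← (ht x).1] at h2
    exact h2

/-- The two sides of a position carry the same pebble indices, so one selection serves both. -/
theorem backForth_rel_iff
    {T : ∀ m, (Fin m → Fin k × A.carrier) → (Fin m → Fin k × B.carrier) → Prop}
    (hT : (wordComonad σ k).BackForth A B T) {m : ℕ} {a : Fin m → Fin k × A.carrier}
    {b : Fin m → Fin k × B.carrier} (hab : T m a b) {s : Set (Fin k)} {t : s → Fin m}
    (ht : Selects a t) (R : σ.Rel) (τ : Fin (σ.arity R) → s ⊕ σ.Const) :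
    (A.rel R fun i => Sum.elim (fun x => (a (t x)).2) A.con (τ i)) ↔
      B.rel R fun i => Sum.elim (fun x => (b (t x)).2) B.con (τ i) := by
  have ht' : Selects b t := by
    intro x
    rw [← hT.index m a b hab]
    exact ⟨(ht x).1, fun r hr => by rw [← hT.index m a b hab]; exact (ht x).2 r hr⟩
  refine (rel_initSeg_iff ht R τ).symm.trans (Iff.trans ?_ (rel_initSeg_iff ht' R τ))
  refine hT.rel_iff m a b hab R _ _ fun i => ?_
  cases τ i with
  | inl x => exact Or.inr ⟨t x, rfl, rfl⟩
  | inr c => exact Or.inl ⟨c, rfl, rfl⟩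

/-- The induction is over all positions and selections at once: the values of the free variables are
read off at the last occurrences of their pebbles, and quantifying `x` is moving pebble `x`. All
words are valid, so the number of moves is not bounded. -/
theorem realize_iff_of_backForth
    {T : ∀ m, (Fin m → Fin k × A.carrier) → (Fin m → Fin k × B.carrier) → Prop}
    (hT : (wordComonad σ.addI k).BackForth A.withI B.withI T) {s : Set (Fin k)}
    (φ : VarFormula σ k s) : ∀ {m : ℕ} (a : Fin m → Fin k × A.carrier)
    (b : Fin m → Fin k × B.carrier) (_ : T m a b) (t : s → Fin m) (_ : Selects a t),
    φ.Realize A (fun x => (a (t x)).2) ↔ φ.Realize B fun x => (b (t x)).2 := by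
  have hval : ∀ (D : Str σ) (s : Set (Fin k)) (f : s → D.carrier),
      VarFormula.termVal D f = Sum.elim f D.con := fun D s f => by
    funext t
    cases t <;> rfl
  induction φ with
  | rel R τ =>
    intro m a b hab t ht
    unfold VarFormula.Realize
    rw [hval, hval]
    exact backForth_rel_iff hT hab ht (some R) τ
  | equal τ τ' =>
    intro m a b hab t ht
    unfold VarFormula.Realize
    rw [hval, hval]
    exact backForth_rel_iff hT hab ht none (fun i : Fin 2 => ![τ, τ'] i)
  | neg φ ih =>
    intro m a b hab t ht
    exact not_congr (ih a b hab t ht)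
  | conj ι φ ih =>
    intro m a b hab t ht
    exact forall_congr' fun i => ih i a b hab t ht
  | all x φ ih =>
    intro m a b hab t ht
    constructor
    · intro hA y
      obtain ⟨c, hc⟩ : ∃ c : A.carrier,
          T (m + 1) (Fin.snoc (α := fun _ => Fin k × A.carrier) a (x, c))
            (Fin.snoc (α := fun _ => Fin k × B.carrier) b (x, y)) :=
        hT.back m a b hab x y ⟨_, rfl⟩
      have h1 := ih _ _ hc _ (ht.snoc x c)
      rw [comp_selectUpdate (fun z => z), comp_selectUpdate (fun z => z)] at h1
      exact h1.1 (hA c)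
    · intro hB y
      obtain ⟨c, hc⟩ : ∃ c : B.carrier,
          T (m + 1) (Fin.snoc (α := fun _ => Fin k × A.carrier) a (x, y))
            (Fin.snoc (α := fun _ => Fin k × B.carrier) b (x, c)) :=
        hT.forth m a b hab x y ⟨_, rfl⟩
      have h1 := ih _ _ hc _ (ht.snoc x y)
      rw [comp_selectUpdate (fun z => z), comp_selectUpdate (fun z => z)] at h1
      exact h1.2 (hB c)

/-- Structures that are connected by a span of open pathwise-embeddings agree on infinitary
`k`-variable sentences. -/
theorem infVarEquiv_of_isSpanned
    (h : IsSpanned (strongInj σ.addI) (comonad σ.addI k) (path σ.addI k) A.withI B.withI) :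
    InfVarEquiv k A B := by
  obtain ⟨T, hT⟩ := (wordComonad σ.addI k).exists_backForth h
  intro φ
  have h1 := realize_iff_of_backForth hT φ _ _ hT.zero (fun x => x.2.elim) fun x => x.2.elim
  unfold VarFormula.Sat
  convert h1 using 2 <;> exact Subsingleton.elim _ _

end Pebble

/-! ### Modal formulas of bounded depth -/

namespace ModalFormula

variable {P : Type u}

/-- Conjunction of a list of formulas. -/
def conjList : List (ModalFormula P) → ModalFormula P
  | [] => imp falsum falsum
  | φ :: L => imp (imp φ (imp (conjList L) falsum)) falsum

theorem depth_conjList {r : ℕ} (L : List (ModalFormula P)) (h : ∀ φ ∈ L, φ.depth ≤ r) :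
    (conjList L).depth ≤ r := by
  induction L with
  | nil => exact Nat.zero_le r
  | cons φ L ih =>
    rw [List.forall_mem_cons] at h
    have h1 := ih h.2
    have h2 := h.1
    simp only [conjList, depth]
    omega

theorem holds_conjList (A : Str (modalSig P)) (x : A.carrier) (L : List (ModalFormula P)) :
    (conjList L).Holds A x ↔ ∀ φ ∈ L, φ.Holds A x := by
  induction L with
  | nil => simp [conjList, Holds]
  | cons φ L ih =>
    rw [List.forall_mem_cons, ← ih]
    simp only [conjList, Holds]
    tauto

/-- Truth values for the formulas in `F`, as a formula. -/
noncomputable def typeFormula {ι : Type u} [Finite ι] (F : ι → ModalFormula P) (T : Set ι) :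
    ModalFormula P :=
  open Classical in
  let _ := Fintype.ofFinite ι
  conjList ((Finset.univ : Finset ι).toList.map fun i => if i ∈ T then F i else imp (F i) falsum)

theorem depth_typeFormula {ι : Type u} [Finite ι] {F : ι → ModalFormula P} {r : ℕ}
    (h : ∀ i, (F i).depth ≤ r) (T : Set ι) : (typeFormula F T).depth ≤ r := by
  classical
  refine depth_conjList _ fun φ hφ => ?_
  obtain ⟨i, -, rfl⟩ := List.mem_map.1 hφ
  by_cases hi : i ∈ T
  · simp only [hi, if_true]
    exact h i
  · simp only [hi, if_false]
    exact max_le (h i) (Nat.zero_le r)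

theorem holds_typeFormula {ι : Type u} [Finite ι] (F : ι → ModalFormula P) (T : Set ι)
    (A : Str (modalSig P)) (x : A.carrier) :
    (typeFormula F T).Holds A x ↔ ∀ i, (F i).Holds A x ↔ i ∈ T := by
  classical
  unfold typeFormula
  rw [holds_conjList]
  simp only [List.forall_mem_map, Finset.mem_toList, Finset.mem_univ, forall_const]
  refine forall_congr' fun i => ?_
  by_cases hi : i ∈ T
  · simp [hi]
  · simp [hi, Holds]

/-- The dual of `box`. -/
def dia (φ : ModalFormula P) : ModalFormula P := imp (box (imp φ falsum)) falsum

theorem holds_dia (A : Str (modalSig P)) (x : A.carrier) (φ : ModalFormula P) :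
    (dia φ).Holds A x ↔ ∃ y, Modal.acc A x y ∧ φ.Holds A y := by
  constructor
  · intro h
    by_contra hne
    exact h fun y hy hφ => hne ⟨y, hy, hφ⟩
  · rintro ⟨y, hy, hφ⟩ h
    exact h y hy hφ

/-- The formula `◇ τ`, where `τ` is the type of `x'`, holds at `x` and hence at `y`. -/
theorem exists_successor {A B : Str (modalSig P)} {ι : Type u} [Finite ι]
    {F : ι → ModalFormula P} {x : A.carrier} {y : B.carrier}
    (h : ∀ T : Set ι, (dia (typeFormula F T)).Holds A x → (dia (typeFormula F T)).Holds B y)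
    {x' : A.carrier} (hx : Modal.acc A x x') :
    ∃ y', Modal.acc B y y' ∧ ∀ i, (F i).Holds A x' ↔ (F i).Holds B y' := by
  have h1 := h {i | (F i).Holds A x'}
    ((holds_dia _ _ _).2 ⟨x', hx, (holds_typeFormula _ _ _ _).2 fun i => Iff.rfl⟩)
  obtain ⟨y', hy, hy'⟩ := (holds_dia _ _ _).1 h1
  exact ⟨y', hy, fun i => ((holds_typeFormula _ _ _ _).1 hy' i).symm⟩

/-- Finitely many formulas determine those of bounded depth. -/
theorem exists_finite_determining [Finite P] (r : ℕ) :
    ∃ (ι : Type u) (_ : Finite ι) (F : ι → ModalFormula P), (∀ i, (F i).depth ≤ r) ∧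
      ∀ (A B : Str (modalSig P)) (x : A.carrier) (y : B.carrier),
        (∀ i, (F i).Holds A x ↔ (F i).Holds B y) →
        ∀ φ : ModalFormula P, φ.depth ≤ r → (φ.Holds A x ↔ φ.Holds B y) := by
  induction r with
  | zero =>
    refine ⟨P, inferInstance, atom, fun i => le_rfl, fun A B x y h φ => ?_⟩
    induction φ with
    | atom p => exact fun _ => h p
    | falsum => exact fun _ => Iff.rfl
    | imp φ ψ ih₁ ih₂ =>
      intro hr
      have hr' := max_le_iff.1 hr
      exact imp_congr (ih₁ hr'.1) (ih₂ hr'.2)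
    | box φ => exact fun hr => absurd hr (Nat.not_succ_le_zero _)
  | succ r ih =>
    obtain ⟨ι, _, F, hF, hdet⟩ := ih
    refine ⟨ι ⊕ Set ι, inferInstance, Sum.elim F fun T => dia (typeFormula F T), ?_,
      fun A B x y h φ => ?_⟩
    · rintro (i | T)
      · exact (hF i).trans (Nat.le_succ r)
      · have := depth_typeFormula hF T
        simp only [Sum.elim_inr, dia, depth]
        omega
    · have h₀ := hdet A B x y fun i => h (Sum.inl i)
      induction φ with
      | atom p => exact fun _ => h₀ _ (Nat.zero_le r)
      | falsum => exact fun _ => Iff.rfl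
      | imp φ ψ ih₁ ih₂ =>
        intro hr
        have hr' := max_le_iff.1 hr
        exact imp_congr (ih₁ hr'.1) (ih₂ hr'.2)
      | box φ =>
        intro hr
        have hr' := Nat.succ_le_succ_iff.1 hr
        constructor
        · intro hA y' hy'
          obtain ⟨x', hx', hxy⟩ := exists_successor (fun T => (h (Sum.inr T)).2) hy'
          exact (hdet _ _ _ _ hxy φ hr').2 (hA x' hx')
        · intro hB x' hx'
          obtain ⟨y', hy', hxy⟩ := exists_successor (fun T => (h (Sum.inr T)).1) hx'
          exact (hdet _ _ _ _ hxy φ hr').2 (hB y' hy')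

end ModalFormula

/-! ### The modal game and modal depth -/

namespace Modal

variable {P : Type u} {k : ℕ} {A B : Str (modalSig P)}

/-- The last element of a position, or the distinguished point. -/
def cur (A : Str (modalSig P)) : ∀ {m : ℕ}, (Fin m → Unit × A.carrier) → A.carrier
  | 0, _ => point A
  | m + 1, a => (a (Fin.last m)).2

theorem cur_snoc {m : ℕ} (a : Fin m → Unit × A.carrier) (x : Unit × A.carrier) :
    cur A (Fin.snoc (α := fun _ => Unit × A.carrier) a x) = x.2 :=
  congrArg Prod.snd (Fin.snoc_last (α := fun _ => Unit × A.carrier) x a)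

theorem valid_iff {w : Word (Unit × A.carrier)} :
    (wordComonad P k).Valid A w ↔ w.len < k ∧ IsWalk A (w.map Prod.snd) := exists_word_iff

/-- Only the last step of the extended walk is new. It starts at the distinguished point when `a` is
empty, which is why `cur` takes that default value. -/
theorem valid_snoc_iff {m : ℕ} {a : Fin m → Unit × A.carrier}
    (ha : ∀ i, (wordComonad P k).Valid A (initSeg a i)) (κ : Unit) (x : A.carrier) :
    (wordComonad P k).Valid A ⟨m, Fin.snoc (α := fun _ => Unit × A.carrier) a (κ, x)⟩ ↔
      m < k ∧ acc A (cur A a) x := by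
  rw [valid_iff]
  refine and_congr Iff.rfl ?_
  have hlast : (Fin.snoc (α := fun _ => Unit × A.carrier) a (κ, x) (Fin.last m)).2 = x :=
    cur_snoc a (κ, x)
  have hcast : ∀ i : Fin m, (Fin.snoc (α := fun _ => Unit × A.carrier) a (κ, x) i.castSucc) = a i :=
    fun i => Fin.snoc_castSucc (α := fun _ => Unit × A.carrier) (κ, x) a i
  cases m with
  | zero =>
    constructor
    · intro h
      have h1 : acc A (point A)
        (Fin.snoc (α := fun _ => Unit × A.carrier) a (κ, x) (Fin.last 0)).2 := h.1
      rwa [hlast] at h1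
    · intro h
      refine ⟨?_, fun i hi => absurd hi (by change ¬ i + 1 < 0 + 1; omega)⟩
      change acc A (point A)
        (Fin.snoc (α := fun _ => Unit × A.carrier) a (κ, x) (Fin.last 0)).2
      rwa [hlast]
  | succ m =>
    have hw := (valid_iff.1 (ha (Fin.last m))).2
    have hcur : (Fin.snoc (α := fun _ => Unit × A.carrier) a (κ, x) (Fin.last m).castSucc).2 =
        cur A a := by
      rw [hcast]
      rfl
    constructor
    · intro h
      have h1 : acc A (Fin.snoc (α := fun _ => Unit × A.carrier) a (κ, x) (Fin.last m).castSucc).2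
        (Fin.snoc (α := fun _ => Unit × A.carrier) a (κ, x) (Fin.last (m + 1))).2 :=
        h.2 m (Nat.lt_succ_self _)
      rwa [hlast, hcur] at h1
    · intro h
      refine ⟨?_, fun i hi => ?_⟩
      · change acc A (point A)
          (Fin.snoc (α := fun _ => Unit × A.carrier) a (κ, x) (0 : Fin (m + 1)).castSucc).2
        rw [hcast]
        exact hw.1
      · rcases Nat.lt_or_eq_of_le (Nat.lt_succ_iff.1 hi) with hi' | hi'
        · change acc A
            (Fin.snoc (α := fun _ => Unit × A.carrier) a (κ, x)
              (⟨i, Nat.lt_of_succ_lt hi'⟩ : Fin (m + 1)).castSucc).2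
            (Fin.snoc (α := fun _ => Unit × A.carrier) a (κ, x)
              (⟨i + 1, hi'⟩ : Fin (m + 1)).castSucc).2
          rw [hcast, hcast]
          exact hw.2 i hi'
        · obtain rfl : i = m := Nat.succ.inj hi'
          change acc A
            (Fin.snoc (α := fun _ => Unit × A.carrier) a (κ, x) (Fin.last i).castSucc).2
            (Fin.snoc (α := fun _ => Unit × A.carrier) a (κ, x) (Fin.last (i + 1))).2
          rwa [hlast, hcur]

theorem valid_initSeg_snoc {m : ℕ} {a : Fin m → Unit × A.carrier}
    (ha : ∀ i, (wordComonad P k).Valid A (initSeg a i)) {x : Unit × A.carrier}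
    (hx : (wordComonad P k).Valid A ⟨m, Fin.snoc (α := fun _ => Unit × A.carrier) a x⟩) :
    ∀ i, (wordComonad P k).Valid A
      (initSeg (Fin.snoc (α := fun _ => Unit × A.carrier) a x) i) := by
  intro i
  refine Fin.lastCases hx (fun i => ?_) i
  rw [initSeg_snoc_castSucc]
  exact ha i

/-- The pairs of walks whose end points agree on all formulas of the remaining depth. -/
def Agree (k : ℕ) (A B : Str (modalSig P)) (m : ℕ)
    (v : Fin m → Unit × (A.carrier × B.carrier)) : Prop :=
  m ≤ k ∧
  (∀ i, (wordComonad P k).Valid A (initSeg (fun i => WordComonad.letter Unit Prod.fst (v i)) i)) ∧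
  (∀ i, (wordComonad P k).Valid B (initSeg (fun i => WordComonad.letter Unit Prod.snd (v i)) i)) ∧
  ∀ φ : ModalFormula P, φ.depth ≤ k - m →
    (φ.Holds A (cur A fun i => WordComonad.letter Unit Prod.fst (v i)) ↔
      φ.Holds B (cur B fun i => WordComonad.letter Unit Prod.snd (v i)))

theorem Agree.snoc {m : ℕ} {v : Fin m → Unit × (A.carrier × B.carrier)} (h : Agree k A B m v)
    (hm : m < k) (κ : Unit) {a : A.carrier} {b : B.carrier}
    (ha : acc A (cur A fun i => WordComonad.letter Unit Prod.fst (v i)) a)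
    (hb : acc B (cur B fun i => WordComonad.letter Unit Prod.snd (v i)) b)
    (hab : ∀ φ : ModalFormula P, φ.depth ≤ k - (m + 1) → (φ.Holds A a ↔ φ.Holds B b)) :
    Agree k A B (m + 1)
      (Fin.snoc (α := fun _ => Unit × (A.carrier × B.carrier)) v (κ, (a, b))) := by
  unfold Agree
  rw [Word.snoc_comp (WordComonad.letter Unit (Prod.fst : A.carrier × B.carrier → _)) v,
    Word.snoc_comp (WordComonad.letter Unit (Prod.snd : A.carrier × B.carrier → _)) v,
    cur_snoc, cur_snoc]
  exact ⟨hm, valid_initSeg_snoc h.2.1 ((valid_snoc_iff h.2.1 κ a).2 ⟨hm, ha⟩),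
    valid_initSeg_snoc h.2.2.1 ((valid_snoc_iff h.2.2.1 κ b).2 ⟨hm, hb⟩), hab⟩

/-- For unary predicates the tuple has a single entry, which must then be the one attaining the
position; over the empty position it is the constant. -/
theorem eps_eq_cur {m : ℕ} {v : Fin m → Unit × (A.prod B).carrier} {x : Carrier k (A.prod B)}
    (hx : (∃ c, word _ x = Sum.inr c) ∨ ∃ l, word _ x = Sum.inl (initSeg v l))
    (htop : ∀ l : Fin m, l.1 + 1 = m → word _ x = Sum.inl (initSeg v l)) :
    (eps _ x).1 = cur A (fun i => WordComonad.letter Unit Prod.fst (v i)) ∧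
      (eps _ x).2 = cur B fun i => WordComonad.letter Unit Prod.snd (v i) := by
  cases m with
  | zero =>
    rcases hx with ⟨c, hc⟩ | ⟨l, -⟩
    · have hc' : x = Sum.inr PUnit.unit := (wordComonad P k).eq_con hc
      rw [hc']
      exact ⟨rfl, rfl⟩
    · exact l.elim0
  | succ m =>
    have h1 : eps _ x = (initSeg v (Fin.last m)).last.2 :=
      (wordComonad P k).eps_word _ _ _ (htop (Fin.last m) rfl)
    rw [h1]
    exact ⟨rfl, rfl⟩

theorem strategy_agree [Finite P] (h : ModalEquiv k A B) :
    (wordComonad P k).Strategy A B (Agree k A B) where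
  zero := ⟨Nat.zero_le k, fun i => i.elim0, fun i => i.elim0, h⟩
  valid m v hv := ⟨hv.2.1 (Fin.last m), hv.2.2.1 (Fin.last m)⟩
  reflect m v hv R s hs htop := by
    have hε1 : ∀ x : Carrier k (A.prod B),
        eps A (StrHom.toFun ((comonad P k).map (A.fst B)) x) = (eps _ x).1 := fun x =>
      Str.congr_toFun ((comonad P k).ε.naturality (A.fst B)) x
    have hε2 : ∀ x : Carrier k (A.prod B),
        eps B (StrHom.toFun ((comonad P k).map (A.snd B)) x) = (eps _ x).2 := fun x =>
      Str.congr_toFun ((comonad P k).ε.naturality (A.snd B)) x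
    cases R with
    | prop p =>
      obtain ⟨h1, h2⟩ := eps_eq_cur (hs (0 : Fin 1)) fun l hl => by
        obtain ⟨i, hi⟩ := htop l hl
        rwa [Subsingleton.elim (α := Fin 1) i 0] at hi
      have h3 := hv.2.2.2 (.atom p) (Nat.zero_le _)
      unfold ModalFormula.Holds at h3
      refine ⟨fun hA => ?_, fun hB => ?_⟩
      · have h4 := (congrArg (holds A p) ((hε1 _).trans h1)).mp hA
        exact (holds_of_rel (A := B) p _).2 ((congrArg (holds B p) h2).mpr (h3.1 h4))
      · have h4 := (congrArg (holds B p) ((hε2 _).trans h2)).mp hB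
        exact (holds_of_rel (A := A) p _).2 ((congrArg (holds A p) h1).mpr (h3.2 h4))
    | E =>
      have hc : ∀ w w', word (A.prod B) (s (0 : Fin 2)) = Sum.inl w →
          word (A.prod B) (s (1 : Fin 2)) = Sum.inl w' → w.Comparable w' := by
        have h1 : ∀ (i : Fin 2) w, word (A.prod B) (s i) = Sum.inl w → ∃ l, w = initSeg v l := by
          intro i w hw
          rcases hs i with ⟨c, hc⟩ | ⟨l, hl⟩
          · cases hc.symm.trans hw
          · exact ⟨l, Sum.inl.inj (hw.symm.trans hl)⟩
        intro w w' hw hw'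
        obtain ⟨l, rfl⟩ := h1 _ w hw
        obtain ⟨l', rfl⟩ := h1 _ w' hw'
        exact comparable_initSeg v l l'
      refine ⟨fun hA => ?_, fun hB => ?_⟩
      -- Covering is visible in either projection, so a step in `A` comes from a step between walks
      -- in the product, and `E` holds there in both coordinates. No formula is involved.
      · have h1 := map_acc (A.snd B) (acc_eps_of_step (step_of_map (A.fst B) hc hA))
        exact (acc_of_rel (A := B) _).2 h1
      · have h1 := map_acc (A.fst B) (acc_eps_of_step (step_of_map (A.snd B) hc hB))
        exact (acc_of_rel (A := A) _).2 h1
  forth m v hv κ a ha := by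
    obtain ⟨hm, hacc⟩ := (valid_snoc_iff hv.2.1 κ a).1 ha
    obtain ⟨ι, _, F, hF, hdet⟩ := ModalFormula.exists_finite_determining (P := P) (k - (m + 1))
    obtain ⟨b, hb, hab⟩ := ModalFormula.exists_successor (F := F)
      (fun T => (hv.2.2.2 _ (by
        have := ModalFormula.depth_typeFormula hF T
        simp only [ModalFormula.dia, ModalFormula.depth]
        omega)).1) hacc
    exact ⟨b, Agree.snoc hv hm κ hacc hb (hdet A B a b hab)⟩
  back m v hv κ b hb := by
    obtain ⟨hm, hacc⟩ := (valid_snoc_iff hv.2.2.1 κ b).1 hb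
    obtain ⟨ι, _, F, hF, hdet⟩ := ModalFormula.exists_finite_determining (P := P) (k - (m + 1))
    obtain ⟨a, ha, hab⟩ := ModalFormula.exists_successor (F := F)
      (fun T => (hv.2.2.2 _ (by
        have := ModalFormula.depth_typeFormula hF T
        simp only [ModalFormula.dia, ModalFormula.depth]
        omega)).2) hacc
    exact ⟨a, Agree.snoc hv hm κ ha hacc (hdet A B a b fun i => (hab i).symm)⟩

/-- Pointed structures that agree on modal formulas of depth at most `k` are connected by a span
of open pathwise-embeddings. -/
theorem isSpanned_of_modalEquiv [Finite P] (h : ModalEquiv k A B) :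
    IsSpanned (strongInj (modalSig P)) (comonad P k) (path P k) A B :=
  (strategy_agree h).isSpanned

/-- The current point is represented by an element of the comonad, so that `BackForth.rel_iff`
applies to unary predicates. -/
theorem exists_cur {m : ℕ} {a : Fin m → Unit × A.carrier}
    (ha : ∀ i, (wordComonad P k).Valid A (initSeg a i)) :
    ∃ x : Carrier k A, eps A x = cur A a ∧
      (m = 0 → x = Sum.inr PUnit.unit) ∧ ∀ l : Fin m, l.1 + 1 = m → word A x =
        Sum.inl (initSeg a l) := by
  cases m with
  | zero => exact ⟨Sum.inr PUnit.unit, rfl, fun _ => rfl, fun l => l.elim0⟩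
  | succ m =>
    obtain ⟨x, hx⟩ := ha (Fin.last m)
    refine ⟨x, (wordComonad P k).eps_word _ _ _ hx, fun h => by omega, fun l hl => ?_⟩
    rw [show l = Fin.last m from Fin.ext (Nat.succ.inj hl)]
    exact hx

/-- Valid extensions of a position are the successors of its current point, provided that `m < k`;
thus moves are the instances of `box`, and the depth bound keeps them available. -/
theorem holds_iff_of_backForth
    {T : ∀ m, (Fin m → Unit × A.carrier) → (Fin m → Unit × B.carrier) → Prop}
    (hT : (wordComonad P k).BackForth A B T) (φ : ModalFormula P) : ∀ {m : ℕ}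
    (a : Fin m → Unit × A.carrier) (b : Fin m → Unit × B.carrier) (_ : T m a b)
    (_ : φ.depth ≤ k - m), φ.Holds A (cur A a) ↔ φ.Holds B (cur B b) := by
  induction φ with
  | atom p =>
    intro m a b hab _
    obtain ⟨x, hx, hx0, hx1⟩ := exists_cur fun i => (hT.valid m a b hab i).1
    obtain ⟨y, hy, hy0, hy1⟩ := exists_cur fun i => (hT.valid m a b hab i).2
    have h1 := hT.rel_iff m a b hab (ModalRel.prop p) (fun _ => x) (fun _ => y) fun _ => by
      cases m with
      | zero => exact Or.inl ⟨PUnit.unit, hx0 rfl, hy0 rfl⟩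
      | succ m => exact Or.inr ⟨Fin.last m, hx1 _ rfl, hy1 _ rfl⟩
    unfold ModalFormula.Holds
    rw [← hx, ← hy]
    exact h1
  | falsum => exact fun _ _ _ _ => Iff.rfl
  | imp φ ψ ih₁ ih₂ =>
    intro m a b hab hr
    have hr' := max_le_iff.1 hr
    exact imp_congr (ih₁ a b hab hr'.1) (ih₂ a b hab hr'.2)
  | box φ ih =>
    intro m a b hab hr
    have hr' : φ.depth + 1 ≤ k - m := hr
    have ha := fun i => (hT.valid m a b hab i).1
    have hb := fun i => (hT.valid m a b hab i).2
    constructor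
    · intro hA y hy
      obtain ⟨x, hx⟩ := hT.back m a b hab () y ((valid_snoc_iff hb () y).2 ⟨by omega, hy⟩)
      have hx' := ((valid_snoc_iff ha () x).1 (hT.valid _ _ _ hx (Fin.last m)).1).2
      have h1 := ih _ _ hx (by omega)
      rw [cur_snoc, cur_snoc] at h1
      exact h1.1 (hA x hx')
    · intro hB x hx
      obtain ⟨y, hy⟩ := hT.forth m a b hab () x ((valid_snoc_iff ha () x).2 ⟨by omega, hx⟩)
      have hy' := ((valid_snoc_iff hb () y).1 (hT.valid _ _ _ hy (Fin.last m)).2).2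
      have h1 := ih _ _ hy (by omega)
      rw [cur_snoc, cur_snoc] at h1
      exact h1.2 (hB y hy')

/-- Pointed structures that are connected by a span of open pathwise-embeddings agree on modal
formulas of depth at most `k`. -/
theorem modalEquiv_of_isSpanned
    (h : IsSpanned (strongInj (modalSig P)) (comonad P k) (path P k) A B) :
    ModalEquiv k A B := by
  obtain ⟨T, hT⟩ := (wordComonad P k).exists_backForth h
  exact fun φ hφ => holds_iff_of_backForth hT φ _ _ hT.zero hφ

end Modal

/-! ### The preservation theorems -/

theorem mainTheorem6 (k : ℕ) (hk : 0 < k) (n : ℕ) :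
    (∀ (σ : Fin n → Signature.{u}) (τ : Signature.{u}),
      (∀ i, Finite (σ i).Rel ∧ Finite (σ i).Const) →
      ∀ H : (∀ i, Discrete (Str (σ i))) ⥤ Discrete (Str τ),
        IsFOSmoothEF k H → Preserves H (fun _ => FOEquiv k) (FOEquiv k)) ∧
    (∀ (σ : Fin n → Signature.{u}) (τ : Signature.{u})
      (H : (∀ i, Discrete (Str (σ i))) ⥤ Discrete (Str τ)), IsFOSmoothPebble k H →
        Preserves H (fun _ => InfVarEquiv k) (InfVarEquiv k) ∧
        Preserves H (fun _ A B => Finite A.carrier ∧ Finite B.carrier ∧ VarEquiv k A B)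
          (VarEquiv k)) ∧
    (∀ (P : Fin n → Type u) (Q : Type u), (∀ i, Finite (P i)) → Finite Q →
      ∀ H : (∀ i, Discrete (Str (modalSig (P i)))) ⥤ Discrete (Str (modalSig Q)),
        IsSmoothModal k H → Preserves H (fun _ => ModalEquiv k) (ModalEquiv k)) := by
  refine ⟨fun σ τ hfin H hH A B hAB => ?_, fun σ τ H hH => ?_, fun P Q hP _ H hH A B hAB => ?_⟩
  · refine EF.foEquiv_of_isSpanned (IsSmoothRel.isSpanned hH Str.strongInj_of_comp
      (EF.wordComonad τ.addI k).exists_equalizer _ _ fun i => ?_)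
    have := (hfin i).1
    have := (hfin i).2
    exact EF.isSpanned_of_foEquiv (hAB i)
  · have key : ∀ A B : ∀ i, Str (σ i),
        (∀ i, IsSpanned (strongInj (σ i).addI) (Pebble.comonad (σ i).addI k)
          (Pebble.path (σ i).addI k) (A i).withI (B i).withI) →
        InfVarEquiv k (H.obj fun i => ⟨A i⟩).as (H.obj fun i => ⟨B i⟩).as := fun A B hAB =>
      Pebble.infVarEquiv_of_isSpanned (IsSmoothRel.isSpanned hH Str.strongInj_of_comp
        (Pebble.wordComonad τ.addI k).exists_equalizer _ _ hAB)
    refine ⟨fun A B hAB => key A B fun i => Pebble.isSpanned_of_infVarEquiv (hAB i),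
      -- For finite inputs, too, the span yields full infinitary equivalence of the outputs, of
      -- which agreement on finitary sentences is a special case.
      fun A B hAB φ _ => key A B (fun i => ?_) φ⟩
    obtain ⟨_, _, h⟩ := hAB i
    exact Pebble.isSpanned_of_varEquiv h
  · refine Modal.modalEquiv_of_isSpanned (IsSmoothRel.isSpanned hH Str.strongInj_of_comp
      (Modal.wordComonad Q k).exists_equalizer _ _ fun i => ?_)
    have := hP i
    exact Modal.isSpanned_of_modalEquiv (hAB i)
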